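/- Fix an algebraic closure $\overline{\mathbb Q}$ of $\mathbb Q$ and, for the imaginary case, an embedding $\iota:\overline{\mathbb Q}\to\mathbb C$. For a finite group $G$ let $G\wr S_2=(G\times G)\rtimes S_2$, where $\sigma\in S_2$ is the generator, and let $G'\subseteq G\wr S_2$ be a subgroup. $G'$ is \emph{admissible} if it contains $(1,\sigma)$, is generated by its elements of order $2$ with non-trivial image in $S_2$, and the kernel of $G'\to S_2$ surjects onto the first factor $G$; it is \emph{good} if its elements of order $2$ outside this kernel form a single non-empty conjugacy class of $G'$. For a quadratic field $K\subset\overline{\mathbb Q}$, an unramified extension $L/K$ is a finite Galois extension $L\subset\overline{\mathbb Q}$ of $K$, unramified at all finite and all infinite places; let $\tilde L$ be the Galois closure of $L$ over $\mathbb Q$. Given an isomorphism $\rho:\mathrm{Gal}(L/K)\to G$ and an element $y$ of order $2$ in $\mathrm{Gal}(\tilde L/\mathbb Q)\setminus \mathrm{Gal}(\tilde L/K)$ (a \emph{twist}), let $\phi:\mathrm{Gal}(\tilde L/\mathbb Q)\to G\wr S_2$ be the homomorphism with $\phi(x)=(\rho(x|_L),\rho((yxy^{-1})|_L))$ for $x\in\mathrm{Gal}(\tilde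 L/K)$ and $\phi(y)=(1,\sigma)$. The pair $(\rho,y)$ is of type $G'$ if $\phi$ has image $G'$. If $K$ is imaginary, $\rho$ is of type $G'$ if $(\rho,y)$ is, for $y$ the complex conjugation of $\tilde L$ induced by $\iota$. For $X>0$ let $\tilde N^+(X)$ be the number of quadruples $(K,L,\rho,y)$ with $K$ real quadratic, $|\mathrm{Disc}\,K|\le X$, $L/K$ unramified, and $(\rho,y)$ of type $G'$, and let $N^+(X)$ be the number of pairs $(K,L)$ that occur in such quadruples. Let $\tilde N^-(X)$ be the number of triples $(K,L,\rho)$ with $K$ imaginary quadratic, $|\mathrm{Disc}\,K|\le X$, $L/K$ unramified, and $\rho$ of type $G'$, and let $N^-(X)$ be the number of pairs $(K,L)$ that occur in such triples. Let $\tilde E^{\pm}(G,G')$ and $E^{\pm}(G,G')$ be the limits, as $X\to\infty$, of $\tilde N^{\pm}(X)$ and $N^{\pm}(X)$ divided by the number of real (for $+$), resp. imaginary (for $-$), quadratic fields $K\subset\overline{\mathbb Q}$ with $|\mathrm{Disc}\,K|\le X$. \textbf{Theorem.} Let $k\ge 1$, $G=C_2^k$, and $G'=\{(a,a,b): a\in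 G,\ b\in S_2\}\subseteq G\wr S_2$. Then $G'\cong C_2^{k+1}$, and $G'$ is admissible and not good. All the counts above are finite, and there are positive constants $\tilde c^{+},c^{+},\tilde c^{-},c^{-}$, depending only on $k$, such that, as $X\to\infty$, $$\tilde N^{\pm}(X)\sim \tilde c^{\pm}\,X(\log X)^{2^k-1},\qquad N^{\pm}(X)\sim c^{\pm}\,X(\log X)^{2^k-1}.$$ Hence $\tilde E^{\pm}(G,G')=\infty$ and $E^{\pm}(G,G')=\infty$. -/

import Mathlib

open Filter Topology Asymptotics

/-! ### Wreath products with `S₂` and subgroups of them -/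

/-- The wreath product `G ≀ S₂ = (G × G) ⋊ S₂`, with `S₂` permuting the two factors. -/
abbrev WreathTwo (G : Type*) [Group G] : Type _ :=
  (Fin 2 → G) ⋊[(mulAutArrow : Equiv.Perm (Fin 2) →* MulAut (Fin 2 → G))] Equiv.Perm (Fin 2)

/-- The element `(1, σ)` of `G ≀ S₂`, where `σ` is the generator of `S₂`. -/
def wreathSigma (G : Type*) [Group G] : WreathTwo G :=
  SemidirectProduct.inr (Equiv.swap 0 1)

/-- The elements of order `2` of `G'` that have non-trivial image in `S₂`. -/
def outerInvolutions {G : Type*} [Group G] (G' : Subgroup (WreathTwo G)) : Set (WreathTwo G) :=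
  {g | g ∈ G' ∧ orderOf g = 2 ∧ g.right ≠ 1}

/-- `G'` is admissible: it contains `(1, σ)`, it is generated by its elements of order `2` with
non-trivial image in `S₂`, and the kernel of `G' → S₂` surjects onto the first factor `G`. -/
def IsAdmissible {G : Type*} [Group G] (G' : Subgroup (WreathTwo G)) : Prop :=
  wreathSigma G ∈ G' ∧
  Subgroup.closure (outerInvolutions G') = G' ∧
  ∀ a : G, ∃ g ∈ G', g.right = 1 ∧ g.left 0 = a

/-- `G'` is good: it has a unique conjugacy class of elements of order `2` that are not in the
kernel of `G' → S₂`. -/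
def IsGood {G : Type*} [Group G] (G' : Subgroup (WreathTwo G)) : Prop :=
  ∃! C : ConjClasses G', ∃ g : G', (g : WreathTwo G) ∈ outerInvolutions G' ∧ ConjClasses.mk g = C

/-- The subgroup `{(a, a, b) : a ∈ G, b ∈ S₂}` of `G ≀ S₂`. -/
def diagonalType (G : Type*) [Group G] : Subgroup (WreathTwo G) where
  carrier := {g | g.left 0 = g.left 1}
  one_mem' := rfl
  mul_mem' := by
    intro g h hg hh
    have key : ∀ i j : Fin 2, h.left i = h.left j := by
      intro i j
      fin_cases i <;> fin_cases j <;> first | rfl | exact hh | exact hh.symm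
    change g.left 0 * h.left (g.right⁻¹ • (0 : Fin 2)) = g.left 1 * h.left (g.right⁻¹ • (1 : Fin 2))
    rw [show g.left 0 = g.left 1 from hg, key]
  inv_mem' := by
    intro g hg
    have key : ∀ i j : Fin 2, g.left i = g.left j := by
      intro i j
      fin_cases i <;> fin_cases j <;> first | rfl | exact hg | exact hg.symm
    change (g.left (g.right⁻¹⁻¹ • (0 : Fin 2)))⁻¹ = (g.left (g.right⁻¹⁻¹ • (1 : Fin 2)))⁻¹
    rw [key]

/-- The elementary abelian group `C₂ᵏ`. -/
abbrev C2pow (k : ℕ) : Type := Multiplicative (Fin k → ZMod 2)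

/-! ### Quadratic fields and their unramified Galois extensions -/

/-- The fixed algebraic closure of `ℚ`. -/
abbrev QBar : Type := AlgebraicClosure ℚ

/-- The quadratic fields inside the fixed algebraic closure of `ℚ`. -/
abbrev QuadField : Type := {K : IntermediateField ℚ QBar // Module.finrank ℚ K = 2}

instance QuadField.numberField (K : QuadField) : NumberField K.1 where
  to_charZero := inferInstance
  to_finiteDimensional := Module.finite_of_finrank_pos (by rw [K.2]; norm_num)

/-- Real quadratic fields of absolute discriminant at most `X`. -/
def realQuad (X : ℝ) : Set QuadField :=
  {K | NumberField.IsTotallyReal K.1 ∧ |(NumberField.discr K.1 : ℝ)| ≤ X}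

/-- Imaginary quadratic fields of absolute discriminant at most `X`. -/
def imagQuad (X : ℝ) : Set QuadField :=
  {K | NumberField.IsTotallyComplex K.1 ∧ |(NumberField.discr K.1 : ℝ)| ≤ X}

/-- A finite Galois extension `L` of `K` inside the fixed algebraic closure, unramified at all
finite and all infinite places. Equivalently: a finite Galois subextension `L / K` of the maximal
unramified extension of `K`. -/
structure UnramifiedExt (K : QuadField) where
  field : IntermediateField K.1 QBar
  finiteDimensional : FiniteDimensional K.1 field
  isGalois : IsGalois K.1 field
  unramified_finite : ∀ (P : Ideal (NumberField.RingOfIntegers field)) [P.IsPrime], P ≠ ⊥ →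
    Algebra.IsUnramifiedAt (NumberField.RingOfIntegers K.1) P
  unramified_infinite : IsUnramifiedAtInfinitePlaces K.1 field

namespace UnramifiedExt

variable {K : QuadField} (L : UnramifiedExt K)

/-- The Galois closure of `L` over `ℚ`, inside the fixed algebraic closure. -/
noncomputable abbrev closure : IntermediateField ℚ QBar :=
  IntermediateField.normalClosure ℚ L.field QBar

/-- `x ∈ Gal(L̃/ℚ)` restricts to `γ ∈ Gal(L/K)` on `L`. (Since `L / K` is Galois, such a `γ`
exists if and only if `x ∈ Gal(L̃/K)`, and it is then unique.) -/
def RestrictsTo (x : Gal(L.closure/ℚ)) (γ : Gal(L.field/K.1)) : Prop :=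
  ∀ a : L.field, x (algebraMap L.field L.closure a) = algebraMap L.field L.closure (γ a)

/-- For `ρ : Gal(L/K) ≃ G` and `y ∈ Gal(L̃/ℚ)` of order `2`, non-trivial on `K`, let
`φ : Gal(L̃/ℚ) → G ≀ S₂` be the homomorphism that sends `x ∈ Gal(L̃/K)` to
`(ρ (x|_L), ρ ((y x y⁻¹)|_L))` and sends `y` to `(1, σ)` (these conditions determine `φ`).
The pair `(ρ, y)` is of type `G'` if the image of `φ` is `G'`. -/
def HasType {G : Type*} [Group G] (ρ : Gal(L.field/K.1) ≃* G) (y : Gal(L.closure/ℚ))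
    (G' : Subgroup (WreathTwo G)) : Prop :=
  ∃ φ : Gal(L.closure/ℚ) →* WreathTwo G,
    (∀ (x : Gal(L.closure/ℚ)) (γ γ' : Gal(L.field/K.1)),
      L.RestrictsTo x γ → L.RestrictsTo (y * x * y⁻¹) γ' →
        φ x = SemidirectProduct.inl ![ρ γ, ρ γ']) ∧
    φ y = wreathSigma G ∧
    φ.range = G'

/-- A twist: an element of order `2` of `Gal(L̃/ℚ)` that is not in `Gal(L̃/K)`. -/
def IsTwist (y : Gal(L.closure/ℚ)) : Prop :=
  orderOf y = 2 ∧ ∃ a : K.1,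
    y (algebraMap L.field L.closure (algebraMap K.1 L.field a)) ≠
      algebraMap L.field L.closure (algebraMap K.1 L.field a)

/-- For `K` imaginary quadratic and a fixed embedding `ι` of the algebraic closure of `ℚ` in `ℂ`:
`ρ` is of type `G'` if `(ρ, y)` is, where `y ∈ Gal(L̃/ℚ)` is the complex conjugation that `ι`
induces on `L̃`, i.e. the generator of the distinguished inertia group at infinity. -/
def HasImagType (ι : QBar →+* ℂ) {G : Type*} [Group G] (ρ : Gal(L.field/K.1) ≃* G)
    (G' : Subgroup (WreathTwo G)) : Prop :=
  ∃ y : Gal(L.closure/ℚ),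
    NumberField.ComplexEmbedding.IsConj (ι.comp (algebraMap L.closure QBar)) y ∧ L.HasType ρ y G'

end UnramifiedExt

/-! ### The counts -/

section counts

variable {G : Type*} [Group G] (G' : Subgroup (WreathTwo G))

/-- For `K` real quadratic: the triples `(L, ρ, y)` with `L / K` unramified, `ρ : Gal(L/K) ≃ G`,
and `y` a twist, such that `(ρ, y)` is of type `G'`. -/
def realRigidified (K : QuadField) :
    Set (Σ L : UnramifiedExt K, (Gal(L.field/K.1) ≃* G) × Gal(L.closure/ℚ)) :=
  {t | t.1.IsTwist t.2.2 ∧ t.1.HasType t.2.1 t.2.2 G'}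

/-- For `K` real quadratic: the unramified `L / K` that are of type `G'` for some choice of an
isomorphism `Gal(L/K) ≃ G` and of a twist. -/
def realFields (K : QuadField) : Set (UnramifiedExt K) :=
  {L | ∃ (ρ : Gal(L.field/K.1) ≃* G) (y : Gal(L.closure/ℚ)), L.IsTwist y ∧ L.HasType ρ y G'}

/-- For `K` imaginary quadratic: the pairs `(L, ρ)` with `L / K` unramified and
`ρ : Gal(L/K) ≃ G` of type `G'`. -/
def imagRigidified (ι : QBar →+* ℂ) (K : QuadField) :
    Set (Σ L : UnramifiedExt K, Gal(L.field/K.1) ≃* G) :=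
  {t | t.1.HasImagType ι t.2 G'}

/-- For `K` imaginary quadratic: the unramified `L / K` that are of type `G'` for some choice of
an isomorphism `Gal(L/K) ≃ G`. -/
def imagFields (ι : QBar →+* ℂ) (K : QuadField) : Set (UnramifiedExt K) :=
  {L | ∃ ρ : Gal(L.field/K.1) ≃* G, L.HasImagType ι ρ G'}

end counts

/-- The sum of `f K` over a (finite) set of quadratic fields, as a real number. -/
noncomputable def quadSum (S : Set QuadField) (f : QuadField → ℕ) : ℝ :=
  ((∑ᶠ K ∈ S, f K : ℕ) : ℝ)

/-- The average of `f K` over a (finite) set of quadratic fields. -/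
noncomputable def quadAverage (S : Set QuadField) (f : QuadField → ℕ) : ℝ :=
  quadSum S f / (S.ncard : ℝ)

/-! ### Summatory functions of arithmetic functions -/

/-! Field theory. Suppose that (ρ, y) has the diagonal type. The two coordinates of φ agree, so
conjugation by y preserves the subgroup fixing L, and L is already Galois over ℚ. The diagonal group
has exponent 2, so Gal(L/ℚ) is an elementary abelian 2-group and L is generated by square roots of
integers. Such an L, unramified over K = ℚ(√d) with d squarefree, lies in the genus field Γ of K,
which is generated by √d and by the √a with a ≡ 1 mod 4, a ∣ d, and a > 0 if d > 0
(`HasType.stable`, `HasType.apply_apply`, `radicand_of_unramified`, `UnramifiedExt.le_genusField`).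
Conversely Γ/K is unramified everywhere, and every subextension of degree 2^k has the required type
for every ρ and every twist, because Gal(Γ/ℚ) is abelian (`isUnramifiedAt_genusExt`,
`hasType_of_le`).

By Galois theory the pairs (L, ρ) are the surjections Gal(Γ/K) → C₂^k. Forgetting ρ divides by
|Aut(C₂^k)|, and in the real case every L has exactly 2^k twists. So all four counts are fixed
multiples of one sum over K of the number of surjections, which is |Gal(Γ/K)|^k +
O(|Gal(Γ/K)|^(k-1)) (`surjCount_eq`, `surjCount_bounds`).

Let m be the odd part of |d|. Then |Gal(Γ/K)| is 2^ω(m) times a constant that depends on the sign of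
d and on d mod 4, with an additional doubling for d > 0 when all primes dividing m are 1 mod 4
(`genusDegree_of_neg`, `genusDegree_of_pos`). The main term is thus a combination of sums of
(2^k)^ω(m) over squarefree m in a class modulo 4. These have order X (log X)^(2^k - 1). The doubled
m, and the error term with 2^(k-1) in place of 2^k, contribute a lower power of log X. There are
only O(X) quadratic fields, so the averages diverge.

Analysis. Let f(n) = z^ω(n) on odd squarefree n. Then f = h * ζ^z with h = f * μ^z, and h vanishes
at odd primes, so Σ |h(n)|/n converges and Σ h(n)/n is a positive Euler product
(`summable_abs_sqfreeCorrection_div`, `sqfreeConst_pos`). The sum of ζ^z up to x is asymptotic to x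
(log x)^(z-1)/(z-1)! by induction on z, and dominated convergence transfers this to f
(`tendsto_sum_mul_comp_div`). The classes 1 and 3 modulo 4 are separated by χ₄, whose bounded
partial sums save a logarithm in the twisted sum. -/

section summatory

open ArithmeticFunction Finset
open scoped ArithmeticFunction.zeta ArithmeticFunction.Moebius

/-- The sum of `f n` over `1 ≤ n ≤ x`. -/
noncomputable def summatory (f : ArithmeticFunction ℝ) (x : ℝ) : ℝ :=
  ∑ n ∈ Ioc 0 ⌊x⌋₊, f n

theorem summatory_mul (f g : ArithmeticFunction ℝ) (x : ℝ) :
    summatory (f * g) x = ∑ a ∈ Ioc 0 ⌊x⌋₊, f a * summatory g (x / a) := by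
  simp only [summatory, sum_Ioc_mul_eq_sum_sum, Nat.floor_div_natCast]

theorem one_le_div_of_mem_Ioc {x : ℝ} {a : ℕ} (ha : a ∈ Ioc 0 ⌊x⌋₊) : 1 ≤ x / a := by
  rw [mem_Ioc] at ha
  have h0 : (0 : ℝ) < a := by exact_mod_cast ha.1
  rw [le_div_iff₀ h0, one_mul]
  exact (Nat.le_floor_iff' ha.1.ne').1 ha.2

theorem div_le_self_of_mem_Ioc {x : ℝ} {a : ℕ} (ha : a ∈ Ioc 0 ⌊x⌋₊) : x / a ≤ x := by
  have h1 := one_le_div_of_mem_Ioc ha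
  rw [mem_Ioc] at ha
  have h0 : (1 : ℝ) ≤ a := by exact_mod_cast ha.1
  have hx : 0 ≤ x := by
    by_contra hx
    rw [Nat.floor_of_nonpos (not_le.1 hx).le] at ha
    omega
  exact div_le_self hx h0

theorem summatory_nonneg {f : ArithmeticFunction ℝ} (hf : ∀ n, 0 ≤ f n) (x : ℝ) :
    0 ≤ summatory f x :=
  sum_nonneg fun n _ => hf n

theorem sum_inv_Ioc_le {x : ℝ} (hx : 1 ≤ x) :
    ∑ a ∈ Ioc 0 ⌊x⌋₊, (a : ℝ)⁻¹ ≤ 1 + Real.log x := by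
  have h := harmonic_floor_le_one_add_log x hx
  rw [harmonic_eq_sum_Icc] at h
  push_cast at h
  rwa [show Ioc 0 ⌊x⌋₊ = Icc 1 ⌊x⌋₊ from rfl]

theorem log_le_sum_inv_Ioc {x : ℝ} (hx : 0 ≤ x) :
    Real.log x ≤ ∑ a ∈ Ioc 0 ⌊x⌋₊, (a : ℝ)⁻¹ := by
  have h := log_le_harmonic_floor x hx
  rw [harmonic_eq_sum_Icc] at h
  push_cast at h
  rwa [show Ioc 0 ⌊x⌋₊ = Icc 1 ⌊x⌋₊ from rfl]

theorem summatory_zeta (x : ℝ) : summatory (ζ : ArithmeticFunction ℝ) x = ⌊x⌋₊ := by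
  have h := sum_Ioc_zeta ⌊x⌋₊
  simp only [summatory, natCoe_apply]
  exact_mod_cast h

theorem zeta_pow_nonneg (z n : ℕ) : 0 ≤ ((ζ : ArithmeticFunction ℝ) ^ z) n := by
  induction z generalizing n with
  | zero => rw [pow_zero, one_apply]; split_ifs <;> norm_num
  | succ z ih =>
    rw [pow_succ, mul_apply]
    refine sum_nonneg fun a _ => mul_nonneg (ih _) ?_
    simp only [natCoe_apply, zeta_apply]
    split_ifs <;> norm_num

/-- Each further factor ζ costs one harmonic sum, at most 1 + log x. This crude bound is the
majorant behind all the later error terms. -/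
theorem summatory_zeta_pow_le (z : ℕ) {x : ℝ} (hx : 1 ≤ x) :
    summatory ((ζ : ArithmeticFunction ℝ) ^ (z + 1)) x ≤ x * (1 + Real.log x) ^ z := by
  induction z generalizing x with
  | zero => 
    rw [zero_add, pow_one, summatory_zeta, pow_zero, mul_one]
    exact Nat.floor_le (by linarith)
  | succ z ih =>
    rw [pow_succ', summatory_mul]
    have hl : 0 ≤ Real.log x := Real.log_nonneg hx
    calc _ ≤ ∑ a ∈ Ioc 0 ⌊x⌋₊, x * (1 + Real.log x) ^ z * (a : ℝ)⁻¹ := by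
          refine sum_le_sum fun a ha => ?_
          have h1 := one_le_div_of_mem_Ioc ha
          have h2 := div_le_self_of_mem_Ioc ha
          rw [natCoe_apply, zeta_apply_ne (by rw [mem_Ioc] at ha; omega), Nat.cast_one, one_mul]
          refine (ih h1).trans ?_
          have : Real.log (x / a) ≤ Real.log x := Real.log_le_log (by linarith) h2
          have h3 : 0 ≤ Real.log (x / a) := Real.log_nonneg h1
          calc _ ≤ x / a * (1 + Real.log x) ^ z := by gcongr
            _ = _ := by ring
      _ = x * (1 + Real.log x) ^ z * ∑ a ∈ Ioc 0 ⌊x⌋₊, (a : ℝ)⁻¹ := by rw [mul_sum]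
      _ ≤ x * (1 + Real.log x) ^ z * (1 + Real.log x) := by
          gcongr
          exact sum_inv_Ioc_le hx
      _ = _ := by ring

/-- A discrete mean value theorem. It lets a telescoping sum replace the comparison of Σ log(x/a)^m
/ a with an integral. -/
theorem pow_sub_pow_bounds {u v : ℝ} (hv : 0 ≤ v) (h : v ≤ u) (m : ℕ) :
    (m + 1) * (v ^ m * (u - v)) ≤ u ^ (m + 1) - v ^ (m + 1) ∧
      u ^ (m + 1) - v ^ (m + 1) ≤ (m + 1) * (u ^ m * (u - v)) := by
  induction m with
  | zero => simp
  | succ m ih =>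
    have hu : 0 ≤ u := hv.trans h
    have e : u ^ (m + 1 + 1) - v ^ (m + 1 + 1)
        = u * (u ^ (m + 1) - v ^ (m + 1)) + v ^ (m + 1) * (u - v) := by ring
    have e2 : u ^ (m + 1 + 1) - v ^ (m + 1 + 1)
        = v * (u ^ (m + 1) - v ^ (m + 1)) + u ^ (m + 1) * (u - v) := by ring
    have h1 := mul_le_mul_of_nonneg_left ih.1 hv
    have h2 := mul_le_mul_of_nonneg_left ih.2 hu
    have h3 : v ^ (m + 1) * (u - v) ≤ u ^ (m + 1) * (u - v) := by
      have : 0 ≤ u - v := by linarith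
      gcongr
    push_cast
    constructor
    · rw [e2]
      have : (m + 1 + 1 : ℝ) * (v ^ (m + 1) * (u - v))
        = v * ((m + 1) * (v ^ m * (u - v))) + v ^ (m + 1) * (u - v) := by ring
      linarith
    · rw [e]
      have : (m + 1 + 1 : ℝ) * (u ^ (m + 1) * (u - v))
        = u * ((m + 1) * (u ^ m * (u - v))) + u ^ (m + 1) * (u - v) := by ring
      linarith

theorem log_succ_sub_log_bounds {a : ℕ} (ha : 0 < a) :
    ((a + 1 : ℕ) : ℝ)⁻¹ ≤ Real.log (a + 1 : ℕ) - Real.log a ∧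
      Real.log (a + 1 : ℕ) - Real.log a ≤ (a : ℝ)⁻¹ := by
  have h0 : (0 : ℝ) < a := by exact_mod_cast ha
  have h1 : (0 : ℝ) < (a + 1 : ℕ) := by positivity
  rw [← Real.log_div h1.ne' h0.ne']
  constructor
  · refine le_trans (le_of_eq ?_) (Real.one_sub_inv_le_log_of_pos (div_pos h1 h0))
    push_cast
    field_simp
    ring
  · refine (Real.log_le_sub_one_of_pos (div_pos h1 h0)).trans (le_of_eq ?_)
    push_cast
    field_simp
    ring

/-- Truncation at 0 makes the induction valid for every N, including N + 1 > x, where log(x/(N+1))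
is negative. -/
theorem sum_log_pow_div_ge (x : ℝ) (hx : 1 ≤ x) (m N : ℕ) :
    (Real.log x ^ (m + 1) - max 0 (Real.log x - Real.log (N + 1 : ℕ)) ^ (m + 1)) / (m + 1) ≤
      ∑ a ∈ Ioc 0 N, max 0 (Real.log x - Real.log a) ^ m * (a : ℝ)⁻¹ := by
  induction N with
  | zero => simp [Real.log_nonneg hx]
  | succ N ih =>
    rw [sum_Ioc_succ_top (by omega)]
    set u := max 0 (Real.log x - Real.log (N + 1 : ℕ)) with hu
    set v := max 0 (Real.log x - Real.log (N + 1 + 1 : ℕ)) with hv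
    have hl := log_succ_sub_log_bounds (a := N + 1) (by omega)
    have hi : (0 : ℝ) < ((N + 1 : ℕ) : ℝ)⁻¹ := by positivity
    have hi2 : (0 : ℝ) < ((N + 1 + 1 : ℕ) : ℝ)⁻¹ := by positivity
    have hv0 : 0 ≤ v := le_max_left _ _
    have hvu : v ≤ u := max_le_max le_rfl (by linarith)
    have huv : u - v ≤ ((N + 1 : ℕ) : ℝ)⁻¹ := by
      rw [sub_le_iff_le_add, hu]
      refine max_le (by positivity) ?_
      have := le_max_right 0 (Real.log x - Real.log (N + 1 + 1 : ℕ))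
      linarith
    have hb := (pow_sub_pow_bounds hv0 hvu m).2
    have hm : (0 : ℝ) < m + 1 := by positivity
    have : (u ^ (m + 1) - v ^ (m + 1)) / (m + 1) ≤ u ^ m * ((N + 1 : ℕ) : ℝ)⁻¹ := by
      rw [div_le_iff₀ hm]
      have : u ^ m * (u - v) ≤ u ^ m * ((N + 1 : ℕ) : ℝ)⁻¹ := by
        have : 0 ≤ u := hv0.trans hvu
        gcongr
      nlinarith
    have e : (Real.log x ^ (m + 1) - v ^ (m + 1)) / (m + 1)
      = (Real.log x ^ (m + 1) - u ^ (m + 1)) / (m + 1) + (u ^ (m + 1) - v ^ (m + 1)) / (m + 1) := by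
      ring
    linarith

theorem sum_log_pow_div_le (x : ℝ) (m N : ℕ) (hN : ((N + 1 : ℕ) : ℝ) ≤ x) :
    ∑ a ∈ Ioc 0 (N + 1), (Real.log x - Real.log a) ^ m * (a : ℝ)⁻¹ ≤ Real.log x ^ m +
      (Real.log x ^ (m + 1) - (Real.log x - Real.log (N + 1 : ℕ)) ^ (m + 1)) / (m + 1) := by
  induction N with
  | zero => simp
  | succ N ih =>
    rw [sum_Ioc_succ_top (by omega)]
    have ih := ih (le_trans (by push_cast; linarith) hN)
    set u := Real.log x - Real.log (N + 1 : ℕ) with hu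
    set v := Real.log x - Real.log (N + 1 + 1 : ℕ) with hv
    have hl := log_succ_sub_log_bounds (a := N + 1) (by omega)
    have hi2 : (0 : ℝ) < ((N + 1 + 1 : ℕ) : ℝ)⁻¹ := by positivity
    have hv0 : 0 ≤ v := sub_nonneg.2 (Real.log_le_log (by positivity) hN)
    have hvu : ((N + 1 + 1 : ℕ) : ℝ)⁻¹ ≤ u - v := by linarith
    have hb := (pow_sub_pow_bounds (u := u) hv0 (by linarith) m).1
    have hm : (0 : ℝ) < m + 1 := by positivity
    have : v ^ m * ((N + 1 + 1 : ℕ) : ℝ)⁻¹ ≤ (u ^ (m + 1) - v ^ (m + 1)) / (m + 1) := by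
      rw [le_div_iff₀ hm]
      have : v ^ m * ((N + 1 + 1 : ℕ) : ℝ)⁻¹ ≤ v ^ m * (u - v) := by gcongr
      nlinarith
    have e : (Real.log x ^ (m + 1) - v ^ (m + 1)) / (m + 1)
      = (Real.log x ^ (m + 1) - u ^ (m + 1)) / (m + 1) + (u ^ (m + 1) - v ^ (m + 1)) / (m + 1) := by
      ring
    linarith

theorem abs_sum_log_pow_div_sub_le {x : ℝ} (hx : 1 ≤ x) (m : ℕ) :
    |∑ a ∈ Ioc 0 ⌊x⌋₊, Real.log (x / a) ^ m * (a : ℝ)⁻¹ - Real.log x ^ (m + 1) / (m + 1)| ≤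
      Real.log x ^ m := by
  have hx0 : 0 < x := by linarith
  have hlog : ∀ a ∈ Ioc 0 ⌊x⌋₊, Real.log (x / a) = Real.log x - Real.log a ∧
      max 0 (Real.log x - Real.log a) = Real.log x - Real.log a := by
    intro a ha
    have h1 := one_le_div_of_mem_Ioc ha
    rw [mem_Ioc] at ha
    have : Real.log (x / a) = Real.log x - Real.log a :=
      Real.log_div hx0.ne' (by exact_mod_cast ha.1.ne')
    exact ⟨this, max_eq_right (this ▸ Real.log_nonneg h1)⟩
  have hlx := Real.log_nonneg hx
  rw [abs_le]
  constructor
  · have h := sum_log_pow_div_ge x hx m ⌊x⌋₊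
    -- Since ⌊x⌋ + 1 > x, the telescoped end term is truncated to 0.
    have h0 : max 0 (Real.log x - Real.log (⌊x⌋₊ + 1 : ℕ)) = 0 := by
      refine max_eq_left (sub_nonpos.2 (Real.log_le_log hx0 ?_))
      push_cast
      exact (Nat.lt_floor_add_one x).le
    rw [h0, zero_pow (by omega), sub_zero] at h
    have : ∑ a ∈ Ioc 0 ⌊x⌋₊, max 0 (Real.log x - Real.log a) ^ m * (a : ℝ)⁻¹ =
        ∑ a ∈ Ioc 0 ⌊x⌋₊, Real.log (x / a) ^ m * (a : ℝ)⁻¹ :=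
      sum_congr rfl fun a ha => by rw [(hlog a ha).1, (hlog a ha).2]
    rw [this] at h
    have : 0 ≤ Real.log x ^ m := by positivity
    linarith
  · have hf : 1 ≤ ⌊x⌋₊ := (Nat.one_le_floor_iff x).2 hx
    obtain ⟨N, hN⟩ : ∃ N, ⌊x⌋₊ = N + 1 := ⟨⌊x⌋₊ - 1, by omega⟩
    have hNx : ((N + 1 : ℕ) : ℝ) ≤ x := hN ▸ Nat.floor_le hx0.le
    have h := sum_log_pow_div_le x m N hNx
    have : ∑ a ∈ Ioc 0 ⌊x⌋₊, Real.log (x / a) ^ m * (a : ℝ)⁻¹ =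
        ∑ a ∈ Ioc 0 (N + 1), (Real.log x - Real.log a) ^ m * (a : ℝ)⁻¹ := by
      rw [← hN]
      exact sum_congr rfl fun a ha => by rw [(hlog a ha).1]
    rw [this, sub_le_iff_le_add]
    refine h.trans ?_
    have h2 : 0 ≤ Real.log x - Real.log (N + 1 : ℕ) :=
      sub_nonneg.2 (Real.log_le_log (by positivity) hNx)
    gcongr
    have : 0 ≤ (Real.log x - Real.log (N + 1 : ℕ)) ^ (m + 1) := by positivity
    linarith

/-- Induction by convolving with one more ζ: summing (x/a) log(x/a)^(z+1)/(z+1)! over a raises the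
power of the logarithm by one and supplies the missing factor of the factorial. The base case is the
Dirichlet divisor sum Σ ⌊x/a⌋. The error stays one logarithm below the main term. -/
theorem abs_summatory_zeta_pow_sub_le (z : ℕ) : ∃ C : ℝ, 0 ≤ C ∧ ∀ x : ℝ, 1 ≤ x →
    |summatory ((ζ : ArithmeticFunction ℝ) ^ (z + 2)) x -
      x * Real.log x ^ (z + 1) / (z + 1).factorial| ≤ C * (x * (1 + Real.log x) ^ z) := by
  induction z with
  | zero =>
    refine ⟨2, by norm_num, fun x hx => ?_⟩
    have hx0 : 0 ≤ x := by linarith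
    have hs : summatory ((ζ : ArithmeticFunction ℝ) ^ 2) x = ∑ a ∈ Ioc 0 ⌊x⌋₊, (⌊x / a⌋₊ : ℝ) := by
      rw [pow_two, summatory_mul]
      refine sum_congr rfl fun a ha => ?_
      rw [natCoe_apply, zeta_apply_ne (by rw [mem_Ioc] at ha; omega), summatory_zeta]
      simp
    have h1 := sum_inv_Ioc_le hx
    have h2 := log_le_sum_inv_Ioc hx0
    have hu : ∑ a ∈ Ioc 0 ⌊x⌋₊, (⌊x / a⌋₊ : ℝ) ≤ x * ∑ a ∈ Ioc 0 ⌊x⌋₊, (a : ℝ)⁻¹ := by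
      rw [mul_sum]
      refine sum_le_sum fun a _ => ?_
      rw [← div_eq_mul_inv]
      exact Nat.floor_le (by positivity)
    have hl : x * ∑ a ∈ Ioc 0 ⌊x⌋₊, (a : ℝ)⁻¹ - x ≤ ∑ a ∈ Ioc 0 ⌊x⌋₊, (⌊x / a⌋₊ : ℝ) := by
      have : ∑ a ∈ Ioc 0 ⌊x⌋₊, (x * (a : ℝ)⁻¹ - 1) ≤ ∑ a ∈ Ioc 0 ⌊x⌋₊, (⌊x / a⌋₊ : ℝ) := by
        refine sum_le_sum fun a _ => ?_
        rw [← div_eq_mul_inv]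
        exact (Nat.sub_one_lt_floor _).le
      rw [sum_sub_distrib, ← mul_sum] at this
      simp only [sum_const, Nat.card_Ioc, tsub_zero, nsmul_eq_mul, mul_one] at this
      have := Nat.floor_le hx0
      linarith
    rw [zero_add, zero_add, hs]
    simp only [pow_one, Nat.factorial_one, Nat.cast_one, div_one, pow_zero, mul_one]
    rw [abs_le]
    constructor <;> nlinarith
  | succ z ih =>
    obtain ⟨C, hC, h⟩ := ih
    refine ⟨C + 1, by linarith, fun x hx => ?_⟩
    have hx0 : 0 ≤ x := by linarith
    have hlx := Real.log_nonneg hx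
    have hfac : (0 : ℝ) < (z + 1).factorial := by positivity
    have hfac1 : (1 : ℝ) ≤ (z + 1).factorial := by exact_mod_cast Nat.one_le_iff_ne_zero.2 (Nat.factorial_ne_zero _)
    have hs : summatory ((ζ : ArithmeticFunction ℝ) ^ (z + 1 + 2)) x =
        ∑ a ∈ Ioc 0 ⌊x⌋₊, summatory ((ζ : ArithmeticFunction ℝ) ^ (z + 2)) (x / a) := by
      rw [show z + 1 + 2 = (z + 2) + 1 by ring, pow_succ', summatory_mul]
      refine sum_congr rfl fun a ha => ?_
      rw [natCoe_apply, zeta_apply_ne (by rw [mem_Ioc] at ha; omega)]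
      simp
    have hE : |∑ a ∈ Ioc 0 ⌊x⌋₊, summatory ((ζ : ArithmeticFunction ℝ) ^ (z + 2)) (x / a) -
        ∑ a ∈ Ioc 0 ⌊x⌋₊, x / a * Real.log (x / a) ^ (z + 1) / (z + 1).factorial| ≤
        C * (x * (1 + Real.log x) ^ (z + 1)) := by
      rw [← sum_sub_distrib]
      refine (abs_sum_le_sum_abs _ _).trans ?_
      calc _ ≤ ∑ a ∈ Ioc 0 ⌊x⌋₊, C * (x * (1 + Real.log x) ^ z) * (a : ℝ)⁻¹ := by
            refine sum_le_sum fun a ha => ?_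
            have h1 := one_le_div_of_mem_Ioc ha
            have h2 := div_le_self_of_mem_Ioc ha
            refine (h _ h1).trans ?_
            have : Real.log (x / a) ≤ Real.log x := Real.log_le_log (by linarith) h2
            have h3 : 0 ≤ Real.log (x / a) := Real.log_nonneg h1
            calc _ ≤ C * (x / a * (1 + Real.log x) ^ z) := by gcongr
              _ = _ := by ring
        _ = C * (x * (1 + Real.log x) ^ z) * ∑ a ∈ Ioc 0 ⌊x⌋₊, (a : ℝ)⁻¹ := by rw [mul_sum]
        _ ≤ C * (x * (1 + Real.log x) ^ z) * (1 + Real.log x) := by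
            gcongr
            exact sum_inv_Ioc_le hx
        _ = _ := by ring
    have hM : ∑ a ∈ Ioc 0 ⌊x⌋₊, x / a * Real.log (x / a) ^ (z + 1) / (z + 1).factorial =
        x / (z + 1).factorial * ∑ a ∈ Ioc 0 ⌊x⌋₊, Real.log (x / a) ^ (z + 1) * (a : ℝ)⁻¹ := by
      rw [mul_sum]
      exact sum_congr rfl fun a _ => by ring
    have hL := abs_sum_log_pow_div_sub_le hx (z + 1)
    have hM2 : |x / (z + 1).factorial * ∑ a ∈ Ioc 0 ⌊x⌋₊, Real.log (x / a) ^ (z + 1) * (a : ℝ)⁻¹ -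
        x * Real.log x ^ (z + 1 + 1) / (z + 1 + 1).factorial| ≤ x * (1 + Real.log x) ^ (z + 1) := by
      have e : x * Real.log x ^ (z + 1 + 1) / (z + 1 + 1).factorial =
          x / (z + 1).factorial * (Real.log x ^ (z + 1 + 1) / ((z + 1 : ℕ) + 1)) := by
        rw [Nat.factorial_succ (z + 1)]
        push_cast
        field_simp
      rw [e, ← mul_sub, abs_mul, abs_of_nonneg (by positivity)]
      calc _ ≤ x / (z + 1).factorial * Real.log x ^ (z + 1) := by gcongr
        _ ≤ x / 1 * (1 + Real.log x) ^ (z + 1) := by gcongr; linarith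
        _ = _ := by ring
    rw [hs]
    rw [hM] at hE
    calc _ ≤ _ := abs_sub_le _ _ _
      _ ≤ _ := add_le_add hE hM2
      _ = _ := by ring

end summatory

/-! ### The function z^ω on odd squarefree numbers and its Euler product -/

section sqfree

open ArithmeticFunction Finset
open scoped ArithmeticFunction.zeta ArithmeticFunction.Moebius

/-- The function `n ↦ z ^ ω(n)`, restricted to odd squarefree `n`. -/
noncomputable def oddSqfreePow (z : ℕ) : ArithmeticFunction ℝ :=
  ⟨fun n => if Odd n ∧ Squarefree n then (z : ℝ) ^ n.primeFactors.card else 0, by simp⟩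

theorem oddSqfreePow_apply (z n : ℕ) : oddSqfreePow z n =
    if Odd n ∧ Squarefree n then (z : ℝ) ^ n.primeFactors.card else 0 := rfl

theorem oddSqfreePow_nonneg (z n : ℕ) : 0 ≤ oddSqfreePow z n := by
  rw [oddSqfreePow_apply]; split_ifs <;> positivity

theorem oddSqfreePow_isMultiplicative (z : ℕ) : (oddSqfreePow z).IsMultiplicative := by
  refine ⟨by simp [oddSqfreePow_apply], fun {m n} h => ?_⟩
  simp only [oddSqfreePow_apply, Nat.odd_mul, Nat.squarefree_mul h, h.primeFactors_mul,
    card_union_of_disjoint h.disjoint_primeFactors, pow_add]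
  by_cases h1 : Odd m <;> by_cases h2 : Odd n <;> by_cases h3 : Squarefree m <;>
    by_cases h4 : Squarefree n <;> simp [h1, h2, h3, h4]

theorem oddSqfreePow_prime_pow_le (z : ℕ) {p : ℕ} (hp : p.Prime) (e : ℕ) :
    |oddSqfreePow z (p ^ e)| ≤ z + 1 := by
  rw [abs_of_nonneg (oddSqfreePow_nonneg _ _), oddSqfreePow_apply]
  have hz : (0 : ℝ) ≤ z := by positivity
  split_ifs
  · rcases Nat.eq_zero_or_pos e with rfl | he
    · simp
    · rw [Nat.primeFactors_prime_pow he.ne' hp]; simp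
  · linarith

theorem oddSqfreePow_prime_pow_eq_zero (z : ℕ) {p : ℕ} (hp : p.Prime) {e : ℕ} (he : 2 ≤ e) :
    oddSqfreePow z (p ^ e) = 0 := by
  rw [oddSqfreePow_apply, if_neg]
  rintro ⟨-, h⟩
  have := Nat.squarefree_pow_iff hp.one_lt.ne' (by omega : e ≠ 0) |>.1 h
  omega

theorem oddSqfreePow_prime (z : ℕ) {p : ℕ} (hp : p.Prime) (h2 : p ≠ 2) :
    oddSqfreePow z p = z := by
  rw [oddSqfreePow_apply, if_pos ⟨hp.odd_of_ne_two h2, hp.squarefree⟩, hp.primeFactors]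
  simp

/-- The convolution of `oddSqfreePow z` with `μ ^ j`. -/
noncomputable def sqfreeCorrection (z j : ℕ) : ArithmeticFunction ℝ :=
  oddSqfreePow z * (μ : ArithmeticFunction ℝ) ^ j

theorem sqfreeCorrection_mul_zeta (z j : ℕ) :
    sqfreeCorrection z (j + 1) * (ζ : ArithmeticFunction ℝ) = sqfreeCorrection z j := by
  rw [sqfreeCorrection, pow_succ, ← mul_assoc, mul_assoc, coe_moebius_mul_coe_zeta, mul_one,
    sqfreeCorrection]

theorem sqfreeCorrection_mul_zeta_pow (z j : ℕ) :
    sqfreeCorrection z j * (ζ : ArithmeticFunction ℝ) ^ j = oddSqfreePow z := by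
  rw [sqfreeCorrection, mul_assoc, ← mul_pow, coe_moebius_mul_coe_zeta, one_pow, mul_one]

theorem sqfreeCorrection_isMultiplicative (z j : ℕ) : (sqfreeCorrection z j).IsMultiplicative :=
  (oddSqfreePow_isMultiplicative z).mul (isMultiplicative_moebius.intCast.pow)

theorem sqfreeCorrection_one (z j : ℕ) : sqfreeCorrection z j 1 = 1 :=
  (sqfreeCorrection_isMultiplicative z j).map_one

theorem sqfreeCorrection_succ_prime_pow (z j : ℕ) {p : ℕ} (hp : p.Prime) (e : ℕ) :
    sqfreeCorrection z (j + 1) (p ^ (e + 1)) =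
      sqfreeCorrection z j (p ^ (e + 1)) - sqfreeCorrection z j (p ^ e) := by
  rw [← sqfreeCorrection_mul_zeta z j]
  simp only [coe_mul_zeta_apply, Nat.sum_divisors_prime_pow hp]
  rw [sum_range_succ _ (e + 1)]
  ring

theorem abs_sqfreeCorrection_prime_pow_le (z j : ℕ) {p : ℕ} (hp : p.Prime) (e : ℕ) :
    |sqfreeCorrection z j (p ^ e)| ≤ 2 ^ j * (z + 1) := by
  induction j generalizing e with
  | zero => simpa [sqfreeCorrection] using oddSqfreePow_prime_pow_le z hp e
  | succ j ih =>
    cases e with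
    | zero =>
      rw [pow_zero, sqfreeCorrection_one, abs_one]
      have : (1 : ℝ) ≤ 2 ^ (j + 1) := one_le_pow₀ (by norm_num)
      have hz : (0 : ℝ) ≤ z := by positivity
      nlinarith
    | succ e =>
      rw [sqfreeCorrection_succ_prime_pow z j hp e]
      refine (abs_sub _ _).trans ((add_le_add (ih _) (ih _)).trans (le_of_eq (by ring)))

theorem sqfreeCorrection_prime_pow_eq_zero (z j : ℕ) {p : ℕ} (hp : p.Prime) {e : ℕ}
    (he : j + 2 ≤ e) : sqfreeCorrection z j (p ^ e) = 0 := by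
  induction j generalizing e with
  | zero => simpa [sqfreeCorrection] using oddSqfreePow_prime_pow_eq_zero z hp (by omega)
  | succ j ih =>
    obtain ⟨e, rfl⟩ : ∃ e', e = e' + 1 := ⟨e - 1, by omega⟩
    rw [sqfreeCorrection_succ_prime_pow z j hp e, ih (by omega), ih (by omega), sub_zero]

/-- Each convolution with μ lowers the value at an odd prime by one. For `j = z` the value is 0,
which is why Σ |h(n)|/n converges. -/
theorem sqfreeCorrection_prime (z j : ℕ) {p : ℕ} (hp : p.Prime) (h2 : p ≠ 2) :
    sqfreeCorrection z j p = z - j := by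
  induction j with
  | zero => simpa [sqfreeCorrection] using oddSqfreePow_prime z hp h2
  | succ j ih =>
    have := sqfreeCorrection_succ_prime_pow z j hp 0
    rw [zero_add, pow_one, pow_zero, sqfreeCorrection_one, ih] at this
    rw [this]; push_cast; ring

/-- The Euler factor at p: each convolution with μ multiplies it by 1 - 1/p. -/
theorem hasSum_sqfreeCorrection (z j : ℕ) {p : ℕ} (hp : p.Prime) :
    HasSum (fun e => sqfreeCorrection z j (p ^ e) / (p : ℝ) ^ e)
      ((1 + oddSqfreePow z p / p) * (1 - (p : ℝ)⁻¹) ^ j) := by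
  have hp0 : (p : ℝ) ≠ 0 := by exact_mod_cast hp.ne_zero
  induction j with
  | zero =>
    have h : HasSum (fun e => oddSqfreePow z (p ^ e) / (p : ℝ) ^ e)
        (∑ e ∈ range 2, oddSqfreePow z (p ^ e) / (p : ℝ) ^ e) := by
      refine hasSum_sum_of_ne_finset_zero fun e he => ?_
      rw [oddSqfreePow_prime_pow_eq_zero z hp (by rwa [mem_range, not_lt] at he), zero_div]
    simpa [sqfreeCorrection, sum_range_succ, (oddSqfreePow_isMultiplicative z).map_one] using h
  | succ j ih =>
    set S := (1 + oddSqfreePow z p / p) * (1 - (p : ℝ)⁻¹) ^ j with hS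
    have h1 := (hasSum_nat_add_iff' 1).2 ih
    have h2 := ih.mul_right (p : ℝ)⁻¹
    have h3 := h1.sub h2
    have h4 : HasSum (fun e => sqfreeCorrection z (j + 1) (p ^ (e + 1)) / (p : ℝ) ^ (e + 1))
        ((S - 1) - S * (p : ℝ)⁻¹) := by
      convert! h3 using 1
      · ext e
        rw [sqfreeCorrection_succ_prime_pow z j hp e]
        field_simp
        ring
      · simp [sqfreeCorrection_one]
    rw [← hasSum_nat_add_iff' 1]
    convert! h4 using 1
    simp only [sum_range_one, pow_zero, sqfreeCorrection_one, hS]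
    ring

/-- Exponents at least 2 contribute O(p⁻²), and the exponent 1 contributes nothing at odd p. At p =
2 it does contribute, and the factor 4 = 2² in the constant absorbs it. -/
theorem sum_abs_sqfreeCorrection_prime_pow_le (z : ℕ) {p : ℕ} (hp : p.Prime) :
    HasSum (fun e => |sqfreeCorrection z z (p ^ (e + 1))| / (p : ℝ) ^ (e + 1))
      (∑ e ∈ range (z + 1), |sqfreeCorrection z z (p ^ (e + 1))| / (p : ℝ) ^ (e + 1)) ∧
    ∑ e ∈ range (z + 1), |sqfreeCorrection z z (p ^ (e + 1))| / (p : ℝ) ^ (e + 1) ≤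
      4 * (z + 1) * (2 ^ z * (z + 1)) / (p : ℝ) ^ 2 := by
  have hp0 : (0 : ℝ) < p := by exact_mod_cast hp.pos
  have hp1 : (1 : ℝ) ≤ p := by exact_mod_cast hp.one_le
  constructor
  · refine hasSum_sum_of_ne_finset_zero fun e he => ?_
    rw [mem_range, not_lt] at he
    rw [sqfreeCorrection_prime_pow_eq_zero z z hp (by omega), abs_zero, zero_div]
  · refine (sum_le_card_nsmul (range (z + 1)) _ (4 * (2 ^ z * (z + 1)) / (p : ℝ) ^ 2)
      fun e _ => ?_).trans (le_of_eq ?_)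
    · have hb := abs_sqfreeCorrection_prime_pow_le z z hp (e + 1)
      rw [div_le_div_iff₀ (by positivity) (by positivity)]
      rcases Nat.eq_zero_or_pos e with rfl | he
      · by_cases h2 : p = 2
        · subst h2
          norm_num at hb ⊢
          have : (0 : ℝ) ≤ 2 ^ z * (z + 1) := by positivity
          linarith
        · rw [zero_add, pow_one, sqfreeCorrection_prime z z hp h2]
          simp; positivity
      · have : (p : ℝ) ^ 2 ≤ (p : ℝ) ^ (e + 1) := pow_le_pow_right₀ hp1 (by omega)
        calc _ ≤ (2 ^ z * (z + 1)) * (p : ℝ) ^ (e + 1) := by gcongr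
          _ ≤ _ := by
            have : (0 : ℝ) ≤ (2 ^ z * (z + 1)) * (p : ℝ) ^ (e + 1) := by positivity
            linarith
    · simp; ring

theorem summable_inv_sq_nat : Summable fun n : ℕ => 1 / (n : ℝ) ^ 2 :=
  Real.summable_one_div_nat_pow.2 (by norm_num)

/-- A partial sum up to N is at most the Euler product over the primes below N, hence at most exp(C
Σ 1/n²). -/
theorem summable_of_multiplicative_of_prime_pow_le {F : ℕ → ℝ} (hF0 : ∀ n, 0 ≤ F n)
    (hF1 : F 1 = 1) (hFz : F 0 = 0) (hmul : ∀ {m n : ℕ}, m.Coprime n → F (m * n) = F m * F n)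
    {C : ℝ} (hC : 0 ≤ C) {S : ℕ → ℝ}
    (hloc : ∀ {p : ℕ}, p.Prime → HasSum (fun e => F (p ^ (e + 1))) (S p))
    (hS : ∀ {p : ℕ}, p.Prime → S p ≤ C * (1 / (p : ℝ) ^ 2)) : Summable F := by
  have hloc' : ∀ {p : ℕ}, p.Prime → HasSum (fun e => F (p ^ e)) (1 + S p) := by
    intro p hp
    rw [← hasSum_nat_add_iff' 1]
    simpa [hF1] using hloc hp
  have hs := EulerProduct.summable_and_hasSum_smoothNumbers_prod_primesBelow_tsum (f := F) hF1 hmul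
    (fun hp => by simpa only [Real.norm_of_nonneg (hF0 _)] using (hloc' hp).summable)
  refine summable_of_sum_range_le (c := Real.exp (C * ∑' n : ℕ, 1 / (n : ℝ) ^ 2)) hF0 fun N => ?_
  have h2 := hasSum_subtype_iff_indicator.1 (hs N).2
  have h3 : ∑ n ∈ range N, F n ≤ ∏ p ∈ N.primesBelow, ∑' e, F (p ^ e) := by
    refine le_trans (sum_le_sum fun n hn => ?_)
      (sum_le_hasSum (range N) (fun n _ => Set.indicator_nonneg (fun m _ => hF0 m) n) h2)
    rcases Nat.eq_zero_or_pos n with rfl | hn0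
    · rw [hFz]
      exact Set.indicator_nonneg (fun m _ => hF0 m) 0
    · rw [Set.indicator_of_mem]
      exact Nat.mem_smoothNumbers_of_lt hn0 (by simpa using hn)
  refine h3.trans ?_
  calc _ ≤ ∏ p ∈ N.primesBelow, Real.exp (C * (1 / (p : ℝ) ^ 2)) := by
        refine prod_le_prod (fun p hp => tsum_nonneg fun e => hF0 _) fun p hp => ?_
        have hpp := Nat.prime_of_mem_primesBelow hp
        rw [(hloc' hpp).tsum_eq]
        linarith [Real.add_one_le_exp (C * (1 / (p : ℝ) ^ 2)), hS hpp]
    _ = Real.exp (C * ∑ p ∈ N.primesBelow, 1 / (p : ℝ) ^ 2) := by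
        rw [← Real.exp_sum, mul_sum]
    _ ≤ _ := by
        refine Real.exp_le_exp.2 (mul_le_mul_of_nonneg_left ?_ hC)
        exact summable_inv_sq_nat.sum_le_tsum _ (fun n _ => by positivity)

theorem summable_abs_sqfreeCorrection_div (z : ℕ) :
    Summable fun n : ℕ => |sqfreeCorrection z z n| / n := by
  refine summable_of_multiplicative_of_prime_pow_le (C := 4 * (z + 1) * (2 ^ z * (z + 1)))
    (S := fun p => ∑ e ∈ range (z + 1), |sqfreeCorrection z z (p ^ (e + 1))| / (p : ℝ) ^ (e + 1))
    (fun n => by positivity) (by simp [sqfreeCorrection_one]) (by simp) ?_ (by positivity) ?_ ?_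
  · intro m n h
    simp only [(sqfreeCorrection_isMultiplicative z z).map_mul_of_coprime h, abs_mul, Nat.cast_mul]
    rw [mul_div_mul_comm]
  · intro p hp
    simpa only [Nat.cast_pow] using (sum_abs_sqfreeCorrection_prime_pow_le z hp).1
  · intro p hp
    rw [mul_one_div]
    exact (sum_abs_sqfreeCorrection_prime_pow_le z hp).2

/-- The mean value constant of `oddSqfreePow z`, up to a factorial. -/
noncomputable def sqfreeConst (z : ℕ) : ℝ := ∑' n : ℕ, sqfreeCorrection z z n / n

/-- Every Euler factor (1 + f(p)/p)(1 - 1/p)^z is positive and differs from 1 by O(p⁻²). The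
logarithms of the factors are therefore summable, and the product is an exponential. -/
theorem sqfreeConst_pos (z : ℕ) : 0 < sqfreeConst z := by
  set F : ℕ → ℝ := fun n => sqfreeCorrection z z n / n with hF
  have hF1 : F 1 = 1 := by simp [hF, sqfreeCorrection_one]
  have hmul : ∀ {m n : ℕ}, m.Coprime n → F (m * n) = F m * F n := by
    intro m n h
    simp only [hF, (sqfreeCorrection_isMultiplicative z z).map_mul_of_coprime h, Nat.cast_mul]
    rw [mul_div_mul_comm]
  have hsum : Summable fun n => ‖F n‖ := by
    simpa [hF, abs_div] using summable_abs_sqfreeCorrection_div z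
  have hprod := EulerProduct.eulerProduct_hasProd (f := F) hF1 hmul hsum (by simp [hF])
  have hloc : ∀ p : Nat.Primes, ∑' e, F ((p : ℕ) ^ e) =
      (1 + oddSqfreePow z p / (p : ℕ)) * (1 - ((p : ℕ) : ℝ)⁻¹) ^ z := by
    intro p
    have := hasSum_sqfreeCorrection z z p.2
    rw [← this.tsum_eq]
    simp [hF]
  have hpos : ∀ p : Nat.Primes, 0 < ∑' e, F ((p : ℕ) ^ e) := by
    intro p
    rw [hloc]
    have h1 : (1 : ℝ) < (p : ℕ) := by exact_mod_cast p.2.one_lt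
    have h2 : 0 < 1 - ((p : ℕ) : ℝ)⁻¹ := sub_pos.2 (inv_lt_one_of_one_lt₀ h1)
    have h3 : 0 ≤ oddSqfreePow z p / (p : ℕ) :=
      div_nonneg (oddSqfreePow_nonneg _ _) (by positivity)
    positivity
  have hsub : Summable fun p : Nat.Primes => (∑' e, F ((p : ℕ) ^ e)) - 1 := by
    set C : ℝ := 4 * (z + 1) * (2 ^ z * (z + 1)) with hC
    have hC' : Summable fun p : Nat.Primes => C * (1 / ((p : ℕ) : ℝ) ^ 2) :=
      (summable_inv_sq_nat.comp_injective Nat.Primes.coe_nat_injective).mul_left C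
    refine Summable.of_norm_bounded hC' fun p => ?_
    have hb := sum_abs_sqfreeCorrection_prime_pow_le z p.2
    have hs : Summable fun e => F ((p : ℕ) ^ e) := by
      simpa [hF] using (hasSum_sqfreeCorrection z z p.2).summable
    have e1 : (∑' e, F ((p : ℕ) ^ e)) - 1 = ∑' e, F ((p : ℕ) ^ (e + 1)) := by
      rw [hs.tsum_eq_zero_add, pow_zero, hF1]; ring
    have hFn : ∀ n, ‖F n‖ = |sqfreeCorrection z z n| / n := fun n => by
      simp only [hF, norm_div, Real.norm_eq_abs, Nat.abs_cast]
    have hb1 : HasSum (fun e => ‖F ((p : ℕ) ^ (e + 1))‖)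
        (∑ e ∈ range (z + 1), ‖F ((p : ℕ) ^ (e + 1))‖) := by
      simpa only [hFn, Nat.cast_pow] using hb.1
    rw [e1]
    refine (norm_tsum_le_tsum_norm hb1.summable).trans ?_
    rw [hb1.tsum_eq]
    simpa only [hFn, Nat.cast_pow, mul_one_div] using hb.2
  have hlog := Real.summable_log_one_add_of_summable hsub
  simp only [add_sub_cancel] at hlog
  have := Real.rexp_tsum_eq_tprod hpos hlog
  rw [hprod.tprod_eq] at this
  change 0 < ∑' n, F n
  rw [← this]
  exact Real.exp_pos _

end sqfree

/-! ### Mean values by dominated convergence, and their twists by χ₄ -/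

section meanvalue

open ArithmeticFunction Finset
open scoped ArithmeticFunction.zeta ArithmeticFunction.Moebius

theorem tendsto_log_sub_const_div_log (b : ℝ) :
    Tendsto (fun x : ℝ => (Real.log x - b) / Real.log x) atTop (𝓝 1) := by
  have h : Tendsto (fun x : ℝ => 1 - b * (Real.log x)⁻¹) atTop (𝓝 (1 - b * 0)) :=
    tendsto_const_nhds.sub (Real.tendsto_log_atTop.inv_tendsto_atTop.const_mul b)
  rw [mul_zero, sub_zero] at h
  refine h.congr' ?_
  filter_upwards [eventually_gt_atTop 1] with x hx
  have := Real.log_pos hx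
  field_simp

theorem tendsto_comp_div_mul_log_pow {G : ℝ → ℝ} {m : ℕ} {c : ℝ}
    (hG : Tendsto (fun x => G x / (x * Real.log x ^ m)) atTop (𝓝 c)) {a : ℝ} (ha : 0 < a) :
    Tendsto (fun x => G (x / a) / (x * Real.log x ^ m)) atTop (𝓝 (c / a)) := by
  have h1 := hG.comp (tendsto_id.atTop_div_const ha)
  have h2 := ((tendsto_log_sub_const_div_log (Real.log a)).pow m).div_const a
  rw [one_pow] at h2
  have h3 := h1.mul h2
  rw [mul_one_div] at h3
  refine h3.congr' ?_
  filter_upwards [eventually_gt_atTop 1, eventually_gt_atTop a] with x hx hxa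
  have hl := Real.log_pos hx
  have hx0 : 0 < x := by linarith
  have hla : 0 < Real.log (x / a) := Real.log_pos ((one_lt_div ha).2 hxa)
  simp only [Function.comp_apply, id]
  rw [← Real.log_div hx0.ne' ha.ne', div_pow]
  field_simp

/-- Dominated convergence in the variable a: for fixed a the quotient tends to c h(a)/a, and the
growth bound on G makes |h(a)|/a a summable majorant. -/
theorem tendsto_sum_mul_comp_div {G : ℝ → ℝ} {m : ℕ} {c B : ℝ} {h : ArithmeticFunction ℝ}
    (hh : Summable fun n : ℕ => |h n| / n)
    (hB : ∀ y, 1 ≤ y → |G y| ≤ B * (y * (1 + Real.log y) ^ m))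
    (hG : Tendsto (fun x => G x / (x * Real.log x ^ m)) atTop (𝓝 c)) :
    Tendsto (fun x => (∑ a ∈ Ioc 0 ⌊x⌋₊, h a * G (x / a)) / (x * Real.log x ^ m)) atTop
      (𝓝 (c * ∑' n : ℕ, h n / n)) := by
  have hB0 : 0 ≤ B := by
    have := (abs_nonneg _).trans (hB 1 le_rfl)
    simpa using this
  have key := tendsto_tsum_of_dominated_convergence (𝓕 := atTop) (β := ℕ)
    (f := fun (x : ℝ) (a : ℕ) => if a ∈ Ioc 0 ⌊x⌋₊ then h a * G (x / a) / (x * Real.log x ^ m) else 0)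
    (g := fun a => c * (h a / a)) (bound := fun a => B * 2 ^ m * (|h a| / a)) (hh.mul_left _) ?_ ?_
  · rw [tsum_mul_left] at key
    refine key.congr fun x => ?_
    rw [tsum_eq_sum (s := Ioc 0 ⌊x⌋₊) (fun a ha => if_neg ha), sum_div]
    exact sum_congr rfl fun a ha => if_pos ha
  · intro a
    rcases Nat.eq_zero_or_pos a with rfl | ha
    · simp
    · have ha' : (0 : ℝ) < a := by exact_mod_cast ha
      have h1 := (tendsto_comp_div_mul_log_pow hG ha').const_mul (h a)
      have e : h a * (c / a) = c * (h a / a) := by ring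
      rw [e] at h1
      refine h1.congr' ?_
      filter_upwards [eventually_ge_atTop (a : ℝ)] with x hx
      rw [if_pos (mem_Ioc.2 ⟨ha, Nat.le_floor hx⟩), mul_div_assoc]
  -- For x ≥ e one has 1 + log(x/a) ≤ 2 log x, which is the source of the factor 2 ^ m in the
  -- majorant.
  · filter_upwards [eventually_ge_atTop (Real.exp 1)] with x hx a
    have hx1 : 1 ≤ Real.log x := by
      rw [← Real.log_exp 1]; exact Real.log_le_log (Real.exp_pos _) hx
    have hx0 : 0 < x := (Real.exp_pos _).trans_le hx
    split_ifs with ha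
    · have h1 := one_le_div_of_mem_Ioc ha
      have h2 := div_le_self_of_mem_Ioc ha
      have hl : Real.log (x / a) ≤ Real.log x := Real.log_le_log (by linarith) h2
      have hl0 := Real.log_nonneg h1
      rw [Real.norm_eq_abs, abs_div, abs_mul, abs_of_pos (by positivity : 0 < x * Real.log x ^ m),
        div_le_iff₀ (by positivity)]
      calc |h a| * |G (x / a)| ≤ |h a| * (B * (x / a * (1 + Real.log (x / a)) ^ m)) := by
            gcongr; exact hB _ h1
        _ ≤ |h a| * (B * (x / a * (2 * Real.log x) ^ m)) := by gcongr; linarith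
        _ = _ := by rw [mul_pow]; ring
    · rw [norm_zero]; positivity

theorem abs_sum_mul_comp_div_le {G : ℝ → ℝ} {m : ℕ} {B : ℝ} {h : ArithmeticFunction ℝ}
    (hh : Summable fun n : ℕ => |h n| / n)
    (hB : ∀ y, 1 ≤ y → |G y| ≤ B * (y * (1 + Real.log y) ^ m)) {x : ℝ} (hx : 1 ≤ x) :
    |∑ a ∈ Ioc 0 ⌊x⌋₊, h a * G (x / a)| ≤
      B * (∑' n : ℕ, |h n| / n) * (x * (1 + Real.log x) ^ m) := by
  have hB0 : 0 ≤ B := by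
    have := (abs_nonneg _).trans (hB 1 le_rfl)
    simpa using this
  have hl := Real.log_nonneg hx
  refine (abs_sum_le_sum_abs _ _).trans ?_
  calc _ ≤ ∑ a ∈ Ioc 0 ⌊x⌋₊, B * (x * (1 + Real.log x) ^ m) * (|h a| / a) := by
        refine sum_le_sum fun a ha => ?_
        have h1 := one_le_div_of_mem_Ioc ha
        have h2 := div_le_self_of_mem_Ioc ha
        have hl : Real.log (x / a) ≤ Real.log x := Real.log_le_log (by linarith) h2
        have hl0 := Real.log_nonneg h1
        rw [abs_mul]
        calc |h a| * |G (x / a)| ≤ |h a| * (B * (x / a * (1 + Real.log (x / a)) ^ m)) := by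
              gcongr; exact hB _ h1
          _ ≤ |h a| * (B * (x / a * (1 + Real.log x) ^ m)) := by gcongr
          _ = _ := by ring
    _ = B * (x * (1 + Real.log x) ^ m) * ∑ a ∈ Ioc 0 ⌊x⌋₊, |h a| / a := by rw [mul_sum]
    _ ≤ B * (x * (1 + Real.log x) ^ m) * ∑' n : ℕ, |h n| / n := by
        gcongr
        exact hh.sum_le_tsum _ fun n _ => by positivity
    _ = _ := by ring

theorem tendsto_one_add_log_pow_div_log_pow {m n : ℕ} (h : m < n) :
    Tendsto (fun x : ℝ => (1 + Real.log x) ^ m / Real.log x ^ n) atTop (𝓝 0) := by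
  have h1 := ((tendsto_log_sub_const_div_log (-1)).pow m).mul
    ((tendsto_pow_atTop (Nat.sub_ne_zero_of_lt h)).comp Real.tendsto_log_atTop).inv_tendsto_atTop
  rw [mul_zero] at h1
  refine h1.congr' ?_
  filter_upwards [eventually_gt_atTop 1] with x hx
  have := Real.log_pos hx
  simp only [Function.comp_apply, Pi.inv_apply]
  rw [div_pow, ← pow_sub_mul_pow _ h.le]
  field_simp
  ring

theorem tendsto_div_mul_log_pow_of_le {F : ℝ → ℝ} {m n : ℕ} {B : ℝ} (h : m < n)
    (hB : ∀ x, 1 ≤ x → |F x| ≤ B * (x * (1 + Real.log x) ^ m)) :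
    Tendsto (fun x => F x / (x * Real.log x ^ n)) atTop (𝓝 0) := by
  have h1 := (tendsto_one_add_log_pow_div_log_pow h).const_mul B
  rw [mul_zero] at h1
  refine squeeze_zero_norm' ?_ h1
  filter_upwards [eventually_gt_atTop 1] with x hx
  have := Real.log_pos hx
  have hx0 : 0 < x := by linarith
  rw [Real.norm_eq_abs, abs_div, abs_of_pos (by positivity : 0 < x * Real.log x ^ n),
    div_le_iff₀ (by positivity)]
  refine (hB x hx.le).trans (le_of_eq ?_)
  field_simp

theorem tendsto_summatory_zeta_pow (z : ℕ) :
    Tendsto (fun x => summatory ((ζ : ArithmeticFunction ℝ) ^ (z + 2)) x /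
      (x * Real.log x ^ (z + 1))) atTop (𝓝 (1 / (z + 1).factorial)) := by
  obtain ⟨C, -, h⟩ := abs_summatory_zeta_pow_sub_le z
  have h1 := tendsto_div_mul_log_pow_of_le (Nat.lt_succ_self z) h
  have h2 := h1.add_const (1 / ((z + 1).factorial : ℝ))
  rw [zero_add] at h2
  refine h2.congr' ?_
  filter_upwards [eventually_gt_atTop 1] with x hx
  have := Real.log_pos hx
  have hx0 : 0 < x := by linarith
  have : ((z + 1).factorial : ℝ) ≠ 0 := by positivity
  field_simp
  simp

theorem summatory_oddSqfreePow_eq (z : ℕ) (x : ℝ) : summatory (oddSqfreePow z) x =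
    ∑ a ∈ Ioc 0 ⌊x⌋₊, sqfreeCorrection z z a *
      summatory ((ζ : ArithmeticFunction ℝ) ^ z) (x / a) := by
  rw [← summatory_mul, sqfreeCorrection_mul_zeta_pow]

theorem abs_summatory_zeta_pow_le (z : ℕ) {x : ℝ} (hx : 1 ≤ x) :
    |summatory ((ζ : ArithmeticFunction ℝ) ^ (z + 1)) x| ≤ 1 * (x * (1 + Real.log x) ^ z) := by
  rw [abs_of_nonneg (summatory_nonneg (zeta_pow_nonneg _) _), one_mul]
  exact summatory_zeta_pow_le z hx

theorem tendsto_summatory_oddSqfreePow (z : ℕ) :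
    Tendsto (fun x => summatory (oddSqfreePow (z + 2)) x / (x * Real.log x ^ (z + 1))) atTop
      (𝓝 (1 / (z + 1).factorial * sqfreeConst (z + 2))) := by
  simp only [summatory_oddSqfreePow_eq]
  exact tendsto_sum_mul_comp_div (summable_abs_sqfreeCorrection_div _)
    (fun y hy => abs_summatory_zeta_pow_le (z + 1) hy) (tendsto_summatory_zeta_pow z)

theorem exists_summatory_oddSqfreePow_le (z : ℕ) : ∃ B : ℝ, ∀ x, 1 ≤ x →
    |summatory (oddSqfreePow (z + 1)) x| ≤ B * (x * (1 + Real.log x) ^ z) := by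
  refine ⟨1 * ∑' n : ℕ, |sqfreeCorrection (z + 1) (z + 1) n| / n, fun x hx => ?_⟩
  rw [summatory_oddSqfreePow_eq]
  exact abs_sum_mul_comp_div_le (summable_abs_sqfreeCorrection_div _)
    (fun y hy => abs_summatory_zeta_pow_le z hy) hx

/-- The quadratic character modulo `4` as an arithmetic function. -/
noncomputable def chiFour : ArithmeticFunction ℝ := ⟨fun n => (ZMod.χ₄ n : ℝ), by simp⟩

theorem chiFour_apply (n : ℕ) : chiFour n = (ZMod.χ₄ n : ℝ) := rfl

theorem chiFour_mul (m n : ℕ) : chiFour (m * n) = chiFour m * chiFour n := by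
  rw [chiFour_apply, chiFour_apply, chiFour_apply, Nat.cast_mul, map_mul, Int.cast_mul]

theorem chiFour_eq (n : ℕ) :
    chiFour n = if n % 2 = 0 then 0 else if n % 4 = 1 then 1 else -1 := by
  rw [chiFour_apply, ZMod.χ₄_nat_eq_if_mod_four]
  push_cast
  rfl

theorem chiFour_isMultiplicative : chiFour.IsMultiplicative :=
  ⟨by simp [chiFour_apply], fun _ => chiFour_mul _ _⟩

theorem abs_chiFour_le (n : ℕ) : |chiFour n| ≤ (ζ : ArithmeticFunction ℝ) n := by
  rw [natCoe_apply, zeta_apply, chiFour_eq]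
  rcases Nat.eq_zero_or_pos n with rfl | h
  · simp
  · rw [if_neg h.ne']; split_ifs <;> simp

theorem sum_chiFour (N : ℕ) : ∑ n ∈ Ioc 0 N, chiFour n = if N % 4 = 1 ∨ N % 4 = 2 then 1 else 0 := by
  induction N with
  | zero => simp
  | succ N ih =>
    rw [sum_Ioc_succ_top (by omega), ih, chiFour_eq]
    have h : N % 4 = 0 ∨ N % 4 = 1 ∨ N % 4 = 2 ∨ N % 4 = 3 := by omega
    rcases h with h | h | h | h <;>
      simp [h, Nat.add_mod, ← Nat.mod_mod_of_dvd N (by norm_num : 2 ∣ 4)]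

theorem abs_summatory_chiFour_le (x : ℝ) : |summatory chiFour x| ≤ 1 := by
  rw [summatory, sum_chiFour]
  split_ifs <;> simp

/-- The partial sums of χ₄ are bounded by 1, so a convolution factor χ₄ costs no logarithm, whereas
a factor ζ costs one. -/
theorem abs_summatory_mul_chiFour_le {g F : ArithmeticFunction ℝ} (h : ∀ n, |g n| ≤ F n) (x : ℝ) :
    |summatory (g * chiFour) x| ≤ summatory F x := by
  rw [summatory_mul]
  refine (abs_sum_le_sum_abs _ _).trans (sum_le_sum fun n _ => ?_)
  rw [abs_mul]
  exact (mul_le_of_le_one_right (abs_nonneg _) (abs_summatory_chiFour_le _)).trans (h n)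

theorem abs_mul_apply_le {f g F G : ArithmeticFunction ℝ} (hf : ∀ n, |f n| ≤ F n)
    (hg : ∀ n, |g n| ≤ G n) (n : ℕ) : |(f * g) n| ≤ (F * G) n := by
  rw [mul_apply, mul_apply]
  refine (abs_sum_le_sum_abs _ _).trans (sum_le_sum fun a _ => ?_)
  rw [abs_mul]
  exact mul_le_mul (hf _) (hg _) (abs_nonneg _) ((abs_nonneg _).trans (hf _))

theorem abs_chiFour_pow_le (j n : ℕ) : |(chiFour ^ j) n| ≤ ((ζ : ArithmeticFunction ℝ) ^ j) n := by
  induction j generalizing n with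
  | zero => rw [pow_zero, pow_zero, one_apply]; split_ifs <;> simp
  | succ j ih =>
    rw [pow_succ, pow_succ]
    exact abs_mul_apply_le ih abs_chiFour_le n

theorem chiFour_pmul_mul (f g : ArithmeticFunction ℝ) :
    chiFour.pmul (f * g) = chiFour.pmul f * chiFour.pmul g := by
  ext n
  rw [pmul_apply, mul_apply, mul_apply, mul_sum]
  refine sum_congr rfl fun a ha => ?_
  rw [pmul_apply, pmul_apply, ← (Nat.mem_divisorsAntidiagonal.1 ha).1, chiFour_mul]
  ring

theorem chiFour_pmul_zeta_pow (z : ℕ) :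
    chiFour.pmul ((ζ : ArithmeticFunction ℝ) ^ z) = chiFour ^ z := by
  induction z with
  | zero =>
    ext n
    rw [pow_zero, pow_zero, pmul_apply, one_apply]
    split_ifs with h
    · rw [h, chiFour_isMultiplicative.map_one, mul_one]
    · rw [mul_zero]
  | succ z ih => rw [pow_succ, pow_succ, chiFour_pmul_mul, ih, pmul_zeta]

theorem abs_summatory_chiFour_pow_le (z : ℕ) {x : ℝ} (hx : 1 ≤ x) :
    |summatory (chiFour ^ (z + 2)) x| ≤ 1 * (x * (1 + Real.log x) ^ z) := by
  rw [pow_succ, one_mul]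
  exact (abs_summatory_mul_chiFour_le (abs_chiFour_pow_le (z + 1)) x).trans
    (summatory_zeta_pow_le z hx)

/-- Because χ₄ is completely multiplicative, the twist turns h * ζ^z into (χ₄ h) * χ₄^z, with z + 2
in place of z here. One of the convolution factors χ₄ saves a logarithm, so the two odd classes
modulo 4 share the main term equally. -/
theorem tendsto_summatory_chiFour_oddSqfreePow (z : ℕ) :
    Tendsto (fun x => summatory (chiFour.pmul (oddSqfreePow (z + 2))) x /
      (x * Real.log x ^ (z + 1))) atTop (𝓝 0) := by
  have e : ∀ x, summatory (chiFour.pmul (oddSqfreePow (z + 2))) x = ∑ a ∈ Ioc 0 ⌊x⌋₊,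
      chiFour.pmul (sqfreeCorrection (z + 2) (z + 2)) a * summatory (chiFour ^ (z + 2)) (x / a) := by
    intro x
    rw [← summatory_mul, ← chiFour_pmul_zeta_pow, ← chiFour_pmul_mul, sqfreeCorrection_mul_zeta_pow]
  have hs : Summable fun n : ℕ => |chiFour.pmul (sqfreeCorrection (z + 2) (z + 2)) n| / n := by
    refine Summable.of_nonneg_of_le (fun n => by positivity) (fun n => ?_)
      (summable_abs_sqfreeCorrection_div (z + 2))
    rw [pmul_apply, abs_mul]
    gcongr
    refine mul_le_of_le_one_left (abs_nonneg _) ((abs_chiFour_le n).trans ?_)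
    rw [natCoe_apply, zeta_apply]
    split_ifs <;> simp
  simp only [e]
  exact tendsto_div_mul_log_pow_of_le (Nat.lt_succ_self z) fun x hx =>
    abs_sum_mul_comp_div_le hs (fun y hy => abs_summatory_chiFour_pow_le z hy) hx

/-- The sum of `z ^ ω(n)` over odd squarefree `n ≤ x` with `n ≡ a` modulo `4`. -/
noncomputable def sqfreeSumMod (z a : ℕ) (x : ℝ) : ℝ :=
  ∑ n ∈ Ioc 0 ⌊x⌋₊ with n % 4 = a, oddSqfreePow z n

theorem sqfreeSumMod_eq (z : ℕ) (x : ℝ) :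
    sqfreeSumMod z 1 x =
      (summatory (oddSqfreePow z) x + summatory (chiFour.pmul (oddSqfreePow z)) x) / 2 ∧
    sqfreeSumMod z 3 x =
      (summatory (oddSqfreePow z) x - summatory (chiFour.pmul (oddSqfreePow z)) x) / 2 := by
  rw [summatory, summatory, ← sum_add_distrib, ← sum_sub_distrib, sum_div, sum_div]
  have h : ∀ n, oddSqfreePow z n ≠ 0 → n % 4 = 1 ∨ n % 4 = 3 := by
    intro n hn
    rw [oddSqfreePow_apply] at hn
    have : Odd n := by by_contra h; simp [h] at hn
    rw [Nat.odd_iff] at this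
    omega
  constructor <;> rw [sqfreeSumMod, sum_filter] <;> refine sum_congr rfl fun n _ => ?_ <;>
    by_cases h0 : oddSqfreePow z n = 0
  · simp [h0]
  · rw [pmul_apply, chiFour_eq]
    rcases h n h0 with h | h <;> have : n % 2 = 1 := by omega
    all_goals simp [h, this]
  · simp [h0]
  · rw [pmul_apply, chiFour_eq]
    rcases h n h0 with h | h <;> have : n % 2 = 1 := by omega
    all_goals simp [h, this]

theorem tendsto_sqfreeSumMod (z : ℕ) {a : ℕ} (ha : a = 1 ∨ a = 3) :
    Tendsto (fun x => sqfreeSumMod (z + 2) a x / (x * Real.log x ^ (z + 1))) atTop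
      (𝓝 (1 / (z + 1).factorial * sqfreeConst (z + 2) / 2)) := by
  have h1 := tendsto_summatory_oddSqfreePow z
  have h2 := tendsto_summatory_chiFour_oddSqfreePow z
  rcases ha with rfl | rfl
  · have h := (h1.add h2).div_const 2
    rw [add_zero] at h
    refine h.congr fun x => ?_
    rw [(sqfreeSumMod_eq _ x).1]
    ring
  · have h := (h1.sub h2).div_const 2
    rw [sub_zero] at h
    refine h.congr fun x => ?_
    rw [(sqfreeSumMod_eq _ x).2]
    ring

theorem mul_apply_prime {f g : ArithmeticFunction ℝ} (hf : f 1 = 1) (hg : g 1 = 1) {p : ℕ}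
    (hp : p.Prime) : (f * g) p = f p + g p := by
  rw [mul_apply, Nat.sum_divisorsAntidiagonal fun i j => f i * g j, hp.sum_divisors]
  simp [hf, hg, Nat.div_self hp.pos]

theorem zeta_mul_chiFour_nonneg (n : ℕ) : 0 ≤ ((ζ : ArithmeticFunction ℝ) * chiFour) n := by
  have hm : ((ζ : ArithmeticFunction ℝ) * chiFour).IsMultiplicative :=
    isMultiplicative_zeta.natCast.mul chiFour_isMultiplicative
  rcases Nat.eq_zero_or_pos n with rfl | hn
  · simp
  rw [hm.multiplicative_factorization _ hn.ne']
  refine prod_nonneg fun p hp => ?_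
  have hpp : p.Prime := Nat.prime_of_mem_primeFactors hp
  change 0 ≤ ((ζ : ArithmeticFunction ℝ) * chiFour) (p ^ n.factorization p)
  rw [mul_comm, coe_mul_zeta_apply, Nat.sum_divisors_prime_pow hpp]
  have hpow : ∀ i, chiFour (p ^ i) = chiFour p ^ i := by
    intro i
    induction i with
    | zero => simp [chiFour_isMultiplicative.map_one]
    | succ i ih => rw [pow_succ, chiFour_mul, ih, pow_succ]
  simp only [hpow]
  rw [chiFour_eq]
  split_ifs
  · exact sum_nonneg fun i _ => by positivity
  · exact sum_nonneg fun i _ => by positivity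
  · rw [neg_one_geom_sum]; split_ifs <;> norm_num

theorem zeta_mul_chiFour_pow_nonneg (j n : ℕ) :
    0 ≤ (((ζ : ArithmeticFunction ℝ) * chiFour) ^ j) n := by
  induction j generalizing n with
  | zero => rw [pow_zero, one_apply]; split_ifs <;> norm_num
  | succ j ih =>
    rw [pow_succ, mul_apply]
    exact sum_nonneg fun a _ => mul_nonneg (ih _) (zeta_mul_chiFour_nonneg _)

/-- The value of ζ * χ₄ at a prime p ≡ 1 mod 4 is 2, so its j-th convolution power is 2j there and
agrees with (2j)^ω at the relevant squarefree n. At all other n non-negativity suffices. -/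
theorem oddSqfreePow_le_of_primes (j n : ℕ) (h : ∀ p ∈ n.primeFactors, p % 4 = 1) :
    oddSqfreePow (2 * j) n ≤ (((ζ : ArithmeticFunction ℝ) * chiFour) ^ j) n := by
  have hm : ((ζ : ArithmeticFunction ℝ) * chiFour).IsMultiplicative :=
    isMultiplicative_zeta.natCast.mul chiFour_isMultiplicative
  rw [oddSqfreePow_apply]
  split_ifs with hn
  · have hv : ∀ p ∈ n.primeFactors, ∀ j, (((ζ : ArithmeticFunction ℝ) * chiFour) ^ j) p
        = (2 * j : ℕ) := by
      intro p hp j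
      have hpp : p.Prime := Nat.prime_of_mem_primeFactors hp
      induction j with
      | zero => simp [one_apply_ne hpp.one_lt.ne']
      | succ j ih =>
        rw [pow_succ, mul_apply_prime hm.pow.map_one hm.map_one hpp, ih,
          mul_apply_prime (by simp) chiFour_isMultiplicative.map_one hpp, chiFour_eq,
          natCoe_apply, zeta_apply_ne hpp.ne_zero]
        have h1 := h p hp
        have h2 : p % 2 = 1 := by omega
        simp [h1, h2]
        ring
    have hprod : (((ζ : ArithmeticFunction ℝ) * chiFour) ^ j) n =
        ∏ p ∈ n.primeFactors, (((ζ : ArithmeticFunction ℝ) * chiFour) ^ j) p := by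
      rw [← hm.pow.map_prod_of_subset_primeFactors n n.primeFactors subset_rfl,
        Nat.prod_primeFactors_of_squarefree hn.2]
    rw [hprod, prod_congr rfl fun p hp => hv p hp j, prod_const]
  · exact zeta_mul_chiFour_pow_nonneg j n

/-- In (ζ * χ₄)^(j+1) the last factor χ₄ is summed first and costs nothing, which leaves the bound
for ζ^(2j+1). This is one logarithm below the unrestricted sum, and no more is needed. -/
theorem exists_sum_oddSqfreePow_primes_le (j : ℕ) : ∃ B : ℝ, ∀ x, 1 ≤ x →
    |∑ n ∈ Ioc 0 ⌊x⌋₊ with ∀ p ∈ n.primeFactors, p % 4 = 1, oddSqfreePow (2 * (j + 1)) n| ≤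
      B * (x * (1 + Real.log x) ^ (2 * j)) := by
  refine ⟨1, fun x hx => ?_⟩
  rw [abs_of_nonneg (sum_nonneg fun n _ => oddSqfreePow_nonneg _ n), one_mul]
  have e : ((ζ : ArithmeticFunction ℝ) * chiFour) ^ (j + 1) =
      ((ζ : ArithmeticFunction ℝ) ^ (j + 1) * chiFour ^ j) * chiFour := by
    rw [mul_pow, pow_succ chiFour, mul_assoc]
  have h1 : ∑ n ∈ Ioc 0 ⌊x⌋₊ with ∀ p ∈ n.primeFactors, p % 4 = 1,
      oddSqfreePow (2 * (j + 1)) n ≤ summatory (((ζ : ArithmeticFunction ℝ) * chiFour) ^ (j + 1)) x := by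
    rw [summatory, sum_filter]
    refine sum_le_sum fun n _ => ?_
    split_ifs with h
    · exact oddSqfreePow_le_of_primes _ n h
    · exact zeta_mul_chiFour_pow_nonneg _ n
  have h2 := abs_summatory_mul_chiFour_le (g := (ζ : ArithmeticFunction ℝ) ^ (j + 1) * chiFour ^ j)
    (fun n => abs_mul_apply_le (fun n => (abs_of_nonneg (zeta_pow_nonneg (j + 1) n)).le)
      (abs_chiFour_pow_le j) n) x
  rw [← e, ← pow_add, show j + 1 + j = 2 * j + 1 by ring] at h2
  exact h1.trans ((le_abs_self _).trans (h2.trans (summatory_zeta_pow_le _ hx)))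

end meanvalue

/-! ### Counting surjections onto elementary abelian 2-groups -/

section elementary

theorem mul_comm_of_mul_self_eq_one {V : Type*} [Group V] (h : ∀ x : V, x * x = 1) (a b : V) :
    a * b = b * a := by
  have ha : a⁻¹ = a := inv_eq_of_mul_eq_one_left (h a)
  have hb : b⁻¹ = b := inv_eq_of_mul_eq_one_left (h b)
  have hab : (a * b)⁻¹ = a * b := inv_eq_of_mul_eq_one_left (h _)
  rw [← hab, mul_inv_rev, ha, hb]

theorem natCard_eq_two_pow_finrank (M : Type*) [AddCommGroup M] [Module (ZMod 2) M] [Finite M] :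
    Nat.card M = 2 ^ Module.finrank (ZMod 2) M := by
  rw [Module.natCard_eq_pow_finrank (K := ZMod 2), Nat.card_zmod]

theorem natCard_dual (M : Type*) [AddCommGroup M] [Module (ZMod 2) M] [Finite M] :
    Nat.card (Module.Dual (ZMod 2) M) = Nat.card M := by
  have : Finite (Module.Dual (ZMod 2) M) := Module.finite_of_finite (ZMod 2)
  rw [natCard_eq_two_pow_finrank, natCard_eq_two_pow_finrank, Subspace.dual_finrank_eq]

theorem two_nsmul_additive {V : Type*} [CommGroup V] (h : ∀ x : V, x * x = 1) (x : Additive V) :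
    2 • x = 0 := by
  rw [two_nsmul]
  exact h x.toMul

theorem exists_mulEquiv_C2pow {V : Type*} [Group V] [Finite V] (h : ∀ x : V, x * x = 1) {n : ℕ}
    (hn : Nat.card V = 2 ^ n) : Nonempty (V ≃* C2pow n) := by
  let _ : CommGroup V := { ‹Group V› with mul_comm := mul_comm_of_mul_self_eq_one h }
  let _ : Module (ZMod 2) (Additive V) := AddCommGroup.zmodModule (two_nsmul_additive h)
  have h1 := natCard_eq_two_pow_finrank (Additive V)
  have h2 : Nat.card (Additive V) = Nat.card V := rfl
  rw [h2, hn] at h1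
  have h3 := Nat.pow_right_injective le_rfl h1
  have : Module.finrank (ZMod 2) (Additive V) = Module.finrank (ZMod 2) (Fin n → ZMod 2) := by
    rw [← h3, Module.finrank_fin_fun]
  exact ⟨AddEquiv.toMultiplicativeRight (LinearEquiv.ofFinrankEq _ _ this).toAddEquiv⟩

theorem C2pow_mul_self {n : ℕ} (x : C2pow n) : x * x = 1 := by
  change Multiplicative.ofAdd (x.toAdd + x.toAdd) = 1
  rw [← ofAdd_zero]
  congr 1
  ext i
  exact CharTwo.add_self_eq_zero _

theorem natCard_C2pow (n : ℕ) : Nat.card (C2pow n) = 2 ^ n := by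
  change Nat.card (Fin n → ZMod 2) = _
  simp

/-- If the map is not surjective, a non-zero linear form kills its image and gives a non-trivial
relation Σ c_j f_j = 0. Then f is determined by c and by the k coordinates other than one at which c
is non-zero. -/
theorem card_linearMap_not_surjective_le (M : Type*) [AddCommGroup M] [Module (ZMod 2) M] [Finite M]
    (k : ℕ) : Nat.card {f : Fin (k + 1) → Module.Dual (ZMod 2) M //
      ¬ Function.Surjective (LinearMap.pi f)} ≤ 2 ^ (k + 1) * Nat.card M ^ k := by
  have hfin : Finite (Module.Dual (ZMod 2) M) := Module.finite_of_finite (ZMod 2)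
  have key : ∀ f : {f : Fin (k + 1) → Module.Dual (ZMod 2) M //
      ¬ Function.Surjective (LinearMap.pi f)}, ∃ c : {c : Fin (k + 1) → ZMod 2 // ∃ i, c i ≠ 0},
        ∑ j, c.1 j • f.1 j = 0 := by
    rintro ⟨f, hf⟩
    rw [← LinearMap.range_eq_top] at hf
    obtain ⟨l, hl0, hl⟩ := Submodule.exists_le_ker_of_lt_top _ (lt_top_iff_ne_top.2 hf)
    have hle := LinearMap.pi_apply_eq_sum_univ l
    refine ⟨⟨fun j => l fun i => if j = i then 1 else 0, ?_⟩, LinearMap.ext fun m => ?_⟩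
    · by_contra! h
      exact hl0 (LinearMap.ext fun x => by rw [hle]; simp [h])
    · have := hl ⟨m, rfl⟩
      rw [LinearMap.mem_ker, hle] at this
      simpa [mul_comm] using this
  choose c hc using key
  have hi := fun c : {c : Fin (k + 1) → ZMod 2 // ∃ i, c i ≠ 0} => c.2
  choose i hi using hi
  have hinj : Function.Injective fun f : {f : Fin (k + 1) → Module.Dual (ZMod 2) M //
      ¬ Function.Surjective (LinearMap.pi f)} =>
      ((c f).1, fun j => f.1 ((i (c f)).succAbove j)) := by
    intro f g hfg
    rw [Prod.mk.injEq] at hfg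
    have hcc : c f = c g := Subtype.ext hfg.1
    have h1 := hc f
    have h2 := hc g
    rw [← hcc] at h2
    have h3 := hfg.2
    rw [← hcc] at h3
    rw [Fin.sum_univ_succAbove _ (i (c f))] at h1 h2
    simp only [funext_iff] at h3
    simp only [h3] at h1
    have h4 : f.1 (i (c f)) = g.1 (i (c f)) := by
      have := h1.trans h2.symm
      rw [add_left_inj] at this
      exact smul_right_injective _ (hi (c f)) this
    refine Subtype.ext (funext fun j => ?_)
    rcases Fin.eq_self_or_eq_succAbove (i (c f)) j with rfl | ⟨j, rfl⟩
    · exact h4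
    · exact h3 j
  have hfin2 : Finite (Fin k → Module.Dual (ZMod 2) M) := inferInstance
  refine (Nat.card_le_card_of_injective _ hinj).trans (le_of_eq ?_)
  rw [Nat.card_prod, Nat.card_fun, Nat.card_fun, natCard_dual]
  simp

/-- The number of surjective homomorphisms from `V` to `C₂ᵏ`. -/
noncomputable def surjCount (k : ℕ) (V : Type*) [Group V] : ℕ :=
  Nat.card {f : V →* C2pow k // Function.Surjective f}

/-- Homomorphisms from an elementary abelian `2`-group to `C₂ᵏ`, by coordinates. -/
noncomputable def dualEquivHomC2pow (V : Type*) [CommGroup V] [Module (ZMod 2) (Additive V)]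
    (k : ℕ) : (Fin k → Module.Dual (ZMod 2) (Additive V)) ≃ (V →* C2pow k) where
  toFun f := AddMonoidHom.toMultiplicativeRight (LinearMap.pi f).toAddMonoidHom
  invFun g := fun i => (LinearMap.proj i).comp (AddMonoidHom.toZModLinearMap 2
    (M₁ := Fin k → ZMod 2) (MonoidHom.toAdditiveLeft g))
  left_inv f := by ext; rfl
  right_inv g := by ext; rfl

theorem surjCount_bounds (k : ℕ) (V : Type*) [Group V] [Finite V] (h : ∀ x : V, x * x = 1) :
    surjCount (k + 1) V ≤ Nat.card V ^ (k + 1) ∧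
      Nat.card V ^ (k + 1) ≤ surjCount (k + 1) V + 2 ^ (k + 1) * Nat.card V ^ k := by
  let _ : CommGroup V := { ‹Group V› with mul_comm := mul_comm_of_mul_self_eq_one h }
  let _ : Module (ZMod 2) (Additive V) := AddCommGroup.zmodModule (two_nsmul_additive h)
  have hfin : Finite (Module.Dual (ZMod 2) (Additive V)) := Module.finite_of_finite (ZMod 2)
  have hcard : Nat.card (Fin (k + 1) → Module.Dual (ZMod 2) (Additive V)) = Nat.card V ^ (k + 1) := by
    rw [Nat.card_fun, natCard_dual]
    simp only [Nat.card_eq_fintype_card, Fintype.card_fin]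
    rfl
  have e : surjCount (k + 1) V = Nat.card {f : Fin (k + 1) → Module.Dual (ZMod 2) (Additive V) //
      Function.Surjective (LinearMap.pi f)} :=
    Nat.card_congr ((dualEquivHomC2pow V (k + 1)).subtypeEquiv fun f => Iff.rfl).symm
  have hsum : Nat.card (Fin (k + 1) → Module.Dual (ZMod 2) (Additive V)) =
      Nat.card {f : Fin (k + 1) → Module.Dual (ZMod 2) (Additive V) //
        Function.Surjective (LinearMap.pi f)} +
      Nat.card {f : Fin (k + 1) → Module.Dual (ZMod 2) (Additive V) //
        ¬ Function.Surjective (LinearMap.pi f)} := by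
    classical
    rw [← Nat.card_sum]
    exact Nat.card_congr (Equiv.sumCompl _).symm
  have hle := card_linearMap_not_surjective_le (Additive V) k
  rw [show Nat.card (Additive V) = Nat.card V from rfl] at hle
  omega

theorem natCard_mulEquiv_congr {A B C : Type*} [Group A] [Group B] [Group C] (e : A ≃* B) :
    Nat.card (A ≃* C) = Nat.card (B ≃* C) :=
  Nat.card_congr
    { toFun := fun f => e.symm.trans f
      invFun := fun f => e.trans f
      left_inv := fun f => by ext; simp
      right_inv := fun f => by ext; simp }

/-- A surjection amounts to its kernel together with an isomorphism of the quotient with C₂^k, and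
for each kernel these isomorphisms are as numerous as the automorphisms of C₂^k. -/
theorem surjCount_eq (k : ℕ) (V : Type*) [Group V] [Finite V] (h : ∀ x : V, x * x = 1) :
    surjCount k V = Nat.card {H : Subgroup V // H.index = 2 ^ k} * Nat.card (MulAut (C2pow k)) := by
  let _ : CommGroup V := { ‹Group V› with mul_comm := mul_comm_of_mul_self_eq_one h }
  have hiso : ∀ H : {H : Subgroup V // H.index = 2 ^ k}, Nonempty (V ⧸ H.1 ≃* C2pow k) := by
    intro H
    refine exists_mulEquiv_C2pow (fun x => ?_) H.2
    obtain ⟨x, rfl⟩ := QuotientGroup.mk_surjective x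
    rw [← QuotientGroup.mk_mul, h, QuotientGroup.mk_one]
  let F : (Σ H : {H : Subgroup V // H.index = 2 ^ k}, (V ⧸ H.1 ≃* C2pow k)) →
      {f : V →* C2pow k // Function.Surjective f} := fun t =>
    ⟨t.2.toMonoidHom.comp (QuotientGroup.mk' t.1.1),
      t.2.surjective.comp (QuotientGroup.mk'_surjective _)⟩
  have hker : ∀ t, (F t).1.ker = t.1.1 := by
    intro t
    ext x
    simp [F]
  have hF : Function.Bijective F := by
    constructor
    · rintro ⟨⟨H, hH⟩, e⟩ ⟨⟨H', hH'⟩, e'⟩ hee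
      obtain rfl : H = H' := by
        exact (hker ⟨⟨H, hH⟩, e⟩).symm.trans ((congrArg (fun f => f.1.ker) hee).trans (hker _))
      congr 1
      refine MulEquiv.ext fun x => ?_
      obtain ⟨x, rfl⟩ := QuotientGroup.mk_surjective x
      exact DFunLike.congr_fun (congrArg Subtype.val hee) x
    · rintro ⟨f, hf⟩
      have hi : f.ker.index = 2 ^ k := by
        rw [Subgroup.index_ker, MonoidHom.range_eq_top.2 hf, Subgroup.card_top, natCard_C2pow]
      exact ⟨⟨⟨f.ker, hi⟩, QuotientGroup.quotientKerEquivOfSurjective f hf⟩,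
        Subtype.ext (MonoidHom.ext fun x => rfl)⟩
  have hfin : Fintype {H : Subgroup V // H.index = 2 ^ k} := Fintype.ofFinite _
  rw [surjCount, ← Nat.card_congr (Equiv.ofBijective F hF), Nat.card_sigma]
  have : ∀ H : {H : Subgroup V // H.index = 2 ^ k}, Nat.card (V ⧸ H.1 ≃* C2pow k) =
      Nat.card (MulAut (C2pow k)) := by
    intro H
    obtain ⟨e⟩ := hiso H
    exact natCard_mulEquiv_congr e
  simp only [this, Finset.sum_const, smul_eq_mul, Finset.card_univ, Nat.card_eq_fintype_card]

end elementary

/-! ### The diagonal subgroup: structure, admissibility, failure of goodness -/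

section diagonal

theorem perm_fin_two_mul_self (b : Equiv.Perm (Fin 2)) : b * b = 1 := by
  revert b; decide

theorem perm_fin_two_eq {b : Equiv.Perm (Fin 2)} (hb : b ≠ 1) : b = Equiv.swap 0 1 := by
  revert b; decide

theorem diagonalType_left {G : Type*} [Group G] {g : WreathTwo G} (hg : g ∈ diagonalType G)
    (i j : Fin 2) : g.left i = g.left j := by
  fin_cases i <;> fin_cases j <;> first | rfl | exact hg | exact hg.symm

theorem mul_left_of_mem_diagonalType {G : Type*} [Group G] {g h : WreathTwo G}
    (hh : h ∈ diagonalType G) : (g * h).left = g.left * h.left := by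
  ext i
  change g.left i * h.left (g.right⁻¹ • i) = g.left i * h.left i
  rw [diagonalType_left hh _ i]

theorem diagonalType_mul_self {k : ℕ} {g : WreathTwo (C2pow k)}
    (hg : g ∈ diagonalType (C2pow k)) : g * g = 1 := by
  refine SemidirectProduct.ext ?_ ?_
  · rw [mul_left_of_mem_diagonalType hg]
    exact funext fun i => C2pow_mul_self (g.left i)
  · rw [SemidirectProduct.mul_right, perm_fin_two_mul_self]
    rfl

/-- The elements of the diagonal type subgroup as pairs. -/
noncomputable def diagonalTypeEquiv (G : Type*) [Group G] :
    diagonalType G ≃ G × Equiv.Perm (Fin 2) where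
  toFun g := (g.1.left 0, g.1.right)
  invFun a := ⟨⟨fun _ => a.1, a.2⟩, rfl⟩
  left_inv g := Subtype.ext (SemidirectProduct.ext (funext fun i => diagonalType_left g.2 0 i) rfl)
  right_inv _ := rfl

theorem natCard_diagonalType (k : ℕ) : Nat.card (diagonalType (C2pow k)) = 2 ^ (k + 1) := by
  rw [Nat.card_congr (diagonalTypeEquiv _), Nat.card_prod, natCard_C2pow, pow_succ]
  congr 1
  rw [Nat.card_eq_fintype_card]
  decide

theorem finite_diagonalType (k : ℕ) : Finite (diagonalType (C2pow k)) :=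
  Nat.finite_of_card_ne_zero (by rw [natCard_diagonalType]; positivity)

theorem nonempty_diagonalType_mulEquiv (k : ℕ) :
    Nonempty (diagonalType (C2pow k) ≃* C2pow (k + 1)) := by
  have := finite_diagonalType k
  exact exists_mulEquiv_C2pow (fun x => Subtype.ext (diagonalType_mul_self x.2))
    (natCard_diagonalType k)

theorem mem_outerInvolutions {k : ℕ} (a : C2pow k) :
    (⟨fun _ => a, Equiv.swap 0 1⟩ : WreathTwo (C2pow k)) ∈
      outerInvolutions (diagonalType (C2pow k)) := by
  have h1 : (⟨fun _ => a, Equiv.swap 0 1⟩ : WreathTwo (C2pow k)) ∈ diagonalType (C2pow k) := rfl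
  have h2 : (Equiv.swap 0 1 : Equiv.Perm (Fin 2)) ≠ 1 := by decide
  refine ⟨h1, ?_, h2⟩
  refine orderOf_eq_prime (by rw [pow_two]; exact diagonalType_mul_self h1) ?_
  intro h
  exact h2 (congrArg SemidirectProduct.right h)

theorem isAdmissible_diagonalType (k : ℕ) : IsAdmissible (diagonalType (C2pow k)) := by
  refine ⟨rfl, le_antisymm ((Subgroup.closure_le _).2 fun g hg => hg.1) fun g hg => ?_,
    fun a => ⟨⟨fun _ => a, 1⟩, rfl, rfl, rfl⟩⟩
  have hs := Subgroup.subset_closure (mem_outerInvolutions (g.left 0))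
  have hg' : g.left = fun _ => g.left 0 := funext fun i => diagonalType_left hg i 0
  by_cases hb : g.right = 1
  -- An element with trivial image in S₂ is a product of two outer involutions: (a, a, 1) = (a, a,
  -- σ)(1, 1, σ).
  · have h1 := Subgroup.subset_closure (mem_outerInvolutions (1 : C2pow k))
    have h2 := mul_mem hs h1
    convert! h2 using 1
    refine SemidirectProduct.ext ?_ ?_
    · rw [mul_left_of_mem_diagonalType rfl, hg']
      ext i
      simp
    · rw [hb, SemidirectProduct.mul_right, perm_fin_two_mul_self]
  · convert! hs using 1
    exact SemidirectProduct.ext hg' (perm_fin_two_eq hb)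

/-- The group is abelian, so conjugacy classes are singletons, but every (a, a, σ) is an outer
involution and `hk` provides some a ≠ 1. -/
theorem not_isGood_diagonalType {k : ℕ} (hk : 1 ≤ k) : ¬ IsGood (diagonalType (C2pow k)) := by
  rintro ⟨C, -, hC⟩
  have hcomm := mul_comm_of_mul_self_eq_one (V := diagonalType (C2pow k))
    (fun x => Subtype.ext (diagonalType_mul_self x.2))
  have key : ∀ a : C2pow k, ConjClasses.mk (⟨⟨fun _ => a, Equiv.swap 0 1⟩, rfl⟩ :
      diagonalType (C2pow k)) = C := fun a => hC _ ⟨_, mem_outerInvolutions a, rfl⟩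
  let a : C2pow k := Multiplicative.ofAdd fun _ => 1
  have h := (key 1).trans (key a).symm
  rw [ConjClasses.mk_eq_mk_iff_isConj, isConj_iff] at h
  obtain ⟨c, hc⟩ := h
  rw [hcomm c, mul_inv_cancel_right] at hc
  have h0 : (1 : C2pow k) = a := congrFun (congrArg (fun x => x.1.left) hc) 0
  have h1 := congrFun (congrArg Multiplicative.toAdd h0) ⟨0, hk⟩
  exact zero_ne_one (α := ZMod 2) h1

end diagonal

/-! ### Inertia groups and ramification of square roots -/

section inertia

open NumberField

theorem card_inertia_int {L : Type*} [Field L] [NumberField L] [IsGalois ℚ L]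
    (P : Ideal (𝓞 L)) [P.IsPrime] :
    Nat.card (P.inertia Gal(L/ℚ)) = P.ramificationIdx ℤ := by
  have := IsGaloisGroup.of_isFractionRing Gal(L/ℚ) ℤ (𝓞 L) ℚ L
  rw [Ideal.card_inertia_eq_ramificationIdxIn (P.under ℤ) P,
    Ideal.ramificationIdxIn_eq_ramificationIdx (P.under ℤ) P Gal(L/ℚ)]

theorem card_inertia_eq_ramificationIdx (K : Type*) {L : Type*} [Field K] [NumberField K] [Field L]
    [NumberField L] [Algebra K L] [IsGalois K L] (P : Ideal (𝓞 L)) [P.IsPrime] :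
    Nat.card (P.inertia Gal(L/K)) = P.ramificationIdx (𝓞 K) := by
  have := IsGaloisGroup.of_isFractionRing Gal(L/K) (𝓞 K) (𝓞 L) K L
  rw [Ideal.card_inertia_eq_ramificationIdxIn (P.under (𝓞 K)) P,
    Ideal.ramificationIdxIn_eq_ramificationIdx (P.under (𝓞 K)) P Gal(L/K)]

theorem isUnramifiedAt_iff_inertia_eq_bot (K : Type*) {L : Type*} [Field K] [NumberField K]
    [Field L] [NumberField L] [Algebra K L] [IsGalois K L] (P : Ideal (𝓞 L)) [P.IsPrime] :
    Algebra.IsUnramifiedAt (𝓞 K) P ↔ P.inertia Gal(L/K) = ⊥ := by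
  rw [← Ideal.ramificationIdx_eq_one_iff, ← card_inertia_eq_ramificationIdx, Subgroup.card_eq_one]

theorem not_mem_sq_of_ramificationIdx_eq_one {E : Type*} [Field E] [NumberField E]
    (Q : Ideal (𝓞 E)) [Q.IsPrime] (h : Q.ramificationIdx ℤ = 1) {p : ℤ} (hp : Prime p)
    (hpQ : (p : 𝓞 E) ∈ Q) : (p : 𝓞 E) ∉ Q ^ 2 := by
  have hlo : Q.LiesOver (Ideal.span {p}) :=
    (Ideal.liesOver_span_iff Ideal.IsPrime.ne_top' hp).mpr hpQ
  have hpr : (Ideal.span {p}).IsPrime := (Ideal.span_singleton_prime hp.ne_zero).2 hp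
  have h0 : Ideal.span {p} ≠ ⊥ := by simpa using hp.ne_zero
  intro hmem
  have hle : (Ideal.span {p}).map (algebraMap ℤ (𝓞 E)) ≤ Q := by
    rw [Ideal.map_span, Ideal.span_le]; simpa using hpQ
  rw [← Ideal.ramificationIdx'_eq_ramificationIdx (Ideal.span {p}) Q h0] at h
  refine (Ideal.ramificationIdx'_ne_one_iff hle).2 ?_ h
  rw [Ideal.map_span, Ideal.span_le]
  simpa using hmem

theorem one_mem_of_isCoprime {R : Type*} [CommRing R] {I : Ideal R} {a b : ℤ} (h : IsCoprime a b)
    (ha : (a : R) ∈ I) (hb : (b : R) ∈ I) : (1 : R) ∈ I := by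
  obtain ⟨u, v, huv⟩ := h
  have := I.add_mem (I.mul_mem_left (u : R) ha) (I.mul_mem_left (v : R) hb)
  rwa [← Int.cast_mul, ← Int.cast_mul, ← Int.cast_add, huv, Int.cast_one] at this

/-- If n = p m, then m is prime to p and p m = y² lies in Q². A Bézout relation then puts p itself
in Q². -/
theorem not_dvd_of_sq_eq {R : Type*} [CommRing R] (Q : Ideal R) [Q.IsPrime] {p : ℤ}
    (hp : Prime p) (hpQ : (p : R) ∈ Q) (hpQ2 : (p : R) ∉ Q ^ 2) {n : ℤ} (hn : Squarefree n)
    {y : R} (hy : y ^ 2 = (n : R)) : ¬ p ∣ n := by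
  rintro ⟨m, rfl⟩
  have hyQ : y ∈ Q := by
    refine Ideal.IsPrime.mem_of_pow_mem ‹_› 2 ?_
    rw [hy, Int.cast_mul]
    exact Q.mul_mem_right _ hpQ
  have hy2 : y ^ 2 ∈ Q ^ 2 := Ideal.pow_mem_pow hyQ 2
  rw [hy, Int.cast_mul] at hy2
  have hcop : IsCoprime p m := by
    rw [Prime.coprime_iff_not_dvd hp]
    rintro ⟨c, rfl⟩
    exact hp.not_isUnit (hn p ⟨c, by ring⟩)
  obtain ⟨u, v, huv⟩ := hcop
  refine hpQ2 ?_
  have h1 : (p : R) = (u : R) * (p : R) ^ 2 + (v : R) * ((p : R) * (m : R)) := by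
    have : p = u * p ^ 2 + v * (p * m) := by linear_combination -p * huv
    exact_mod_cast congrArg (Int.cast : ℤ → R) this
  rw [h1]
  exact (Q ^ 2).add_mem ((Q ^ 2).mul_mem_left _ (Ideal.pow_mem_pow hpQ 2))
    ((Q ^ 2).mul_mem_left _ hy2)

/-- If n ≡ 3 mod 4, then 1 + y and y - 1 both lie in Q, so their product n - 1 ≡ 2 mod 4 lies in Q².
Since 4 ∈ Q², also 2 ∈ Q². -/
theorem emod_four_of_sq_eq {R : Type*} [CommRing R] (Q : Ideal R) [Q.IsPrime]
    (hQ : (2 : R) ∈ Q) (hQ2 : (2 : R) ∉ Q ^ 2) {n : ℤ} (hn : Squarefree n)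
    {y : R} (hy : y ^ 2 = (n : R)) : n % 4 = 1 := by
  have h2 : ¬ (2 : ℤ) ∣ n := not_dvd_of_sq_eq Q Int.prime_two (by exact_mod_cast hQ)
    (by exact_mod_cast hQ2) hn hy
  by_contra h
  obtain ⟨m, rfl⟩ : ∃ m, n = 4 * m + 3 := ⟨n / 4, by omega⟩
  have hα : 1 + y ∈ Q := by
    refine Ideal.IsPrime.mem_of_pow_mem ‹_› 2 ?_
    have : (1 + y) ^ 2 = 2 * (y + (2 * m + 2 : ℤ)) := by
      push_cast at hy ⊢
      linear_combination hy
    rw [this]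
    exact Q.mul_mem_right _ hQ
  have hα2 : (1 + y) - 2 ∈ Q := Q.sub_mem hα hQ
  have hprod := Ideal.mul_mem_mul hα hα2
  rw [← pow_two] at hprod
  refine hQ2 ?_
  have h4 := Ideal.mul_mem_mul hQ hQ
  rw [← pow_two] at h4
  have : (2 : R) = (1 + y) * ((1 + y) - 2) - (m : R) * (2 * 2) := by
    push_cast at hy
    linear_combination -hy
  rw [this]
  exact (Q ^ 2).sub_mem hprod ((Q ^ 2).mul_mem_left _ h4)

theorem exists_int_of_sq {F : Type*} [Field F] {y : F} {n : ℤ} (hy : y ^ 2 = (n : F)) :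
    ∃ w : 𝓞 F, (w : F) = y ∧ w ^ 2 = (n : 𝓞 F) := by
  have hi : IsIntegral ℤ y := by
    refine IsIntegral.of_pow (n := 2) (by norm_num) ?_
    rw [hy]
    exact isIntegral_algebraMap (x := n)
  refine ⟨⟨y, hi⟩, rfl, ?_⟩
  refine RingOfIntegers.ext ?_
  change y ^ 2 = algebraMap (𝓞 F) F n
  rw [hy, map_intCast]

/-- The order of the inertia group is the ramification index of P both over ℤ and over its fixed
field. Multiplicativity in the tower leaves index 1 for the lower step. -/
theorem ramificationIdx_fixedField_inertia {L : Type*} [Field L] [NumberField L] [IsGalois ℚ L]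
    (P : Ideal (𝓞 L)) [P.IsPrime] :
    (P.under (𝓞 (IntermediateField.fixedField (P.inertia Gal(L/ℚ))))).ramificationIdx ℤ = 1 := by
  set I := P.inertia Gal(L/ℚ) with hI
  set E := IntermediateField.fixedField I with hE
  have h1 := card_inertia_int P
  have h2 := card_inertia_eq_ramificationIdx E P
  have h3 : P.inertia Gal(L/E) = ⊤ := by
    refine eq_top_iff.2 fun τ _ => ?_
    have hτ : ((IntermediateField.fixingSubgroupEquiv E).symm τ : Gal(L/ℚ)) ∈
        IntermediateField.fixingSubgroup E :=
      Subtype.prop _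
    have hI' : E.fixingSubgroup = I := IntermediateField.fixingSubgroup_fixedField I
    have hτ' : ((IntermediateField.fixingSubgroupEquiv E).symm τ : Gal(L/ℚ)) ∈ I :=
      hI'.le hτ
    intro x
    exact hτ' x
  rw [h3, Subgroup.card_top, ← Nat.card_congr (IntermediateField.fixingSubgroupEquiv E).toEquiv,
    hE, IntermediateField.fixingSubgroup_fixedField, ← hE, h1] at h2
  have h4 := Ideal.ramificationIdx_tower (R := ℤ) (P.under (𝓞 E)) P
  have h5 : 0 < P.ramificationIdx ℤ := Ideal.ramificationIdx_pos P ℤ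
  rw [← h2] at h4
  exact (Nat.eq_of_mul_eq_mul_right h5 (by rw [one_mul]; exact h4)).symm

theorem of_fixed_by_inertia {L : Type*} [Field L] [NumberField L] [IsGalois ℚ L]
    (P : Ideal (𝓞 L)) [P.IsPrime] {p : ℤ} (hp : Prime p) (hpP : (p : 𝓞 L) ∈ P)
    {n : ℤ} (hn : Squarefree n) {y : L} (hy : y ^ 2 = (n : L))
    (hfix : ∀ σ ∈ P.inertia Gal(L/ℚ), σ y = y) : ¬ p ∣ n ∧ (p = 2 → n % 4 = 1) := by
  set E := IntermediateField.fixedField (P.inertia Gal(L/ℚ)) with hE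
  have hyE : y ∈ E := fun σ => hfix σ.1 σ.2
  have hy' : (⟨y, hyE⟩ : E) ^ 2 = (n : E) := Subtype.ext (by simpa using hy)
  obtain ⟨w, -, hw⟩ := exists_int_of_sq hy'
  have hpQ : (p : 𝓞 E) ∈ P.under (𝓞 E) := by
    rw [Ideal.mem_comap, map_intCast]; exact hpP
  have hpQ2 := not_mem_sq_of_ramificationIdx_eq_one _ (ramificationIdx_fixedField_inertia P) hp hpQ
  refine ⟨not_dvd_of_sq_eq _ hp hpQ hpQ2 hn hw, ?_⟩
  rintro rfl
  exact emod_four_of_sq_eq (P.under (𝓞 E)) (by exact_mod_cast hpQ) (by exact_mod_cast hpQ2) hn hw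

/-- Since P is unramified over K, the inertia group over ℚ meets Gal(L/K) trivially. It thus has at
most one non-trivial element, and this element negates δ; if it also negates x, it fixes xδ. -/
theorem fixed_or_mul_fixed {K L : Type*} [Field K] [NumberField K] [Field L] [NumberField L]
    [Algebra K L] [IsGalois K L] {δ : K}
    (hδ : ∀ σ : Gal(L/ℚ), σ (algebraMap K L δ) = algebraMap K L δ →
      ∀ a : K, σ (algebraMap K L a) = algebraMap K L a)
    {d : ℤ} (hd : δ ^ 2 = (d : K)) (P : Ideal (𝓞 L)) [P.IsPrime]
    (hP : Algebra.IsUnramifiedAt (𝓞 K) P) {m : ℤ} {x : L} (hx : x ^ 2 = (m : L)) :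
    (∀ σ ∈ P.inertia Gal(L/ℚ), σ x = x) ∨
      ∀ σ ∈ P.inertia Gal(L/ℚ), σ (x * algebraMap K L δ) = x * algebraMap K L δ := by
  have hd' : (algebraMap K L δ) ^ 2 = (d : L) := by rw [← map_pow, hd, map_intCast]
  have hsign : ∀ (n : ℤ) (y : L), y ^ 2 = (n : L) → ∀ σ : Gal(L/ℚ), σ y = y ∨ σ y = -y := by
    intro n y hy σ
    refine sq_eq_sq_iff_eq_or_eq_neg.1 ?_
    rw [← map_pow, hy, map_intCast]
  have htriv : ∀ σ ∈ P.inertia Gal(L/ℚ), σ (algebraMap K L δ) = algebraMap K L δ → σ = 1 := by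
    intro σ hσ h
    rw [isUnramifiedAt_iff_inertia_eq_bot] at hP
    let σ' : Gal(L/K) := AlgEquiv.ofRingEquiv (f := σ.toRingEquiv) (hδ σ h)
    have h1 : σ' ∈ P.inertia Gal(L/K) := fun z => hσ z
    rw [hP, Subgroup.mem_bot] at h1
    ext z
    exact AlgEquiv.congr_fun h1 z
  by_cases hall : ∀ σ ∈ P.inertia Gal(L/ℚ), σ x = x
  · exact Or.inl hall
  · right
    push Not at hall
    obtain ⟨σ, hσ, hσx⟩ := hall
    have hσx' := (hsign m x hx σ).resolve_left hσx
    have hσδ := (hsign d _ hd' σ).resolve_left fun h => hσx (by rw [htriv σ hσ h]; rfl)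
    intro τ hτ
    rcases hsign d _ hd' τ with h | h
    · rw [htriv τ hτ h]; rfl
    · have h1 : σ⁻¹ * τ = 1 := by
        refine htriv _ (mul_mem (inv_mem hσ) hτ) ?_
        rw [AlgEquiv.mul_apply, h, ← hσδ]
        exact σ.symm_apply_apply _
      have h2 : τ = σ := (inv_mul_eq_one.1 h1).symm
      rw [h2, map_mul, hσx', hσδ, neg_mul_neg]

theorem dvd_of_forall_prime_dvd {m d : ℤ} (hm : Squarefree m) (hd : d ≠ 0)
    (h : ∀ p : ℕ, p.Prime → (p : ℤ) ∣ m → (p : ℤ) ∣ d) : m ∣ d := by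
  rw [← Int.natAbs_dvd_natAbs, ← Nat.prod_primeFactors_of_squarefree (Int.squarefree_natAbs.2 hm)]
  refine dvd_trans (Finset.prod_dvd_prod_of_subset _ (d.natAbs.primeFactors) _ fun p hp => ?_)
    (Nat.prod_primeFactors_dvd _)
  have hp' := Nat.mem_primeFactors.1 hp
  refine Nat.mem_primeFactors.2 ⟨hp'.1, ?_, Int.natAbs_ne_zero.2 hd⟩
  exact Int.natCast_dvd.1 (h p hp'.1 (Int.natCast_dvd.2 hp'.2.1))

theorem exists_prime_natCast_mem (L : Type*) [Field L] [NumberField L] {p : ℕ} (hp : p.Prime) :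
    ∃ P : Ideal (𝓞 L), P.IsPrime ∧ P ≠ ⊥ ∧ (p : 𝓞 L) ∈ P := by
  have hpr : (Ideal.span {(p : ℤ)}).IsPrime :=
    (Ideal.span_singleton_prime (by exact_mod_cast hp.ne_zero)).2 (Nat.prime_iff_prime_int.1 hp)
  obtain ⟨P, hP, hPp⟩ := Ideal.exists_ideal_over_prime_of_isIntegral_of_isDomain (S := 𝓞 L)
    (Ideal.span {(p : ℤ)}) (by
      rw [(RingHom.injective_iff_ker_eq_bot _).1 (algebraMap ℤ (𝓞 L)).injective_int]; exact bot_le)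
  have hpP : (p : 𝓞 L) ∈ P := by
    have h1 : (p : ℤ) ∈ P.comap (algebraMap ℤ (𝓞 L)) := by
      rw [hPp]; exact Ideal.mem_span_singleton_self _
    simpa using h1
  refine ⟨P, hP, ?_, hpP⟩
  rintro rfl
  exact hp.ne_zero (by simpa using hpP)

/-- The squarefree part of the product of two squarefree integers. -/
def sqfreeMul (m n : ℤ) : ℤ := (m / Int.gcd m n) * (n / Int.gcd m n)

theorem exists_eq_mul_gcd {m n : ℤ} (hm : Squarefree m) :
    ∃ g m' n' : ℤ, g ≠ 0 ∧ m = g * m' ∧ n = g * n' ∧ IsCoprime m' n' ∧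
      sqfreeMul m n = m' * n' := by
  have hg : (Int.gcd m n : ℤ) ≠ 0 := by
    simpa using fun h => absurd h hm.ne_zero
  obtain ⟨m', hm'⟩ := Int.gcd_dvd_left m n
  obtain ⟨n', hn'⟩ := Int.gcd_dvd_right m n
  have e1 : m / Int.gcd m n = m' := Int.ediv_eq_of_eq_mul_right hg hm'
  have e2 : n / Int.gcd m n = n' := Int.ediv_eq_of_eq_mul_right hg hn'
  refine ⟨Int.gcd m n, m', n', hg, hm', hn', ?_, by rw [sqfreeMul, e1, e2]⟩
  rw [Int.isCoprime_iff_gcd_eq_one, ← e1, ← e2]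
  exact Int.gcd_ediv_gcd_ediv_gcd (Nat.pos_of_ne_zero (by exact_mod_cast hg))

theorem squarefree_sqfreeMul {m n : ℤ} (hm : Squarefree m) (hn : Squarefree n) :
    Squarefree (sqfreeMul m n) := by
  obtain ⟨g, m', n', -, rfl, rfl, hc, h⟩ := exists_eq_mul_gcd (n := n) hm
  rw [h]
  exact (squarefree_mul_iff.2 ⟨hc.isRelPrime, hm.squarefree_of_dvd (Dvd.intro_left _ rfl),
    hn.squarefree_of_dvd (Dvd.intro_left _ rfl)⟩)

/-- Let n be the squarefree part of md. At every rational prime, one of ℚ(√m) and ℚ(√n) is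
unramified. The prime 2 selects one of m, n that is 1 mod 4. A prime dividing the selected integer
cannot divide the other one, and therefore divides d. -/
theorem radicand_of_unramified {K L : Type*} [Field K] [NumberField K] [Field L] [NumberField L]
    [Algebra K L] [IsGalois K L] [IsGalois ℚ L] {δ : K}
    (hδ : ∀ σ : Gal(L/ℚ), σ (algebraMap K L δ) = algebraMap K L δ →
      ∀ a : K, σ (algebraMap K L a) = algebraMap K L a)
    {d : ℤ} (hd : δ ^ 2 = (d : K)) (hds : Squarefree d)
    (hP : ∀ P : Ideal (𝓞 L), ∀ _ : P.IsPrime, P ≠ ⊥ → Algebra.IsUnramifiedAt (𝓞 K) P) {m : ℤ}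
    (hm : Squarefree m) {x : L} (hx : x ^ 2 = (m : L)) :
    (m % 4 = 1 ∧ m ∣ d) ∨ (sqfreeMul m d % 4 = 1 ∧ sqfreeMul m d ∣ d) := by
  have hns := squarefree_sqfreeMul hm hds
  have hloc : ∀ p : ℕ, p.Prime → (¬ (p : ℤ) ∣ m ∧ ((p : ℤ) = 2 → m % 4 = 1)) ∨
      (¬ (p : ℤ) ∣ sqfreeMul m d ∧ ((p : ℤ) = 2 → sqfreeMul m d % 4 = 1)) := by
    intro p hp
    obtain ⟨P, hPp, hP0, hpP⟩ := exists_prime_natCast_mem L hp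
    have hpP' : ((p : ℤ) : 𝓞 L) ∈ P := by exact_mod_cast hpP
    rcases fixed_or_mul_fixed hδ hd P (hP P hPp hP0) hx with h | h
    · exact Or.inl (of_fixed_by_inertia P (Nat.prime_iff_prime_int.1 hp) hpP' hm hx h)
    · right
      -- With g = gcd(m, d) up to notation, √m √d / g is a square root of the squarefree part of md.
      obtain ⟨g, m', d', hg, h1, h2, -, h3⟩ := exists_eq_mul_gcd (n := d) hm
      have hg' : (g : L) ≠ 0 := Int.cast_ne_zero.2 hg
      have hd' : (algebraMap K L δ) ^ 2 = (d : L) := by rw [← map_pow, hd, map_intCast]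
      refine of_fixed_by_inertia P (Nat.prime_iff_prime_int.1 hp) hpP' hns
        (y := x * algebraMap K L δ / g) ?_ fun σ hσ => ?_
      · rw [h3, div_pow, mul_pow, hx, hd', h1, h2]
        push_cast
        field_simp
      · rw [map_div₀, h σ hσ, map_intCast]
  obtain ⟨g, m', d', hg, h1, h2, -, h3⟩ := exists_eq_mul_gcd (n := d) hm
  rcases hloc 2 Nat.prime_two with h | h
  · refine Or.inl ⟨h.2 rfl, dvd_of_forall_prime_dvd hm hds.ne_zero fun p hp hpm => ?_⟩
    have h4 := ((hloc p hp).resolve_left fun h => h.1 hpm).1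
    rw [h1] at hpm
    rw [h2]
    rcases (Nat.prime_iff_prime_int.1 hp).dvd_or_dvd hpm with h5 | h5
    · exact h5.mul_right _
    · exact absurd (h3 ▸ h5.mul_right d') h4
  · refine Or.inr ⟨h.2 rfl, dvd_of_forall_prime_dvd hns hds.ne_zero fun p hp hpn => ?_⟩
    have h4 := ((hloc p hp).resolve_right fun h => h.1 hpn).1
    rw [h3] at hpn
    rw [h2]
    rcases (Nat.prime_iff_prime_int.1 hp).dvd_or_dvd hpn with h5 | h5
    · exact absurd (h1 ▸ h5.mul_left g) h4
    · exact h5.mul_left _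

theorem isIntegral_one_add_div_two {F : Type*} [Field F] [CharZero F] {x : F} {a : ℤ}
    (hx : x ^ 2 = (a : F)) (ha : a % 4 = 1) : IsIntegral ℤ ((1 + x) / 2) := by
  obtain ⟨b, rfl⟩ : ∃ b, a = 4 * b + 1 := ⟨a / 4, by omega⟩
  push_cast at hx
  refine ⟨Polynomial.X ^ 2 - (Polynomial.X + Polynomial.C b), ?_, ?_⟩
  · refine Polynomial.monic_X_pow_sub ((Polynomial.degree_add_le _ _).trans_lt ?_)
    exact max_lt (Polynomial.degree_X_le.trans_lt (by norm_num))
      (Polynomial.degree_C_le.trans_lt (by norm_num))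
  · simp only [Polynomial.eval₂_sub, Polynomial.eval₂_X_pow, Polynomial.eval₂_add,
      Polynomial.eval₂_X, Polynomial.eval₂_C]
    rw [eq_intCast]
    linear_combination hx / 4

/-- Suppose that an inertia element σ negates x = √a. If 2 ∉ P, then σw - w = -2w for w = √a and for
w = √(d/a), which is also negated, so a and d/a both lie in P although they are coprime. If 2 ∈ P,
then w = (1 + √a)/2 is integral and σw - w = -√a, so the odd number a lies in P. -/
theorem isUnramifiedAt_of_generators {K L : Type*} [Field K] [NumberField K] [Field L]
    [NumberField L] [Algebra K L] [IsGalois K L] {δ : K} {d : ℤ} (hd : δ ^ 2 = (d : K))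
    (hds : Squarefree d)
    (hgen : ∀ σ : Gal(L/K), (∀ (a : ℤ) (x : L), a % 4 = 1 → a ∣ d → x ^ 2 = (a : L) → σ x = x) →
      σ = 1) (P : Ideal (𝓞 L)) [P.IsPrime] : Algebra.IsUnramifiedAt (𝓞 K) P := by
  rw [isUnramifiedAt_iff_inertia_eq_bot, Subgroup.eq_bot_iff_forall]
  refine fun σ hσ => hgen σ fun a x ha had hx => ?_
  refine (sq_eq_sq_iff_eq_or_eq_neg.1 (?_ : (σ x) ^ 2 = x ^ 2)).resolve_right fun hneg => ?_
  · rw [← map_pow, hx, map_intCast]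
  have hx0 : x ≠ 0 := by
    rintro rfl
    have : (a : L) = 0 := by rw [← hx]; ring
    rw [Int.cast_eq_zero] at this
    omega
  have hσ' : ∀ w : 𝓞 L, σ (w : L) = -(w : L) → (2 : 𝓞 L) * w ∈ P := by
    intro w hw
    have h1 : (σ • w - w : 𝓞 L) ∈ P := hσ w
    have h2 : (σ • w - w : 𝓞 L) = -(2 * w) := by
      refine RingOfIntegers.ext ?_
      have h3 : algebraMap (𝓞 L) L (σ • w) = σ (w : L) := rfl
      change algebraMap (𝓞 L) L _ = algebraMap (𝓞 L) L _
      rw [map_sub, h3, hw, map_neg, map_mul, map_ofNat]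
      ring
    rw [h2] at h1
    exact neg_mem_iff.1 h1
  obtain ⟨u, hu, hu2⟩ := exists_int_of_sq hx
  by_cases h2 : (2 : 𝓞 L) ∈ P
  · have hi := isIntegral_one_add_div_two hx ha
    obtain ⟨b, rfl⟩ : ∃ b, a = 4 * b + 1 := ⟨a / 4, by omega⟩
    obtain ⟨w, hw⟩ : ∃ w : 𝓞 L, (w : L) = (1 + x) / 2 := ⟨⟨_, hi⟩, rfl⟩
    have h1 : (σ • w - w : 𝓞 L) ∈ P := hσ w
    have h4 : (σ • w - w : 𝓞 L) = -u := by
      refine RingOfIntegers.ext ?_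
      have h3 : algebraMap (𝓞 L) L (σ • w) = σ (w : L) := rfl
      change algebraMap (𝓞 L) L _ = algebraMap (𝓞 L) L _
      have hw' : algebraMap (𝓞 L) L w = (1 + x) / 2 := hw
      have hu' : algebraMap (𝓞 L) L u = x := hu
      rw [map_sub, h3, hw, map_div₀, map_add, map_one, hneg, map_ofNat, map_neg, hu', hw']
      ring
    rw [h4, neg_mem_iff] at h1
    refine Ideal.IsPrime.one_notMem ‹_› (one_mem_of_isCoprime (a := 4 * b + 1) (b := 2)
      ⟨1, -(2 * b), by ring⟩ ?_ (by exact_mod_cast h2))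
    rw [← hu2]; exact Ideal.pow_mem_of_mem _ h1 2 two_pos
  · obtain ⟨c, hc⟩ := had
    have hy : (algebraMap K L δ / x) ^ 2 = (c : L) := by
      have : (a : L) ≠ 0 := by rw [← hx]; exact pow_ne_zero 2 hx0
      rw [div_pow, ← map_pow, hd, hx, map_intCast, hc]
      push_cast
      field_simp
    obtain ⟨w, hw, hw2⟩ := exists_int_of_sq hy
    have h3 := (Ideal.IsPrime.mem_or_mem ‹_› (hσ' u (by rw [hu, hneg]))).resolve_left h2
    have h4 := (Ideal.IsPrime.mem_or_mem ‹_› (hσ' w (by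
      rw [hw, map_div₀, hneg, AlgEquiv.commutes, div_neg]))).resolve_left h2
    refine Ideal.IsPrime.one_notMem ‹_› (one_mem_of_isCoprime (a := a) (b := c) ?_ ?_ ?_)
    · exact (squarefree_mul_iff.1 (hc ▸ hds)).1.isCoprime
    · rw [← hu2]; exact Ideal.pow_mem_of_mem _ h3 2 two_pos
    · rw [← hw2]; exact Ideal.pow_mem_of_mem _ h4 2 two_pos

end inertia

/-! ### Multiquadratic fields -/

section kummer

open IntermediateField

instance : Algebra.IsAlgebraic ℚ QBar := AlgebraicClosure.isAlgebraic ℚ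

instance : IsAlgClosure ℚ QBar := ⟨inferInstance, inferInstance⟩

theorem exists_sq_mul_sqfreeMul {m : ℤ} (n : ℤ) (hm : Squarefree m) :
    ∃ g : ℤ, g ≠ 0 ∧ m * n = g ^ 2 * sqfreeMul m n := by
  obtain ⟨g, m', n', hg, rfl, rfl, -, h⟩ := exists_eq_mul_gcd (n := n) hm
  exact ⟨g, hg, by rw [h]; ring⟩

/-- After division by the gcd, m'n' is both squarefree and a square, hence equal to 1. Distinct
squarefree integers thus have distinct classes modulo squares. -/
theorem eq_of_isSquare_mul {m n : ℤ} (hm : Squarefree m) (hn : Squarefree n)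
    (h : IsSquare (m * n)) : m = n := by
  obtain ⟨g, m', n', hg, rfl, rfl, hc, -⟩ := exists_eq_mul_gcd (n := n) hm
  have h1 : IsSquare (m' * n') := by
    rw [← Rat.isSquare_intCast_iff] at h ⊢
    have hg' : (g : ℚ) ≠ 0 := Int.cast_ne_zero.2 hg
    have h2 : ((m' * n' : ℤ) : ℚ) = ((g * m' * (g * n') : ℤ) : ℚ) / (g * g) := by
      push_cast; field_simp
    rw [h2]
    exact h.div (IsSquare.mul_self _)
  have h2 : Squarefree (m' * n') := squarefree_mul_iff.2 ⟨hc.isRelPrime,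
    hm.squarefree_of_dvd (Dvd.intro_left _ rfl), hn.squarefree_of_dvd (Dvd.intro_left _ rfl)⟩
  obtain ⟨t, ht⟩ := h1
  have h3 : IsUnit t := h2 t (ht ▸ dvd_rfl)
  have h4 : m' * n' = 1 := by
    rw [ht]
    rcases Int.isUnit_iff.1 h3 with rfl | rfl <;> norm_num
  rw [Int.eq_of_mul_eq_one h4]

theorem sq_eq_intCast_apply {F : Type*} [Field F] [Algebra ℚ F] {x : F} {n : ℤ}
    (hx : x ^ 2 = (n : F)) (σ : Gal(F/ℚ)) : σ x = x ∨ σ x = -x := by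
  refine sq_eq_sq_iff_eq_or_eq_neg.1 ?_
  rw [← map_pow, hx, map_intCast]

theorem ne_zero_of_sq_eq_intCast {F : Type*} [Field F] [CharZero F] {x : F} {n : ℤ} (hn : n ≠ 0)
    (hx : x ^ 2 = (n : F)) : x ≠ 0 := by
  rintro rfl
  exact hn (by exact_mod_cast (by simpa using hx.symm : (n : F) = 0))

theorem exists_apply_ne_of_sq_eq {m n : ℤ} (hm : Squarefree m) (hn : Squarefree n) (hmn : m ≠ n)
    {x y : QBar} (hx : x ^ 2 = (m : QBar)) (hy : y ^ 2 = (n : QBar)) :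
    ∃ σ : Gal(QBar/ℚ), σ (x * y) ≠ x * y := by
  by_contra! h
  obtain ⟨q, hq⟩ := (InfiniteGalois.mem_range_algebraMap_iff_fixed (k := ℚ) (x * y)).2 h
  refine hmn (eq_of_isSquare_mul hm hn ?_)
  rw [← Rat.isSquare_intCast_iff]
  refine ⟨q, (algebraMap ℚ QBar).injective ?_⟩
  rw [map_mul, hq, map_intCast]
  push_cast
  rw [← hx, ← hy]
  ring

/-- The sign character of the absolute Galois group of `ℚ` on a square root of an integer. -/
noncomputable def signChar {x : QBar} {n : ℤ} (hn : n ≠ 0) (hx : x ^ 2 = (n : QBar)) :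
    Gal(QBar/ℚ) →* QBar where
  toFun σ := σ x / x
  map_one' := div_self (ne_zero_of_sq_eq_intCast hn hx)
  map_mul' σ τ := by
    have h0 := ne_zero_of_sq_eq_intCast hn hx
    rw [AlgEquiv.mul_apply]
    rcases sq_eq_intCast_apply hx σ with h | h <;> rcases sq_eq_intCast_apply hx τ with h' | h' <;>
      rw [h', h] <;> simp [h, h0]

/-- The characters σ ↦ σ(x_i)/x_i are distinct, because x_i x_j is irrational for i ≠ j. Dedekind's
independence of characters then applies. -/
theorem linearIndependent_of_sq_eq {ι : Type*} {b : ι → ℤ} (hb : ∀ i, Squarefree (b i))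
    (hinj : Function.Injective b) {x : ι → QBar} (hx : ∀ i, x i ^ 2 = (b i : QBar)) :
    LinearIndependent ℚ x := by
  have hchar : LinearIndependent QBar
      (fun i => (signChar (hb i).ne_zero (hx i) : Gal(QBar/ℚ) → QBar)) := by
    refine (linearIndependent_monoidHom Gal(QBar/ℚ) QBar).comp
      (fun i => signChar (hb i).ne_zero (hx i)) fun i j hij => ?_
    by_contra hne
    obtain ⟨σ, hσ⟩ := exists_apply_ne_of_sq_eq (hb i) (hb j) (fun h => hne (hinj h)) (hx i) (hx j)
    have h1 : σ (x i) / x i = σ (x j) / x j := DFunLike.congr_fun hij σ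
    have hi := ne_zero_of_sq_eq_intCast (hb i).ne_zero (hx i)
    have hj := ne_zero_of_sq_eq_intCast (hb j).ne_zero (hx j)
    refine hσ ?_
    rw [map_mul]
    rcases sq_eq_intCast_apply (hx i) σ with h | h <;>
      rcases sq_eq_intCast_apply (hx j) σ with h' | h' <;> rw [h, h'] at h1 ⊢
    · rw [div_self hi, neg_div, div_self hj] at h1
      norm_num at h1
    · rw [div_self hj, neg_div, div_self hi] at h1
      norm_num at h1
    · rw [neg_mul_neg]
  rw [linearIndependent_iff'] at hchar ⊢
  intro s g hg i hi
  -- Applying σ to Σ g_j x_j = 0 gives a relation between the characters with coefficients g_j x_j.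
  have h1 := hchar s (fun i => algebraMap ℚ QBar (g i) * x i) (by
    ext σ
    rw [Finset.sum_apply, Pi.zero_apply, ← map_zero σ, ← hg, map_sum]
    refine Finset.sum_congr rfl fun j _ => ?_
    have hj := ne_zero_of_sq_eq_intCast (hb j).ne_zero (hx j)
    have h2 : g j • x j = algebraMap ℚ QBar (g j) * x j := Algebra.smul_def _ _
    rw [h2, map_mul, AlgEquiv.commutes]
    change algebraMap ℚ QBar (g j) * x j * (σ (x j) / x j) = _
    field_simp) i hi
  exact (map_eq_zero _).1 ((mul_eq_zero.1 h1).resolve_right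
    (ne_zero_of_sq_eq_intCast (hb i).ne_zero (hx i)))

/-- The field generated by the square roots of the elements of a set of integers. -/
noncomputable def sqrtField (B : Set ℤ) : IntermediateField ℚ QBar :=
  adjoin ℚ {x | ∃ b ∈ B, x ^ 2 = (b : QBar)}

theorem mem_sqrtField {B : Set ℤ} {b : ℤ} (hb : b ∈ B) {x : QBar} (hx : x ^ 2 = (b : QBar)) :
    x ∈ sqrtField B :=
  subset_adjoin _ _ ⟨b, hb, hx⟩

theorem exists_sq_eq_intCast (n : ℤ) : ∃ x : QBar, x ^ 2 = (n : QBar) :=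
  IsAlgClosed.exists_pow_nat_eq _ two_pos

/-- Closure of B under products modulo squares makes the span of one square root for each b ∈ B a
ring, so this span is the whole field and the square roots form a basis. -/
theorem finrank_sqrtField {B : Finset ℤ} (hs : ∀ b ∈ B, Squarefree b) (h1 : 1 ∈ B)
    (hmul : ∀ a ∈ B, ∀ b ∈ B, sqfreeMul a b ∈ B) :
    Module.finrank ℚ (sqrtField B) = B.card := by
  choose r hr using exists_sq_eq_intCast
  have hli : LinearIndependent ℚ (fun b : B => r b) :=
    linearIndependent_of_sq_eq (ι := B) (b := fun b => b) (fun b => hs b.1 b.2) Subtype.val_injective (fun b => hr b)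
  set S := Submodule.span ℚ (Set.range fun b : B => r b) with hS
  have hmem : ∀ b ∈ B, ∀ x : QBar, x ^ 2 = (b : QBar) → x ∈ S := by
    intro b hb x hx
    have h2 : r b ∈ S := Submodule.subset_span ⟨⟨b, hb⟩, rfl⟩
    rcases sq_eq_sq_iff_eq_or_eq_neg.1 (hx.trans (hr b).symm) with rfl | rfl
    · exact h2
    · exact S.neg_mem h2
  have hprod : ∀ x y, x ∈ S → y ∈ S → x * y ∈ S := by
    intro x y hx hy
    induction hx, hy using Submodule.span_induction₂ with
    | mem_mem x y hx hy =>
      obtain ⟨a, rfl⟩ := hx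
      obtain ⟨b, rfl⟩ := hy
      obtain ⟨g, hg, h⟩ := exists_sq_mul_sqfreeMul (b : ℤ) (hs a.1 a.2)
      have hg' : (g : QBar) ≠ 0 := Int.cast_ne_zero.2 hg
      have h2 : r a * r b / g ∈ S := by
        refine hmem _ (hmul a.1 a.2 b.1 b.2) _ ?_
        rw [div_pow, mul_pow, hr, hr, div_eq_iff (pow_ne_zero 2 hg')]
        exact_mod_cast h.trans (mul_comm _ _)
      have h3 : r a * r b = (g : ℚ) • (r a * r b / g) := by
        rw [Algebra.smul_def, map_intCast]
        field_simp
      change r a * r b ∈ S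
      rw [h3]
      exact S.smul_mem _ h2
    | zero_left y hy => simp
    | zero_right x hx => simp
    | add_left x y z _ _ _ h h' => rw [add_mul]; exact S.add_mem h h'
    | add_right x y z _ _ _ h h' => rw [mul_add]; exact S.add_mem h h'
    | smul_left c x y _ _ h => rw [smul_mul_assoc]; exact S.smul_mem _ h
    | smul_right c x y _ _ h => rw [mul_smul_comm]; exact S.smul_mem _ h
  have hone : (1 : QBar) ∈ S := hmem 1 h1 1 (by simp)
  have heq : Subalgebra.toSubmodule (sqrtField B).toSubalgebra = S := by
    refine le_antisymm ?_ (Submodule.span_le.2 ?_)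
    · have : (sqrtField B).toSubalgebra ≤ S.toSubalgebra hone hprod := by
        rw [sqrtField, adjoin_toSubalgebra, Algebra.adjoin_le_iff]
        rintro x ⟨b, hb, hx⟩
        exact hmem b hb x hx
      exact this
    · rintro _ ⟨b, rfl⟩
      exact mem_sqrtField (Finset.mem_coe.2 b.property) (hr b)
  refine (finrank_eq_finrank_subalgebra (sqrtField (B : Set ℤ))).symm.trans ?_
  rw [← Subalgebra.finrank_toSubmodule, heq, hS, finrank_span_eq_card hli, Fintype.card_coe]

theorem normal_sqrtField (B : Set ℤ) : Normal ℚ (sqrtField B) := by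
  refine normal_iff_forall_map_le'.2 fun σ => ?_
  rw [sqrtField, adjoin_map]
  refine adjoin.mono _ _ _ ?_
  rintro _ ⟨x, ⟨b, hb, hx⟩, rfl⟩
  refine ⟨b, hb, ?_⟩
  change (σ x) ^ 2 = _
  rw [← map_pow, hx, map_intCast]

theorem isGalois_sqrtField (B : Set ℤ) : IsGalois ℚ (sqrtField B) :=
  have := normal_sqrtField B
  ⟨⟩

theorem mul_self_apply_of_mem_sqrtField {B : Set ℤ} (σ : Gal(QBar/ℚ)) {x : QBar}
    (hx : x ∈ sqrtField B) : σ (σ x) = x := by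
  have h : sqrtField B ≤ fixedField (Subgroup.zpowers (σ * σ)) := by
    refine adjoin_le_iff.2 ?_
    rintro x ⟨b, -, hx⟩
    rw [SetLike.mem_coe, mem_fixedField_iff]
    intro f hf
    have h2 : (σ * σ) x = x := by
      rw [AlgEquiv.mul_apply]
      rcases sq_eq_intCast_apply hx σ with h | h
      · rw [h, h]
      · rw [h, map_neg, h, neg_neg]
    have h3 : Subgroup.zpowers (σ * σ) ≤ MulAction.stabilizer Gal(QBar/ℚ) x := by
      rw [Subgroup.zpowers_le]; exact h2
    exact h3 hf
  exact mem_fixedField_iff _ _ |>.1 (h hx) (σ * σ) (Subgroup.mem_zpowers _)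

end kummer

/-! ### The radicands of the genus field and their number -/

section genus

/-- The radicands `a ≡ 1 mod 4` dividing `d`, positive if `d` is positive. -/
def genusSet (d : ℤ) : Set ℤ := {a | a % 4 = 1 ∧ a ∣ d ∧ (0 < d → 0 < a)}

/-- The squarefree radicands of the genus field of the quadratic field of radicand `d`. -/
def kummerSet (d : ℤ) : Set ℤ :=
  {b | Squarefree b ∧ (b ∈ genusSet d ∨ sqfreeMul b d ∈ genusSet d)}

theorem squarefree_of_mem_genusSet {d a : ℤ} (hd : Squarefree d) (ha : a ∈ genusSet d) :
    Squarefree a := hd.squarefree_of_dvd ha.2.1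

theorem one_mem_genusSet (d : ℤ) : 1 ∈ genusSet d := ⟨rfl, one_dvd d, fun _ => one_pos⟩

theorem sqfreeMul_mem_genusSet {d a b : ℤ} (hd : Squarefree d) (ha : a ∈ genusSet d)
    (hb : b ∈ genusSet d) : sqfreeMul a b ∈ genusSet d := by
  obtain ⟨ha4, had, ha0⟩ := ha
  obtain ⟨hb4, hbd, hb0⟩ := hb
  obtain ⟨g, a', b', hg, rfl, rfl, hc, h⟩ := exists_eq_mul_gcd (n := b) (hd.squarefree_of_dvd had)
  rw [h]
  refine ⟨?_, hc.mul_dvd ((Dvd.intro_left _ rfl).trans had) ((Dvd.intro_left _ rfl).trans hbd), ?_⟩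
  · have h1 : (g * a') * (g * b') % 4 = 1 := by rw [Int.mul_emod, ha4, hb4]; rfl
    have h2 : g ^ 2 * (a' * b') % 4 = 1 := by rw [← h1]; ring_nf
    have h3 : Odd g := by
      rcases Int.even_or_odd g with ⟨t, rfl⟩ | h
      · rw [show (t + t) * a' = 2 * (t * a') by ring] at ha4
        omega
      · exact h
    have h4 : g ^ 2 % 4 = 1 := by
      obtain ⟨t, rfl⟩ := h3
      rw [show (2 * t + 1) ^ 2 = 1 + 4 * (t ^ 2 + t) by ring, Int.add_mul_emod_self_left]
      rfl
    rw [Int.mul_emod, h4, one_mul, Int.emod_emod] at h2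
    exact h2
  · intro h0
    have h1 := mul_pos (ha0 h0) (hb0 h0)
    rw [show g * a' * (g * b') = g ^ 2 * (a' * b') by ring] at h1
    exact (pos_iff_pos_of_mul_pos h1).1 (by positivity)

theorem isSquare_mul_sq_iff {x g : ℤ} (hg : g ≠ 0) : IsSquare (g ^ 2 * x) ↔ IsSquare x := by
  refine ⟨fun h => ?_, fun h => (IsSquare.sq g).mul h⟩
  rw [← Rat.isSquare_intCast_iff] at h ⊢
  have hg' : (g : ℚ) ≠ 0 := Int.cast_ne_zero.2 hg
  have h2 : (x : ℚ) = ((g ^ 2 * x : ℤ) : ℚ) / (g * g) := by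
    push_cast; field_simp
  rw [h2]
  exact h.div (IsSquare.mul_self _)

/-- In terms of ℚˣ/ℚˣ², the set is the subgroup generated by `genusSet d` and d. In this form
closure under products amounts to multiplying squares. -/
theorem mem_kummerSet_iff {d b : ℤ} (hd : Squarefree d) (hb : Squarefree b) :
    b ∈ kummerSet d ↔ ∃ a ∈ genusSet d, IsSquare (a * b) ∨ IsSquare (a * b * d) := by
  obtain ⟨g, hg, hgd⟩ := exists_sq_mul_sqfreeMul d hb
  constructor
  · rintro ⟨-, h | h⟩
    · exact ⟨b, h, Or.inl (IsSquare.mul_self b)⟩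
    · refine ⟨_, h, Or.inr ?_⟩
      rw [mul_assoc, hgd]
      exact ⟨g * sqfreeMul b d, by ring⟩
  · rintro ⟨a, ha, h | h⟩
    · rw [← eq_of_isSquare_mul (squarefree_of_mem_genusSet hd ha) hb h]
      exact ⟨squarefree_of_mem_genusSet hd ha, Or.inl ha⟩
    · refine ⟨hb, Or.inr ?_⟩
      rw [mul_assoc, hgd, mul_left_comm, isSquare_mul_sq_iff hg] at h
      rwa [← eq_of_isSquare_mul (squarefree_of_mem_genusSet hd ha) (squarefree_sqfreeMul hb hd) h]

theorem sqfreeMul_mem_kummerSet {d b c : ℤ} (hd : Squarefree d) (hb : b ∈ kummerSet d)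
    (hc : c ∈ kummerSet d) : sqfreeMul b c ∈ kummerSet d := by
  have hbs := hb.1
  have hcs := hc.1
  rw [mem_kummerSet_iff hd (squarefree_sqfreeMul hbs hcs)]
  rw [mem_kummerSet_iff hd hbs] at hb
  rw [mem_kummerSet_iff hd hcs] at hc
  obtain ⟨a, ha, h⟩ := hb
  obtain ⟨a', ha', h'⟩ := hc
  obtain ⟨g, hg, hgd⟩ := exists_sq_mul_sqfreeMul c hbs
  obtain ⟨g', hg', hgd'⟩ := exists_sq_mul_sqfreeMul a' (squarefree_of_mem_genusSet hd ha)
  refine ⟨_, sqfreeMul_mem_genusSet hd ha ha', ?_⟩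
  have h0 : g * g' ≠ 0 := mul_ne_zero hg hg'
  have key : ∀ e : ℤ, IsSquare (a * a' * (b * c) * e) →
      IsSquare (sqfreeMul a a' * sqfreeMul b c * e) := by
    intro e he
    rw [hgd, hgd', show g' ^ 2 * sqfreeMul a a' * (g ^ 2 * sqfreeMul b c) * e =
      (g * g') ^ 2 * (sqfreeMul a a' * sqfreeMul b c * e) by ring, isSquare_mul_sq_iff h0] at he
    exact he
  rcases h with h | h <;> rcases h' with h' | h'
  · exact Or.inl (by simpa using key 1 (by
      have h3 := h.mul h'; ring_nf at h3 ⊢; exact h3))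
  · exact Or.inr (key d (by
      have h3 := h.mul h'; ring_nf at h3 ⊢; exact h3))
  · exact Or.inr (key d (by
      have h3 := h.mul h'; ring_nf at h3 ⊢; exact h3))
  · refine Or.inl ?_
    have h2 := key (d ^ 2) (by
      have h3 := h.mul h'; ring_nf at h3 ⊢; exact h3)
    rwa [mul_comm, isSquare_mul_sq_iff hd.ne_zero] at h2

theorem one_mem_kummerSet (d : ℤ) : 1 ∈ kummerSet d := ⟨squarefree_one, Or.inl (one_mem_genusSet d)⟩

theorem self_mem_kummerSet {d : ℤ} (hd : Squarefree d) : d ∈ kummerSet d := by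
  rw [mem_kummerSet_iff hd hd]
  exact ⟨1, one_mem_genusSet d, Or.inr (by rw [one_mul]; exact IsSquare.mul_self d)⟩

theorem finite_genusSet {d : ℤ} (hd : d ≠ 0) : (genusSet d).Finite := by
  refine (Set.finite_Icc (-|d|) |d|).subset fun a ha => ?_
  have := Int.le_of_dvd (abs_pos.2 hd) ((abs_dvd_abs a d).2 ha.2.1)
  exact abs_le.1 this

theorem self_mem_genusSet {d : ℤ} (h4 : d % 4 = 1) : d ∈ genusSet d := ⟨h4, dvd_rfl, id⟩

theorem sqfreeMul_sqfreeMul {a d : ℤ} (ha : Squarefree a) (hd : Squarefree d) :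
    sqfreeMul (sqfreeMul a d) d = a := by
  have hs := squarefree_sqfreeMul ha hd
  obtain ⟨g, hg, h⟩ := exists_sq_mul_sqfreeMul d ha
  obtain ⟨g', hg', h'⟩ := exists_sq_mul_sqfreeMul d hs
  refine eq_of_isSquare_mul (squarefree_sqfreeMul hs hd) ha ?_
  rw [← isSquare_mul_sq_iff hg', ← isSquare_mul_sq_iff hg]
  refine ⟨g ^ 2 * sqfreeMul a d, ?_⟩
  linear_combination (-g ^ 2 * a) * h' + (g ^ 2 * sqfreeMul a d) * h

theorem kummerSet_eq_genusSet {d : ℤ} (hd : Squarefree d) (h4 : d % 4 = 1) :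
    kummerSet d = genusSet d := by
  refine Set.Subset.antisymm ?_ fun a ha => ⟨squarefree_of_mem_genusSet hd ha, Or.inl ha⟩
  rintro b ⟨hb, h | h⟩
  · exact h
  · rw [← sqfreeMul_sqfreeMul hb hd]
    exact sqfreeMul_mem_genusSet hd h (self_mem_genusSet h4)

theorem kummerSet_eq_union {d : ℤ} (hd : Squarefree d) :
    kummerSet d = genusSet d ∪ (fun a => sqfreeMul a d) '' genusSet d := by
  ext b
  constructor
  · rintro ⟨hb, h | h⟩
    · exact Or.inl h
    · exact Or.inr ⟨_, h, sqfreeMul_sqfreeMul hb hd⟩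
  · rintro (h | ⟨a, ha, rfl⟩)
    · exact ⟨squarefree_of_mem_genusSet hd h, Or.inl h⟩
    · have has := squarefree_of_mem_genusSet hd ha
      refine ⟨squarefree_sqfreeMul has hd, Or.inr ?_⟩
      rwa [sqfreeMul_sqfreeMul has hd]

theorem finite_kummerSet {d : ℤ} (hd : Squarefree d) : (kummerSet d).Finite := by
  rw [kummerSet_eq_union hd]
  exact (finite_genusSet hd.ne_zero).union ((finite_genusSet hd.ne_zero).image _)

/-- The set `genusSet d` and its translate by d are disjoint: otherwise d would be, modulo squares,
a product of two elements of `genusSet d`, which forces d ≡ 1 mod 4. -/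
theorem ncard_kummerSet {d : ℤ} (hd : Squarefree d) (h4 : d % 4 ≠ 1) :
    (kummerSet d).ncard = 2 * (genusSet d).ncard := by
  have hf := finite_genusSet hd.ne_zero
  rw [kummerSet_eq_union hd, Set.ncard_union_eq ?_ hf (hf.image _), Set.InjOn.ncard_image,
    two_mul]
  · intro a ha b hb hab
    have := congrArg (fun x => sqfreeMul x d) hab
    simpa only [sqfreeMul_sqfreeMul (squarefree_of_mem_genusSet hd ha) hd,
      sqfreeMul_sqfreeMul (squarefree_of_mem_genusSet hd hb) hd] using this
  · rw [Set.disjoint_left]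
    rintro _ hb ⟨a, ha, rfl⟩
    have has := squarefree_of_mem_genusSet hd ha
    have h1 := sqfreeMul_mem_genusSet hd ha hb
    have h2 : sqfreeMul a (sqfreeMul a d) = d := by
      have hs := squarefree_sqfreeMul has hd
      obtain ⟨g, hg, h⟩ := exists_sq_mul_sqfreeMul d has
      obtain ⟨g', hg', h'⟩ := exists_sq_mul_sqfreeMul (sqfreeMul a d) has
      refine eq_of_isSquare_mul (squarefree_sqfreeMul has hs) hd ?_
      rw [← isSquare_mul_sq_iff hg', ← isSquare_mul_sq_iff hg]
      refine ⟨g ^ 2 * sqfreeMul a d, ?_⟩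
      linear_combination (-g ^ 2 * d) * h' + (g ^ 2 * sqfreeMul a d) * h
    rw [h2] at h1
    exact h4 h1.1

theorem dvd_iff_natAbs_dvd_of_odd {a d : ℤ} {m : ℕ} (h : d.natAbs = m ∨ d.natAbs = 2 * m)
    (ha : Odd a.natAbs) : a ∣ d ↔ a.natAbs ∣ m := by
  rw [← Int.natAbs_dvd_natAbs]
  rcases h with h | h
  · rw [h]
  · rw [h]
    exact ⟨fun h' => (Nat.Coprime.dvd_mul_left (Nat.coprime_two_right.2 ha)).1 h',
      fun h' => h'.mul_left 2⟩

theorem two_pow_card_primeFactors {m : ℕ} (hm : Squarefree m) :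
    m.divisors.card = 2 ^ m.primeFactors.card := by
  have h := ArithmeticFunction.isMultiplicative_zeta.prodPrimeFactors_one_add_of_squarefree hm
  rw [Finset.sum_congr rfl fun d hd => ArithmeticFunction.zeta_apply_ne
      (Nat.pos_of_mem_divisors hd).ne', Finset.prod_congr rfl fun p hp => by
      rw [ArithmeticFunction.zeta_apply_ne (Nat.prime_of_mem_primeFactors hp).ne_zero],
    Finset.prod_const, Finset.sum_const, smul_eq_mul, mul_one] at h
  exact h.symm

/-- For odd e exactly one of e and -e is 1 mod 4. With no condition on the sign, a ↦ |a| is a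
bijection onto the divisors of m. -/
theorem ncard_genusSet_of_neg {d : ℤ} {m : ℕ} (hm : Odd m) (hms : Squarefree m)
    (h : d.natAbs = m ∨ d.natAbs = 2 * m) (hd : d < 0) :
    (genusSet d).ncard = 2 ^ m.primeFactors.card := by
  rw [← two_pow_card_primeFactors hms, ← Set.ncard_coe_finset]
  refine Set.ncard_congr (fun a _ => a.natAbs) ?_ ?_ ?_
  · rintro a ⟨h4, had, -⟩
    rw [Finset.mem_coe, Nat.mem_divisors]
    exact ⟨(dvd_iff_natAbs_dvd_of_odd h (Nat.odd_iff.2 (by omega))).1 had, hms.ne_zero⟩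
  · rintro a b ⟨ha, -⟩ ⟨hb, -⟩ hab
    omega
  · intro e he
    rw [Finset.mem_coe, Nat.mem_divisors] at he
    have ho := Nat.odd_iff.1 (hm.of_dvd_nat he.1)
    rcases (by omega : e % 4 = 1 ∨ e % 4 = 3) with h4 | h4
    · refine ⟨e, ⟨by omega, ?_, fun h => by omega⟩, by simp⟩
      exact (dvd_iff_natAbs_dvd_of_odd h (Nat.odd_iff.2 (by omega))).2 (by simpa using he.1)
    · refine ⟨-e, ⟨by omega, ?_, fun h => by omega⟩, by simp⟩
      exact (dvd_iff_natAbs_dvd_of_odd h (Nat.odd_iff.2 (by omega))).2 (by simpa using he.1)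

/-- Only the divisors of m that are 1 mod 4 remain. Twice their number is Σ (1 + χ₄(e)) over the
divisors e of m, and Σ χ₄(e) = Π (1 + χ₄(p)) vanishes unless every p ∣ m is 1 mod 4. -/
theorem ncard_genusSet_of_pos {d : ℤ} {m : ℕ} (hm : Odd m) (hms : Squarefree m)
    (h : d.natAbs = m ∨ d.natAbs = 2 * m) (hd : 0 < d) :
    2 * (genusSet d).ncard = 2 ^ m.primeFactors.card +
      if ∀ p ∈ m.primeFactors, p % 4 = 1 then 2 ^ m.primeFactors.card else 0 := by
  have h1 : (genusSet d).ncard = (m.divisors.filter (fun e => e % 4 = 1)).card := by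
    rw [← Set.ncard_coe_finset]
    refine Set.ncard_congr (fun a _ => a.natAbs) ?_ ?_ ?_
    · rintro a ⟨h4, had, h0⟩
      have := h0 hd
      rw [Finset.mem_coe, Finset.mem_filter, Nat.mem_divisors]
      exact ⟨⟨(dvd_iff_natAbs_dvd_of_odd h (Nat.odd_iff.2 (by omega))).1 had, hms.ne_zero⟩,
        by omega⟩
    · rintro a b ⟨ha, -⟩ ⟨hb, -⟩ hab
      omega
    · intro e he
      rw [Finset.mem_coe, Finset.mem_filter, Nat.mem_divisors] at he
      refine ⟨e, ⟨by omega, ?_, fun h => by omega⟩, by simp⟩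
      exact (dvd_iff_natAbs_dvd_of_odd h (Nat.odd_iff.2 (by omega))).2 (by simpa using he.1.1)
  have hprod : ∏ p ∈ m.primeFactors, (1 + chiFour p) =
      if ∀ p ∈ m.primeFactors, p % 4 = 1 then (2 : ℝ) ^ m.primeFactors.card else 0 := by
    split_ifs with hall
    · rw [Finset.prod_congr rfl fun p hp => by
        rw [chiFour_eq, if_neg (by have := hall p hp; omega), if_pos (hall p hp)],
        Finset.prod_const]
      norm_num
    · push Not at hall
      obtain ⟨p, hp, hp4⟩ := hall
      refine Finset.prod_eq_zero hp ?_
      have := Nat.odd_iff.1 (hm.of_dvd_nat (Nat.dvd_of_mem_primeFactors hp))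
      rw [chiFour_eq, if_neg (by omega), if_neg hp4]
      norm_num
  rw [chiFour_isMultiplicative.prodPrimeFactors_one_add_of_squarefree hms] at hprod
  have h2 : (2 * (m.divisors.filter (fun e => e % 4 = 1)).card : ℝ) =
      m.divisors.card + ∑ e ∈ m.divisors, chiFour e := by
    rw [Finset.card_eq_sum_ones, Finset.card_eq_sum_ones, Finset.sum_filter]
    push_cast
    rw [Finset.mul_sum, ← Finset.sum_add_distrib]
    refine Finset.sum_congr rfl fun e he => ?_
    have := Nat.odd_iff.1 (hm.of_dvd_nat (Nat.dvd_of_mem_divisors he))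
    rw [chiFour_eq, if_neg (show ¬ e % 2 = 0 by omega)]
    split_ifs <;> norm_num
  rw [hprod, two_pow_card_primeFactors hms] at h2
  rw [h1]
  have h3 : ((2 * (m.divisors.filter (fun e => e % 4 = 1)).card : ℕ) : ℝ) =
    ((2 ^ m.primeFactors.card +
      if ∀ p ∈ m.primeFactors, p % 4 = 1 then 2 ^ m.primeFactors.card else 0 : ℕ) : ℝ) := by
    rw [Nat.cast_mul, Nat.cast_ofNat, h2]
    push_cast
    rfl
  exact_mod_cast h3

end genus

/-! ### Quadratic fields and squarefree radicands -/

section quadratic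

open IntermediateField

theorem exists_squarefree_of_rat {q : ℚ} (hq : q ≠ 0) :
    ∃ (c : ℚ) (m : ℤ), c ≠ 0 ∧ Squarefree m ∧ c ^ 2 * q = m := by
  have hn : q.num * q.den ≠ 0 :=
    mul_ne_zero (Rat.num_ne_zero.2 hq) (by exact_mod_cast q.den_nz)
  obtain ⟨a, b, hab, ha⟩ := Nat.sq_mul_squarefree (q.num * q.den).natAbs
  have hb : b ≠ 0 := by
    rintro rfl
    exact hn (Int.natAbs_eq_zero.1 (by rw [← hab]; simp))
  have hb' : (b : ℚ) ≠ 0 := by exact_mod_cast hb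
  have hd' : (q.den : ℚ) ≠ 0 := by exact_mod_cast q.den_nz
  have key : ∀ m : ℤ, q.num * q.den = (b : ℤ) ^ 2 * m → ((q.den : ℚ) / b) ^ 2 * q = m := by
    intro m hm
    have hm' : (q.num : ℚ) * q.den = b ^ 2 * m := by exact_mod_cast hm
    have h2 : q * q.den = q.num := Rat.mul_den_eq_num q
    rw [div_pow, div_mul_eq_mul_div, div_eq_iff (pow_ne_zero 2 hb')]
    linear_combination q.den * h2 + hm'
  rcases Int.natAbs_eq (q.num * q.den) with h | h
  · refine ⟨q.den / b, a, div_ne_zero hd' hb', Int.squarefree_natCast.2 ha, key _ ?_⟩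
    rw [h, ← hab]; push_cast; ring
  · refine ⟨q.den / b, -a, div_ne_zero hd' hb', Int.squarefree_natAbs.1 (by simpa using ha), key _ ?_⟩
    rw [h, ← hab]; push_cast; ring

theorem exists_smul_sq_eq_intCast {F : Type*} [Field F] [CharZero F] {x : F} (hx : x ≠ 0) {q : ℚ}
    (hq : x ^ 2 = algebraMap ℚ F q) :
    ∃ (c : ℚ) (m : ℤ), c ≠ 0 ∧ Squarefree m ∧ (algebraMap ℚ F c * x) ^ 2 = (m : F) := by
  have hq0 : q ≠ 0 := by
    rintro rfl
    rw [map_zero] at hq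
    exact hx (pow_eq_zero_iff two_ne_zero |>.1 hq)
  obtain ⟨c, m, hc, hm, h⟩ := exists_squarefree_of_rat hq0
  refine ⟨c, m, hc, hm, ?_⟩
  rw [mul_pow, hq, ← map_pow, ← map_mul, h, map_intCast]

theorem not_mem_range_of_sq_eq {d : ℤ} (hd : Squarefree d) (hd1 : d ≠ 1) {x : QBar}
    (hx : x ^ 2 = (d : QBar)) : ∃ σ : Gal(QBar/ℚ), σ x ≠ x := by
  obtain ⟨σ, hσ⟩ := exists_apply_ne_of_sq_eq hd squarefree_one hd1 hx (y := 1) (by simp)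
  exact ⟨σ, by simpa using hσ⟩

theorem fixes_of_mem_adjoin_simple {σ : Gal(QBar/ℚ)} {δ x : QBar} (h : σ δ = δ)
    (hx : x ∈ ℚ⟮δ⟯) : σ x = x := by
  have h1 : ℚ⟮δ⟯ ≤ fixedField (Subgroup.zpowers σ) := by
    rw [adjoin_simple_le_iff, mem_fixedField_iff]
    intro f hf
    have h3 : Subgroup.zpowers σ ≤ MulAction.stabilizer Gal(QBar/ℚ) δ := by
      rw [Subgroup.zpowers_le]; exact h
    exact h3 hf
  exact (mem_fixedField_iff _ _).1 (h1 hx) σ (Subgroup.mem_zpowers _)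

theorem QuadField.eq_adjoin (K : QuadField) {d : ℤ} (hd : Squarefree d) (hd1 : d ≠ 1) {δ : QBar}
    (hδ : δ ∈ K.1) (hδd : δ ^ 2 = (d : QBar)) : K.1 = ℚ⟮δ⟯ := by
  have hle : ℚ⟮δ⟯ ≤ K.1 := adjoin_simple_le_iff.2 hδ
  have : FiniteDimensional ℚ K.1 := inferInstance
  refine (eq_of_le_of_finrank_le hle ?_).symm
  rw [K.2]
  have h1 : 0 < Module.finrank ℚ ℚ⟮δ⟯ := by
    have : FiniteDimensional ℚ ℚ⟮δ⟯ := adjoin.finiteDimensional (Algebra.IsIntegral.isIntegral δ)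
    exact Module.finrank_pos
  have h2 : Module.finrank ℚ ℚ⟮δ⟯ ≠ 1 := by
    intro h
    rw [finrank_adjoin_simple_eq_one_iff, IntermediateField.mem_bot] at h
    obtain ⟨q, hq⟩ := h
    obtain ⟨σ, hσ⟩ := not_mem_range_of_sq_eq hd hd1 hδd
    rw [← hq] at hσ
    exact hσ (AlgEquiv.commutes σ q)
  omega

/-- If the non-trivial automorphism σ moves a, it negates a - σa, so the square of a - σa is
rational. A rational multiple of this element squares to a squarefree integer. -/
theorem QuadField.exists_radicand (K : QuadField) : ∃ (d : ℤ) (δ : QBar), Squarefree d ∧ d ≠ 1 ∧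
    δ ∈ K.1 ∧ δ ^ 2 = (d : QBar) := by
  have hquad : Algebra.IsQuadraticExtension ℚ K.1 := ⟨K.2⟩
  have hgal : IsGalois ℚ K.1 := ⟨⟩
  have hcard : Nat.card Gal(K.1/ℚ) = 2 := by rw [IsGalois.card_aut_eq_finrank]; exact K.2
  have hfin : Finite Gal(K.1/ℚ) := Nat.finite_of_card_ne_zero (by rw [hcard]; norm_num)
  have : Nontrivial Gal(K.1/ℚ) := Finite.one_lt_card_iff_nontrivial.1 (by rw [hcard]; norm_num)
  obtain ⟨σ, hσ⟩ := exists_ne (1 : Gal(K.1/ℚ))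
  obtain ⟨a, ha⟩ : ∃ a, σ a ≠ a := by
    by_contra! h
    exact hσ (AlgEquiv.ext h)
  have hσ2 : ∀ x, σ (σ x) = x := by
    intro x
    have h : σ ^ 2 = 1 := by
      have h2 : σ ^ Nat.card Gal(K.1/ℚ) = 1 := pow_card_eq_one'
      rwa [hcard] at h2
    rw [pow_two] at h
    exact AlgEquiv.congr_fun h x
  have hall : ∀ τ : Gal(K.1/ℚ), τ = 1 ∨ τ = σ := by
    intro τ
    by_contra! h
    have h3 : ({1, σ, τ} : Set Gal(K.1/ℚ)).ncard = 3 := by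
      rw [Set.ncard_eq_three]
      exact ⟨1, σ, τ, hσ.symm, h.1.symm, h.2.symm, rfl⟩
    have h4 := Set.ncard_le_card ({1, σ, τ} : Set Gal(K.1/ℚ))
    omega
  have hb : a - σ a ≠ 0 := sub_ne_zero.2 ha.symm
  obtain ⟨q, hq⟩ := (IsGalois.mem_range_algebraMap_iff_fixed (F := ℚ) ((a - σ a) ^ 2)).2 (by
    intro τ
    rcases hall τ with rfl | rfl
    · rfl
    · rw [map_pow, map_sub, hσ2]; ring)
  obtain ⟨c, m, hc, hm, h⟩ := exists_smul_sq_eq_intCast hb hq.symm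
  refine ⟨m, (algebraMap ℚ K.1 c * (a - σ a) : K.1), hm, ?_, SetLike.coe_mem _, ?_⟩
  -- If the integer were 1, the scaled element would be ±1 and fixed by σ, although σ negates it and
  -- it is non-zero.
  · rintro rfl
    rw [Int.cast_one, sq_eq_one_iff] at h
    have h5 : σ (algebraMap ℚ K.1 c * (a - σ a)) = algebraMap ℚ K.1 c * (a - σ a) := by
      rcases h with h | h <;> rw [h] <;> simp
    rw [map_mul, AlgEquiv.commutes, map_sub, hσ2] at h5
    have h6 := mul_left_cancel₀ ((map_ne_zero _).2 hc) h5
    exact hb (by linear_combination -h6 / 2)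
  · exact_mod_cast congrArg (Subtype.val : K.1 → QBar) h

/-- The squarefree integer `d` such that `K = ℚ(√d)`. -/
noncomputable def QuadField.radicand (K : QuadField) : ℤ := K.exists_radicand.choose

/-- A square root of the radicand of `K`. -/
noncomputable def QuadField.sqrt (K : QuadField) : QBar := K.exists_radicand.choose_spec.choose

namespace QuadField

variable (K : QuadField)

theorem squarefree_radicand : Squarefree K.radicand :=
  K.exists_radicand.choose_spec.choose_spec.1

theorem radicand_ne_one : K.radicand ≠ 1 := K.exists_radicand.choose_spec.choose_spec.2.1

theorem sqrt_mem : K.sqrt ∈ K.1 := K.exists_radicand.choose_spec.choose_spec.2.2.1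

theorem sqrt_sq : K.sqrt ^ 2 = (K.radicand : QBar) :=
  K.exists_radicand.choose_spec.choose_spec.2.2.2

theorem eq_adjoin_sqrt : K.1 = ℚ⟮K.sqrt⟯ :=
  K.eq_adjoin K.squarefree_radicand K.radicand_ne_one K.sqrt_mem K.sqrt_sq

theorem radicand_injective : Function.Injective radicand := by
  intro K K' h
  refine Subtype.ext ?_
  have h1 : K.sqrt ^ 2 = K'.sqrt ^ 2 := by rw [sqrt_sq, sqrt_sq, h]
  have h2 : K.sqrt ∈ K'.1 := by
    rcases sq_eq_sq_iff_eq_or_eq_neg.1 h1 with h | h <;> rw [h]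
    · exact K'.sqrt_mem
    · exact neg_mem K'.sqrt_mem
  rw [K.eq_adjoin_sqrt, K'.eq_adjoin K.squarefree_radicand K.radicand_ne_one h2 K.sqrt_sq]

/-- Both square roots generate K, so every automorphism fixes both or negates both and hence fixes
their product. For distinct squarefree radicands this is impossible. -/
theorem radicand_eq {d : ℤ} (hd : Squarefree d) (hd1 : d ≠ 1) {δ : QBar} (hδ : δ ∈ K.1)
    (hδd : δ ^ 2 = (d : QBar)) : K.radicand = d := by
  by_contra hne
  obtain ⟨σ, hσ⟩ := exists_apply_ne_of_sq_eq K.squarefree_radicand hd hne K.sqrt_sq hδd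
  have h1 : σ K.sqrt = K.sqrt → σ δ = δ := fun h =>
    fixes_of_mem_adjoin_simple h (K.eq_adjoin_sqrt ▸ hδ)
  have h2 : σ δ = δ → σ K.sqrt = K.sqrt := fun h =>
    fixes_of_mem_adjoin_simple h (K.eq_adjoin hd hd1 hδ hδd ▸ K.sqrt_mem)
  refine hσ ?_
  rw [map_mul]
  rcases sq_eq_intCast_apply K.sqrt_sq σ with h | h
  · rw [h, h1 h]
  · rcases sq_eq_intCast_apply hδd σ with h' | h'
    · rw [h', h2 h']
    · rw [h, h', neg_mul_neg]

theorem exists_radicand_eq {d : ℤ} (hd : Squarefree d) (hd1 : d ≠ 1) :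
    ∃ K : QuadField, K.radicand = d := by
  obtain ⟨δ, hδ⟩ := exists_sq_eq_intCast d
  have h1 : sqfreeMul 1 d = d := by simp [sqfreeMul]
  have h2 : sqfreeMul d d = 1 := by
    have := sqfreeMul_sqfreeMul squarefree_one hd
    rwa [h1] at this
  have h3 : sqfreeMul d 1 = d := by simp [sqfreeMul]
  have h4 : sqfreeMul 1 1 = 1 := by simp [sqfreeMul]
  have hfin : Module.finrank ℚ (sqrtField (({1, d} : Finset ℤ) : Set ℤ)) = 2 := by
    rw [finrank_sqrtField, Finset.card_pair hd1.symm]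
    · simp [hd]
    · simp
    · intro a ha b hb
      simp only [Finset.mem_insert, Finset.mem_singleton] at ha hb ⊢
      rcases ha with rfl | rfl <;> rcases hb with rfl | rfl <;> simp [h1, h2, h3, h4]
  exact ⟨⟨_, hfin⟩, radicand_eq _ hd hd1 (mem_sqrtField (by simp) hδ) hδ⟩

theorem fixes_of_fixes_sqrt {σ : Gal(QBar/ℚ)} (h : σ K.sqrt = K.sqrt) {x : QBar} (hx : x ∈ K.1) :
    σ x = x :=
  fixes_of_mem_adjoin_simple h (K.eq_adjoin_sqrt ▸ hx)

end QuadField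

end quadratic

/-! ### The discriminant of a quadratic field -/

section discriminant

open NumberField

variable {F : Type*} [Field F] [NumberField F]

theorem exists_int_of_isIntegral_algebraMap {q : ℚ} (h : IsIntegral ℤ (algebraMap ℚ F q)) :
    ∃ n : ℤ, q = n := by
  have h1 : IsIntegral ℤ q := (isIntegral_algebraMap_iff (algebraMap ℚ F).injective).1 h
  obtain ⟨n, hn⟩ := IsIntegrallyClosed.isIntegral_iff.1 h1
  exact ⟨n, by simpa using hn.symm⟩

theorem trace_of_basis {d : ℤ} {δ : F} (e : Module.Basis (Fin 2) ℚ F) (h0 : e 0 = 1) (h1 : e 1 = δ)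
    (hδ : δ ^ 2 = (d : F)) (u v : ℚ) :
    Algebra.trace ℚ F (algebraMap ℚ F u + algebraMap ℚ F v * δ) = 2 * u := by
  have hδtr : Algebra.trace ℚ F δ = 0 := by
    rw [Algebra.trace_eq_matrix_trace e, Matrix.trace_fin_two, Algebra.leftMulMatrix_eq_repr_mul,
      Algebra.leftMulMatrix_eq_repr_mul, h0, mul_one, ← h1, e.repr_self, h1, ← pow_two, hδ]
    have h2 : (d : F) = (d : ℚ) • e 0 := by rw [h0, Algebra.smul_def, mul_one, map_intCast]
    rw [h2, map_smul, e.repr_self]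
    simp
  rw [map_add, Algebra.trace_algebraMap, Module.finrank_eq_card_basis e, ← Algebra.smul_def,
    map_smul, hδtr]
  simp

/-- For x = u + vδ the trace 2u and the norm u² - dv² = 2u x - x² are integers. Then (2v)² d is an
integer, so the square of the denominator of 2v divides the squarefree d, and that denominator is 1.
-/
theorem exists_of_isIntegral {d : ℤ} (hd : Squarefree d) {δ : F}
    (e : Module.Basis (Fin 2) ℚ F) (h0 : e 0 = 1) (h1 : e 1 = δ) (hδ : δ ^ 2 = (d : F)) {u v : ℚ}
    (hx : IsIntegral ℤ (algebraMap ℚ F u + algebraMap ℚ F v * δ)) :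
    ∃ a b : ℤ, 2 * u = a ∧ 2 * v = b ∧ (4 : ℤ) ∣ a ^ 2 - d * b ^ 2 := by
  obtain ⟨a, ha⟩ : ∃ a : ℤ, 2 * u = a := by
    have h2 := Algebra.isIntegral_trace (L := ℚ) hx
    rw [trace_of_basis e h0 h1 hδ] at h2
    exact exists_int_of_isIntegral_algebraMap (F := ℚ) h2
  have hint : ∀ n : ℤ, IsIntegral ℤ (n : F) := fun n => isIntegral_algebraMap (x := n)
  have ha' : 2 * algebraMap ℚ F u = (a : F) := by
    rw [← map_intCast (algebraMap ℚ F) a, ← ha, map_mul, map_ofNat]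
  obtain ⟨n, hn⟩ : ∃ n : ℤ, u ^ 2 - d * v ^ 2 = n := by
    refine exists_int_of_isIntegral_algebraMap (F := F) ?_
    have h2 : algebraMap ℚ F (u ^ 2 - d * v ^ 2) = (a : F) * (algebraMap ℚ F u +
        algebraMap ℚ F v * δ) - (algebraMap ℚ F u + algebraMap ℚ F v * δ) ^ 2 := by
      simp only [map_sub, map_mul, map_pow, map_intCast]
      rw [← ha', ← hδ]
      ring
    rw [h2]
    exact ((hint a).mul hx).sub (hx.pow 2)
  have hs : (2 * v) ^ 2 * d = (a ^ 2 - 4 * n : ℤ) := by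
    push_cast
    rw [← ha, ← hn]
    ring
  obtain ⟨b, hb⟩ : ∃ b : ℤ, 2 * v = b := by
    set s := 2 * v
    have h2 : s * s.den = s.num := Rat.mul_den_eq_num s
    have h3 : s.num ^ 2 * d = (a ^ 2 - 4 * n) * (s.den : ℤ) ^ 2 := by
      have : ((s.num ^ 2 * d : ℤ) : ℚ) = (((a ^ 2 - 4 * n) * (s.den : ℤ) ^ 2 : ℤ) : ℚ) := by
        rw [Int.cast_mul, Int.cast_mul, ← hs]
        push_cast
        rw [← h2]
        ring
      exact_mod_cast this
    have h4 : (s.den : ℤ) * s.den ∣ d := by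
      rw [← pow_two]
      refine (IsCoprime.dvd_of_dvd_mul_left (y := s.num ^ 2) ?_
        ⟨a ^ 2 - 4 * n, by rw [h3, mul_comm]⟩)
      exact ((Rat.isCoprime_num_den s).symm).pow
    have h5 := Int.isUnit_iff.1 (hd _ h4)
    have h6 : s.den = 1 := by omega
    exact ⟨s.num, by rw [← h2, h6]; simp⟩
  refine ⟨a, b, ha, hb, n, ?_⟩
  rw [hb] at hs
  have hs' : b ^ 2 * d = a ^ 2 - 4 * n := by exact_mod_cast hs
  linarith

theorem even_of_four_dvd {d a b : ℤ} (hd : Squarefree d) (h4 : d % 4 ≠ 1)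
    (h : (4 : ℤ) ∣ a ^ 2 - d * b ^ 2) : a % 2 = 0 ∧ b % 2 = 0 := by
  have hd4 : ¬ (4 : ℤ) ∣ d := fun h => by
    have := Int.isUnit_iff.1 (hd 2 (by simpa using h))
    omega
  have h0 : d % 4 ≠ 0 := fun h => hd4 (Int.dvd_of_emod_eq_zero h)
  have h2 : (a ^ 2 - d * b ^ 2) % 4 = 0 := Int.emod_eq_zero_of_dvd h
  rw [Int.sub_emod, Int.mul_emod] at h2
  have hsq : ∀ x : ℤ, (x % 2 = 0 ∧ x ^ 2 % 4 = 0) ∨ (x % 2 = 1 ∧ x ^ 2 % 4 = 1) := by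
    intro x
    rcases Int.even_or_odd' x with ⟨t, rfl | rfl⟩
    · left; ring_nf; omega
    · right; ring_nf; omega
  have hd' : d % 4 = 2 ∨ d % 4 = 3 := by omega
  rcases hsq a with ⟨ha, ha'⟩ | ⟨ha, ha'⟩ <;> rcases hsq b with ⟨hb, hb'⟩ | ⟨hb, hb'⟩ <;>
    rcases hd' with h5 | h5 <;> rw [ha', hb', h5] at h2 <;> omega

theorem two_dvd_sub_of_four_dvd {d a b : ℤ} (h4 : d % 4 = 1)
    (h : (4 : ℤ) ∣ a ^ 2 - d * b ^ 2) : (2 : ℤ) ∣ a - b := by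
  obtain ⟨n, hn⟩ := h
  obtain ⟨m, rfl⟩ : ∃ m, d = 4 * m + 1 := ⟨d / 4, by omega⟩
  have h1 : (a - b) * (a + b) = 2 * (2 * (n + m * b ^ 2)) := by linear_combination hn
  rcases Int.prime_two.dvd_or_dvd (Dvd.intro _ h1.symm) with h | h <;> omega

theorem discr_of_basis {d : ℤ} (hd : Squarefree d) {δ : F}
    (e : Module.Basis (Fin 2) ℚ F) (h0 : e 0 = 1) (h1 : e 1 = δ) (hδ : δ ^ 2 = (d : F)) :
    discr F = if d % 4 = 1 then d else 4 * d := by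
  have hrep : ∀ x : F, x = algebraMap ℚ F (e.repr x 0) + algebraMap ℚ F (e.repr x 1) * δ := by
    intro x
    conv_lhs => rw [← e.sum_repr x, Fin.sum_univ_two, h0, h1, Algebra.smul_def, mul_one,
      Algebra.smul_def]
  have hb : ∀ i, IsIntegral ℤ (integralBasis F i) := fun i => by
    rw [integralBasis_apply]; exact RingOfIntegers.isIntegral_coe _
  have hbr : ∀ x : F, IsIntegral ℤ x → ∀ i, IsIntegral ℤ ((integralBasis F).repr x i) := by
    intro x hx i
    have := integralBasis_repr_apply F ⟨x, hx⟩ i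
    change (integralBasis F).repr x i = _ at this
    rw [this]
    exact isIntegral_algebraMap
  -- A ℚ-basis of integral elements in which all integral elements have integral coordinates has the
  -- same discriminant as `integralBasis F`.
  have key : ∀ e' : Module.Basis (Fin 2) ℚ F, (∀ i, IsIntegral ℤ (e' i)) →
      (∀ x : F, IsIntegral ℤ x → ∀ i, IsIntegral ℤ (e'.repr x i)) →
      (discr F : ℚ) = Algebra.discr ℚ e' := by
    intro e' h h'
    rw [coe_discr]
    refine Algebra.discr_eq_discr_of_toMatrix_coeff_isIntegral F ?_ ?_
    · intro i j
      exact hbr _ (h j) i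
    · intro i j
      exact h' _ (hb j) i
  have hδint : IsIntegral ℤ δ := by
    obtain ⟨w, hw, -⟩ := exists_int_of_sq hδ
    rw [← hw]; exact RingOfIntegers.isIntegral_coe _
  have htr := trace_of_basis e h0 h1 hδ
  split_ifs with h4
  · have hli : LinearIndependent ℚ ![(1 : F), (1 + δ) / 2] := by
      have hli0 : LinearIndependent ℚ ![(1 : F), δ] := by
        convert e.linearIndependent using 1
        ext i
        fin_cases i
        · exact h0.symm
        · exact h1.symm
      rw [LinearIndependent.pair_iff] at hli0 ⊢
      intro s t hst
      have h2 := hli0 (s + t / 2) (t / 2) (by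
        rw [← hst]
        simp only [Algebra.smul_def, map_add, map_div₀, map_ofNat]
        ring)
      constructor <;> linarith [h2.1, h2.2]
    have hcard : Fintype.card (Fin 2) = Module.finrank ℚ F :=
      (Module.finrank_eq_card_basis e).symm
    let e' := basisOfLinearIndependentOfCardEqFinrank hli hcard
    have h0' : e' 0 = 1 := by
      rw [show e' 0 = ![(1 : F), (1 + δ) / 2] 0 from congrFun
        (coe_basisOfLinearIndependentOfCardEqFinrank hli hcard) 0]
      rfl
    have h1' : e' 1 = (1 + δ) / 2 := by
      rw [show e' 1 = ![(1 : F), (1 + δ) / 2] 1 from congrFun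
        (coe_basisOfLinearIndependentOfCardEqFinrank hli hcard) 1]
      rfl
    have h2 : (discr F : ℚ) = (d : ℚ) := by
      rw [key e']
      · rw [Algebra.discr_def, Matrix.det_fin_two]
        simp only [Algebra.traceMatrix_apply, Algebra.traceForm_apply, h0', h1']
        have t1 := htr 1 0
        have t2 := htr (1 / 2) (1 / 2)
        have t3 := htr ((1 + d) / 4) (1 / 2)
        have c1 : algebraMap ℚ F (1 / 2) = 1 / 2 := by simp
        have c2 : algebraMap ℚ F ((1 + d) / 4) = (1 + d) / 4 := by simp
        rw [map_one, map_zero, zero_mul, add_zero] at t1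
        rw [c1] at t2
        rw [c1, c2] at t3
        rw [mul_one, mul_one, one_mul, t1, show (1 + δ) / 2 * ((1 + δ) / 2) =
          (1 + (d : F)) / 4 + 1 / 2 * δ by rw [← hδ]; ring, t3,
          show (1 + δ) / 2 = 1 / 2 + 1 / 2 * δ by ring, t2]
        ring
      · intro i
        fin_cases i
        · exact h0' ▸ isIntegral_one
        · change IsIntegral ℤ (e' 1)
          rw [h1']
          exact isIntegral_one_add_div_two hδ h4
      · intro x hx
        have hx2 := hrep x
        rw [hx2] at hx
        obtain ⟨a, b, ha, hb, hab⟩ := exists_of_isIntegral hd e h0 h1 hδ hx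
        obtain ⟨c, hc⟩ := two_dvd_sub_of_four_dvd h4 hab
        have hx3 : x = (c : ℚ) • e' 0 + (b : ℚ) • e' 1 := by
          have hc' : (c : ℚ) = e.repr x 0 - e.repr x 1 := by
            have : (a : ℚ) - b = 2 * c := by exact_mod_cast hc
            linarith
          rw [hc', ← hb, h0', h1', Algebra.smul_def, Algebra.smul_def, map_sub, map_mul, map_ofNat]
          linear_combination hx2
        rw [hx3, map_add, map_smul, map_smul, e'.repr_self, e'.repr_self]
        intro i
        fin_cases i
        · simpa using isIntegral_algebraMap (R := ℤ) (A := ℚ) (x := c)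
        · simpa using isIntegral_algebraMap (R := ℤ) (A := ℚ) (x := b)
    exact_mod_cast h2
  · have h2 : (discr F : ℚ) = ((4 * d : ℤ) : ℚ) := by
      rw [key e]
      · rw [Algebra.discr_def, Matrix.det_fin_two]
        simp only [Algebra.traceMatrix_apply, Algebra.traceForm_apply, h0, h1]
        have t1 := htr 1 0
        have t2 := htr 0 1
        have t3 := htr d 0
        simp only [map_one, map_zero, zero_mul, add_zero, one_mul, zero_add, map_intCast] at t1 t2 t3
        rw [mul_one, mul_one, one_mul, ← pow_two, hδ, t1, t2, t3]
        push_cast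
        ring
      · intro i
        fin_cases i
        · exact h0 ▸ isIntegral_one
        · exact h1 ▸ hδint
      · intro x hx
        rw [hrep x] at hx
        obtain ⟨a, b, ha, hb, hab⟩ := exists_of_isIntegral hd e h0 h1 hδ hx
        have h3 : a % 2 = 0 ∧ b % 2 = 0 := even_of_four_dvd hd h4 hab
        obtain ⟨a', rfl⟩ := Int.dvd_of_emod_eq_zero h3.1
        obtain ⟨b', rfl⟩ := Int.dvd_of_emod_eq_zero h3.2
        intro i
        fin_cases i
        · have : e.repr x 0 = (a' : ℚ) := by push_cast at ha; linarith
          change IsIntegral ℤ (e.repr x 0)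
          rw [this]; exact isIntegral_algebraMap (x := a')
        · have : e.repr x 1 = (b' : ℚ) := by push_cast at hb; linarith
          change IsIntegral ℤ (e.repr x 1)
          rw [this]; exact isIntegral_algebraMap (x := b')
    exact_mod_cast h2

end discriminant

/-! ### Real and imaginary fields in terms of the radicand -/

section signature

open NumberField IntermediateField

theorem conj_eq_of_sq_eq {z : ℂ} {b : ℤ} (hb : 0 ≤ b) (hz : z ^ 2 = (b : ℂ)) :
    starRingEnd ℂ z = z := by
  have hre := congrArg Complex.re hz
  have him := congrArg Complex.im hz
  rw [Complex.intCast_re, pow_two, Complex.mul_re] at hre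
  rw [Complex.intCast_im, pow_two, Complex.mul_im] at him
  have h2 : (0 : ℝ) ≤ b := by exact_mod_cast hb
  rw [Complex.conj_eq_iff_im]
  by_contra him0
  have h3 : z.re = 0 := by
    have : z.re * z.im = 0 := by linarith
    exact (mul_eq_zero.1 this).resolve_right him0
  rw [h3] at hre
  exact him0 (mul_self_eq_zero.1 (le_antisymm (by linarith) (mul_self_nonneg z.im)))

namespace QuadField

variable (K : QuadField)

/-- A square root of the radicand of `K`, as an element of `K`. -/
noncomputable def root : K.1 := ⟨K.sqrt, K.sqrt_mem⟩

theorem root_sq : K.root ^ 2 = (K.radicand : K.1) := Subtype.ext (K.sqrt_sq.trans (by simp))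

theorem exists_basis : ∃ e : Module.Basis (Fin 2) ℚ K.1, e 0 = 1 ∧ e 1 = K.root := by
  have h1 : LinearIndependent ℚ ![(1 : QBar), K.sqrt] := by
    refine linearIndependent_of_sq_eq (b := ![1, K.radicand]) ?_ ?_ ?_
    · intro i
      fin_cases i
      · exact squarefree_one
      · exact K.squarefree_radicand
    · intro i j hij
      fin_cases i <;> fin_cases j
      · rfl
      · exact absurd hij.symm K.radicand_ne_one
      · exact absurd hij K.radicand_ne_one
      · rfl
    · intro i
      fin_cases i
      · simp
      · exact K.sqrt_sq
  have h2 : LinearIndependent ℚ ![(1 : K.1), K.root] := by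
    rw [LinearIndependent.pair_iff] at h1 ⊢
    intro s t hst
    refine h1 s t ?_
    have h3 := congrArg (algebraMap K.1 QBar) hst
    rw [map_zero, Algebra.smul_def, Algebra.smul_def] at h3
    rw [Algebra.smul_def, Algebra.smul_def, ← h3, map_add, map_mul, map_mul, map_one]
    simp only [eq_ratCast, map_ratCast]
    rfl
  have hcard : Fintype.card (Fin 2) = Module.finrank ℚ K.1 := K.2.symm
  refine ⟨basisOfLinearIndependentOfCardEqFinrank h2 hcard, ?_, ?_⟩
  · exact congrFun (coe_basisOfLinearIndependentOfCardEqFinrank h2 hcard) 0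
  · exact congrFun (coe_basisOfLinearIndependentOfCardEqFinrank h2 hcard) 1

theorem exists_rep (x : K.1) : ∃ u v : ℚ, x = algebraMap ℚ K.1 u + algebraMap ℚ K.1 v * K.root := by
  obtain ⟨e, h0, h1⟩ := K.exists_basis
  refine ⟨e.repr x 0, e.repr x 1, ?_⟩
  conv_lhs => rw [← e.sum_repr x, Fin.sum_univ_two, h0, h1, Algebra.smul_def, mul_one,
    Algebra.smul_def]

theorem discr_eq : discr K.1 = if K.radicand % 4 = 1 then K.radicand else 4 * K.radicand := by
  obtain ⟨e, h0, h1⟩ := K.exists_basis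
  exact discr_of_basis K.squarefree_radicand e h0 h1 K.root_sq

theorem ringHom_ext {S : Type*} [Field S] [CharZero S] {f g : K.1 →+* S}
    (h : f K.root = g K.root) : f = g := by
  ext x
  obtain ⟨u, v, rfl⟩ := K.exists_rep x
  simp only [map_add, map_mul, h, eq_ratCast, map_ratCast]

theorem isReal_iff (φ : K.1 →+* ℂ) : ComplexEmbedding.IsReal φ ↔ 0 < K.radicand := by
  have hsq : φ K.root ^ 2 = (K.radicand : ℂ) := by rw [← map_pow, root_sq, map_intCast]
  have hre := congrArg Complex.re hsq
  rw [Complex.intCast_re, pow_two, Complex.mul_re] at hre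
  have h0 : K.radicand ≠ 0 := K.squarefree_radicand.ne_zero
  have h0' : (K.radicand : ℝ) ≠ 0 := by exact_mod_cast h0
  rw [ComplexEmbedding.isReal_iff]
  constructor
  · intro h
    have h1 : (φ K.root).im = 0 := by
      rw [← Complex.conj_eq_iff_im]
      exact RingHom.congr_fun h K.root
    rw [h1, mul_zero, sub_zero] at hre
    have : (0 : ℝ) ≤ K.radicand := hre ▸ mul_self_nonneg _
    exact lt_of_le_of_ne (by exact_mod_cast this) h0.symm
  · intro h
    refine K.ringHom_ext ?_
    exact conj_eq_of_sq_eq h.le hsq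

theorem isTotallyReal_iff : IsTotallyReal K.1 ↔ 0 < K.radicand := by
  constructor
  · intro h
    obtain ⟨v⟩ : Nonempty (InfinitePlace K.1) := inferInstance
    exact (K.isReal_iff _).1 (InfinitePlace.isReal_iff.1 (h.isReal v))
  · exact fun h => ⟨fun v => InfinitePlace.isReal_iff.2 ((K.isReal_iff _).2 h)⟩

theorem isTotallyComplex_iff : IsTotallyComplex K.1 ↔ K.radicand < 0 := by
  have h0 : K.radicand ≠ 0 := K.squarefree_radicand.ne_zero
  constructor
  · intro h
    obtain ⟨v⟩ : Nonempty (InfinitePlace K.1) := inferInstance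
    have h1 : ¬ 0 < K.radicand := fun h' =>
      InfinitePlace.isComplex_iff.1 (h.isComplex v) ((K.isReal_iff _).2 h')
    omega
  · intro h
    refine ⟨fun v => InfinitePlace.isComplex_iff.2 fun h' => ?_⟩
    have := (K.isReal_iff _).1 h'
    omega

theorem abs_discr_le_iff (X : ℝ) : |(discr K.1 : ℝ)| ≤ X ↔
    (if K.radicand % 4 = 1 then |(K.radicand : ℝ)| ≤ X else |(K.radicand : ℝ)| ≤ X / 4) := by
  rw [discr_eq]
  split_ifs
  · rfl
  · push_cast
    rw [abs_mul, le_div_iff₀ (by norm_num), mul_comm]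
    norm_num

end QuadField

/-- The radicands of the real quadratic fields of absolute discriminant at most `X`. -/
def realRadicands (X : ℝ) : Set ℤ := {d | Squarefree d ∧ d ≠ 1 ∧ 0 < d ∧
  if d % 4 = 1 then |(d : ℝ)| ≤ X else |(d : ℝ)| ≤ X / 4}

/-- The radicands of the imaginary quadratic fields of absolute discriminant at most `X`. -/
def imagRadicands (X : ℝ) : Set ℤ := {d | Squarefree d ∧ d < 0 ∧
  if d % 4 = 1 then |(d : ℝ)| ≤ X else |(d : ℝ)| ≤ X / 4}

theorem image_radicand_realQuad (X : ℝ) : QuadField.radicand '' realQuad X = realRadicands X := by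
  ext d
  constructor
  · rintro ⟨K, ⟨h1, h2⟩, rfl⟩
    exact ⟨K.squarefree_radicand, K.radicand_ne_one, K.isTotallyReal_iff.1 h1,
      (K.abs_discr_le_iff X).1 h2⟩
  · rintro ⟨h1, h2, h3, h4⟩
    obtain ⟨K, rfl⟩ := QuadField.exists_radicand_eq h1 h2
    exact ⟨K, ⟨K.isTotallyReal_iff.2 h3, (K.abs_discr_le_iff X).2 h4⟩, rfl⟩

theorem image_radicand_imagQuad (X : ℝ) : QuadField.radicand '' imagQuad X = imagRadicands X := by
  ext d
  constructor
  · rintro ⟨K, ⟨h1, h2⟩, rfl⟩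
    exact ⟨K.squarefree_radicand, K.isTotallyComplex_iff.1 h1, (K.abs_discr_le_iff X).1 h2⟩
  · rintro ⟨h1, h3, h4⟩
    obtain ⟨K, rfl⟩ := QuadField.exists_radicand_eq h1 (by omega)
    exact ⟨K, ⟨K.isTotallyComplex_iff.2 h3, (K.abs_discr_le_iff X).2 h4⟩, rfl⟩

theorem abs_le_of_ite {d : ℤ} {X : ℝ}
    (h : if d % 4 = 1 then |(d : ℝ)| ≤ X else |(d : ℝ)| ≤ X / 4) : |(d : ℝ)| ≤ X := by
  split_ifs at h
  · exact h
  · have := abs_nonneg (d : ℝ)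
    linarith

theorem finite_of_abs_le {S : Set ℤ} {X : ℝ} (h : ∀ d ∈ S, |(d : ℝ)| ≤ X) : S.Finite := by
  refine (Set.finite_Icc (-⌊X⌋) ⌊X⌋).subset fun d hd => ?_
  have h1 := abs_le.1 (h d hd)
  refine ⟨?_, Int.le_floor.2 h1.2⟩
  have : -d ≤ ⌊X⌋ := Int.le_floor.2 (by push_cast; linarith)
  omega

theorem finite_realRadicands (X : ℝ) : (realRadicands X).Finite :=
  finite_of_abs_le fun _ h => abs_le_of_ite h.2.2.2

theorem finite_imagRadicands (X : ℝ) : (imagRadicands X).Finite :=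
  finite_of_abs_le fun _ h => abs_le_of_ite h.2.2

theorem finite_realQuad (X : ℝ) : (realQuad X).Finite :=
  Set.Finite.of_finite_image (image_radicand_realQuad X ▸ finite_realRadicands X)
    QuadField.radicand_injective.injOn

theorem finite_imagQuad (X : ℝ) : (imagQuad X).Finite :=
  Set.Finite.of_finite_image (image_radicand_imagQuad X ▸ finite_imagRadicands X)
    QuadField.radicand_injective.injOn

end signature

/-! ### The diagonal type makes L Galois over ℚ with group of exponent 2 -/

section galois

open IntermediateField

namespace QuadField

variable (K : QuadField)

theorem apply_sqrt (σ : Gal(QBar/ℚ)) : σ K.sqrt = K.sqrt ∨ σ K.sqrt = -K.sqrt :=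
  sq_eq_intCast_apply K.sqrt_sq σ

theorem sqrt_ne_zero : K.sqrt ≠ 0 :=
  ne_zero_of_sq_eq_intCast K.squarefree_radicand.ne_zero K.sqrt_sq

theorem exists_apply_sqrt_eq_neg : ∃ σ : Gal(QBar/ℚ), σ K.sqrt = -K.sqrt := by
  obtain ⟨σ, hσ⟩ := not_mem_range_of_sq_eq K.squarefree_radicand K.radicand_ne_one K.sqrt_sq
  exact ⟨σ, (K.apply_sqrt σ).resolve_left hσ⟩

theorem inv_apply_sqrt (σ : Gal(QBar/ℚ)) : σ⁻¹ K.sqrt = σ K.sqrt := by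
  rw [AlgEquiv.aut_inv, AlgEquiv.symm_apply_eq]
  rcases K.apply_sqrt σ with h | h
  · rw [h, h]
  · rw [h, map_neg, h, neg_neg]

end QuadField

namespace UnramifiedExt

variable {K : QuadField} (L : UnramifiedExt K)

theorem normal : Normal K.1 L.field := L.isGalois.to_normal

theorem normal_closure : Normal ℚ L.closure := normalClosure.normal ℚ L.field QBar

/-- The restriction to the Galois closure of `L` of an automorphism of the algebraic closure. -/
noncomputable def res : Gal(QBar/ℚ) →* Gal(L.closure/ℚ) :=
  have := L.normal_closure
  AlgEquiv.restrictNormalHom L.closure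

theorem coe_res (σ : Gal(QBar/ℚ)) (z : L.closure) : ((L.res σ z : L.closure) : QBar) = σ z :=
  have := L.normal_closure
  AlgEquiv.restrictNormal_commutes σ L.closure z

theorem res_surjective : Function.Surjective L.res :=
  have := L.normal_closure
  AlgEquiv.restrictNormalHom_surjective QBar

theorem coe_algebraMap_closure (a : L.field) :
    ((algebraMap L.field L.closure a : L.closure) : QBar) = a := rfl

theorem restrictsTo_res_iff (σ : Gal(QBar/ℚ)) (γ : Gal(L.field/K.1)) :
    L.RestrictsTo (L.res σ) γ ↔ ∀ a : L.field, σ a = γ a := by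
  refine forall_congr' fun a => ?_
  rw [← Subtype.coe_inj, coe_res, coe_algebraMap_closure, coe_algebraMap_closure]

theorem exists_gal_of_apply_sqrt {σ : Gal(QBar/ℚ)} (h : σ K.sqrt = K.sqrt) :
    ∃ γ : Gal(L.field/K.1), ∀ a : L.field, σ a = γ a := by
  have := L.normal
  let σ' : Gal(QBar/K.1) := AlgEquiv.ofRingEquiv (f := σ.toRingEquiv)
    (fun x => K.fixes_of_fixes_sqrt h x.2)
  refine ⟨σ'.restrictNormal L.field, fun a => ?_⟩
  exact (AlgEquiv.restrictNormal_commutes σ' L.field a).symm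

theorem res_isTwist_iff (σ : Gal(QBar/ℚ)) :
    L.IsTwist (L.res σ) ↔ orderOf (L.res σ) = 2 ∧ σ K.sqrt = -K.sqrt := by
  refine and_congr_right fun _ => ?_
  have h1 : ∀ a : K.1, (L.res σ (algebraMap L.field L.closure (algebraMap K.1 L.field a)) ≠
      algebraMap L.field L.closure (algebraMap K.1 L.field a)) ↔ σ a ≠ a := by
    intro a
    rw [Ne, ← Subtype.coe_inj, coe_res, coe_algebraMap_closure]
    rfl
  simp only [h1]
  constructor
  · rintro ⟨a, ha⟩
    exact (K.apply_sqrt σ).resolve_left fun h => ha (K.fixes_of_fixes_sqrt h a.2)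
  · intro h
    refine ⟨K.root, fun h' => K.sqrt_ne_zero ?_⟩
    have h2 : σ K.sqrt = K.sqrt := h'
    rw [h] at h2
    exact self_eq_neg.1 h2.symm

theorem mem_field_of_fixed {z : QBar}
    (h : ∀ σ : Gal(QBar/ℚ), (∀ a : L.field, σ a = a) → σ z = z) : z ∈ L.field := by
  have h1 := InfiniteGalois.fixedField_fixingSubgroup (k := ℚ) (L.field.restrictScalars ℚ)
  have h2 : z ∈ fixedField (L.field.restrictScalars ℚ).fixingSubgroup :=
    fun σ => h σ.1 fun a => σ.2 a
  rw [h1] at h2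
  exact h2

variable {L} {k : ℕ} {ρ : Gal(L.field/K.1) ≃* C2pow k}

/-- Let τ fix L. The element x = σ₀⁻¹τσ₀ has conjugate σ₀xσ₀⁻¹ = τ, which is trivial on L, so the
second coordinate of φ(x) is 1. The first coordinate equals it, so x is trivial on L and τ fixes
σ₀L. Hence σ₀L ⊆ L, and every other automorphism is reduced to σ₀ by an element fixing K. -/
theorem HasType.stable {σ₀ : Gal(QBar/ℚ)} (hσ₀ : σ₀ K.sqrt = -K.sqrt)
    (h : L.HasType ρ (L.res σ₀) (diagonalType (C2pow k))) (σ : Gal(QBar/ℚ)) (a : L.field) :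
    σ a ∈ L.field := by
  obtain ⟨φ, hφ, -, hrange⟩ := h
  have hdiag : ∀ x, φ x ∈ diagonalType (C2pow k) := fun x => hrange ▸ ⟨x, rfl⟩
  have hconj : ∀ τ : Gal(QBar/ℚ), (∀ a : L.field, τ a = a) →
      ∀ a : L.field, (σ₀⁻¹ * τ * σ₀) a = a := by
    intro τ hτ
    have h1 : (σ₀⁻¹ * τ * σ₀) K.sqrt = K.sqrt := by
      have : τ K.sqrt = K.sqrt := hτ (algebraMap K.1 L.field K.root)
      rw [AlgEquiv.mul_apply, hσ₀, AlgEquiv.mul_apply, map_neg, this, map_neg, K.inv_apply_sqrt,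
        hσ₀, neg_neg]
    obtain ⟨γ, hγ⟩ := L.exists_gal_of_apply_sqrt h1
    have h2 := hφ (L.res (σ₀⁻¹ * τ * σ₀)) γ 1 ((L.restrictsTo_res_iff _ _).2 hγ) (by
      rw [← map_inv, ← map_mul, ← map_mul, L.restrictsTo_res_iff]
      intro a
      rw [show σ₀ * (σ₀⁻¹ * τ * σ₀) * σ₀⁻¹ = τ by group, hτ]
      rfl)
    have h3 : (φ (L.res (σ₀⁻¹ * τ * σ₀))).left 0 = (φ (L.res (σ₀⁻¹ * τ * σ₀))).left 1 := hdiag _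
    rw [h2] at h3
    have h4 : ρ γ = ρ 1 := h3
    have h5 := ρ.injective h4
    intro a
    rw [hγ, h5]
    rfl
  have hσ₀L : ∀ a : L.field, σ₀ a ∈ L.field := by
    intro a
    refine L.mem_field_of_fixed fun τ hτ => ?_
    have h1 := congrArg σ₀ (hconj τ hτ a)
    rw [AlgEquiv.mul_apply, AlgEquiv.mul_apply] at h1
    rwa [show σ₀ (σ₀⁻¹ (τ (σ₀ a))) = τ (σ₀ a) from σ₀.apply_symm_apply _] at h1
  rcases K.apply_sqrt σ with hs | hs
  · obtain ⟨γ, hγ⟩ := L.exists_gal_of_apply_sqrt hs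
    rw [hγ]
    exact SetLike.coe_mem _
  · have h1 : (σ₀⁻¹ * σ) K.sqrt = K.sqrt := by
      rw [AlgEquiv.mul_apply, hs, map_neg, K.inv_apply_sqrt, hσ₀, neg_neg]
    obtain ⟨γ, hγ⟩ := L.exists_gal_of_apply_sqrt h1
    have h2 : σ a = σ₀ (γ a) := by
      rw [← hγ, AlgEquiv.mul_apply]
      exact (σ₀.apply_symm_apply _).symm
    rw [h2]
    exact hσ₀L _

/-- The diagonal group has exponent 2, so φ kills σ², and the first coordinate of φ(σ²) is ρ of the
restriction of σ² to L. -/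
theorem HasType.apply_apply {y : Gal(L.closure/ℚ)}
    (h : L.HasType ρ y (diagonalType (C2pow k))) (σ : Gal(QBar/ℚ)) (a : L.field) :
    σ (σ a) = a := by
  obtain ⟨φ, hφ, -, hrange⟩ := h
  obtain ⟨σ₀, rfl⟩ := L.res_surjective y
  have h1 : ∀ τ : Gal(QBar/ℚ), (τ * τ) K.sqrt = K.sqrt := by
    intro τ
    rw [AlgEquiv.mul_apply]
    rcases K.apply_sqrt τ with h | h
    · rw [h, h]
    · rw [h, map_neg, h, neg_neg]
  obtain ⟨γ, hγ⟩ := L.exists_gal_of_apply_sqrt (h1 σ)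
  obtain ⟨γ', hγ'⟩ := L.exists_gal_of_apply_sqrt (h1 (σ₀ * σ * σ₀⁻¹))
  have h2 := hφ (L.res (σ * σ)) γ γ' ((L.restrictsTo_res_iff _ _).2 hγ) (by
    rw [← map_inv, ← map_mul, ← map_mul, L.restrictsTo_res_iff]
    intro a
    rw [← hγ', show σ₀ * (σ * σ) * σ₀⁻¹ = σ₀ * σ * σ₀⁻¹ * (σ₀ * σ * σ₀⁻¹) by group])
  have h3 : φ (L.res (σ * σ)) = 1 := by
    rw [map_mul, map_mul]
    exact diagonalType_mul_self (hrange ▸ ⟨L.res σ, rfl⟩)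
  have h4 : ρ γ = 1 := by
    have := congrArg (fun g => g.left 0) (h2.symm.trans h3)
    exact this
  have h5 : γ = 1 := (MulEquiv.map_eq_one_iff ρ).1 h4
  have h6 := hγ a
  rw [h5] at h6
  exact h6

end UnramifiedExt

end galois

/-! ### Simultaneous eigenvectors of commuting involutions -/

section decomposition

/-- The splitting β = (β + sβ)/2 + (β - sβ)/2 produces eigenvectors of s and preserves the
eigenvector property for the other elements, since all of them commute. Induction runs over the
elements of the group. -/
theorem mem_of_forall_eigenvector_mem {F : Type*} [Field F] [CharZero F] [Finite Gal(F/ℚ)]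
    (h2 : ∀ (σ : Gal(F/ℚ)) (x : F), σ (σ x) = x) (P : AddSubgroup F)
    (hP : ∀ β : F, (∀ σ : Gal(F/ℚ), σ β = β ∨ σ β = -β) → β ∈ P) (x : F) : x ∈ P := by
  have hcomm : ∀ (σ τ : Gal(F/ℚ)) (x : F), σ (τ x) = τ (σ x) := by
    intro σ τ x
    have h := mul_comm_of_mul_self_eq_one (fun σ : Gal(F/ℚ) => AlgEquiv.ext (h2 σ)) σ τ
    exact AlgEquiv.congr_fun h x
  have key : ∀ S : Finset Gal(F/ℚ), (∀ β : F, (∀ σ ∈ S, σ β = β ∨ σ β = -β) → β ∈ P) → ∀ x, x ∈ P := by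
    classical
    intro S
    induction S using Finset.induction_on with
    | empty => exact fun h x => h x (by simp)
    | insert s S _ ih =>
      intro h
      refine ih fun β hβ => ?_
      have h1 : (β + s β) / 2 ∈ P := by
        refine h _ fun σ hσ => ?_
        rcases Finset.mem_insert.1 hσ with rfl | hσ
        · left
          rw [map_div₀, map_add, h2, map_ofNat, add_comm]
        · rw [map_div₀, map_add, hcomm, map_ofNat]
          rcases hβ σ hσ with h | h <;> rw [h]
          · exact Or.inl rfl
          · right; rw [map_neg]; ring
      have h3 : (β - s β) / 2 ∈ P := by
        refine h _ fun σ hσ => ?_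
        rcases Finset.mem_insert.1 hσ with rfl | hσ
        · right
          rw [map_div₀, map_sub, h2, map_ofNat]; ring
        · rw [map_div₀, map_sub, hcomm, map_ofNat]
          rcases hβ σ hσ with h | h <;> rw [h]
          · exact Or.inl rfl
          · right; rw [map_neg]; ring
      have h4 := P.add_mem h1 h3
      rwa [show (β + s β) / 2 + (β - s β) / 2 = β by ring] at h4
  have := Fintype.ofFinite Gal(F/ℚ)
  exact key Finset.univ (fun β hβ => hP β fun σ => hβ σ (Finset.mem_univ _)) x

end decomposition

/-! ### Containment in the genus field -/

section genusField

open IntermediateField NumberField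

/-- The genus field of the quadratic field `K`, as an extension of `ℚ`. -/
noncomputable def QuadField.genusField (K : QuadField) : IntermediateField ℚ QBar :=
  sqrtField (kummerSet K.radicand)

namespace QuadField

variable (K : QuadField)

theorem le_genusField : K.1 ≤ K.genusField := by
  rw [K.eq_adjoin_sqrt, adjoin_simple_le_iff]
  exact mem_sqrtField (self_mem_kummerSet K.squarefree_radicand) K.sqrt_sq

end QuadField

namespace UnramifiedExt

variable {K : QuadField} (L : UnramifiedExt K)

theorem numberField : NumberField L.field where
  to_charZero := inferInstance
  to_finiteDimensional :=
    have := L.finiteDimensional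
    FiniteDimensional.trans ℚ K.1 L.field

/-- All places of a real K are real, and L/K is unramified at them, so L has a real embedding, under
which m becomes a square of a real number. -/
theorem pos_of_sq_eq (h : 0 < K.radicand) {m : ℤ} (hm : m ≠ 0) {x : L.field}
    (hx : x ^ 2 = (m : L.field)) : 0 < m := by
  have := L.numberField
  obtain ⟨w⟩ : Nonempty (InfinitePlace L.field) := inferInstance
  have hun := L.unramified_infinite.isUnramified w
  have hcomp := ((K.isReal_iff (w.embedding.comp (algebraMap K.1 L.field))).2 h)
  have hreal : w.IsReal := by
    rcases InfinitePlace.isUnramified_iff.1 hun with h1 | h1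
    · exact h1
    · refine absurd ?_ (InfinitePlace.not_isReal_iff_isComplex.2 h1)
      rw [← InfinitePlace.mk_embedding w, InfinitePlace.comap_mk, InfinitePlace.isReal_mk_iff]
      exact hcomp
  have h2 : starRingEnd ℂ (w.embedding x) = w.embedding x :=
    RingHom.congr_fun (ComplexEmbedding.isReal_iff.1 (InfinitePlace.isReal_iff.1 hreal)) x
  obtain ⟨r, hr⟩ := Complex.conj_eq_iff_real.1 h2
  have h3 : (r : ℂ) ^ 2 = (m : ℂ) := by rw [← hr, ← map_pow, hx, map_intCast]
  have h4 : r ^ 2 = (m : ℝ) := by exact_mod_cast h3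
  have h5 : (0 : ℝ) ≤ m := h4 ▸ sq_nonneg r
  exact lt_of_le_of_ne (by exact_mod_cast h5) hm.symm

theorem mem_kummerSet [IsGalois ℚ L.field] {m : ℤ} (hm : Squarefree m) {x : L.field}
    (hx : x ^ 2 = (m : L.field)) : m ∈ kummerSet K.radicand := by
  have := L.numberField
  have := L.isGalois
  have hδ : ∀ σ : Gal(L.field/ℚ), σ (algebraMap K.1 L.field K.root) = algebraMap K.1 L.field K.root →
      ∀ a : K.1, σ (algebraMap K.1 L.field a) = algebraMap K.1 L.field a := by
    intro σ hσ a
    exact RingHom.congr_fun (K.ringHom_ext (f := (σ : L.field →+* L.field).comp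
      (algebraMap K.1 L.field)) (g := algebraMap K.1 L.field) hσ) a
  refine ⟨hm, ?_⟩
  have hpos : 0 < K.radicand → 0 < m := fun h => L.pos_of_sq_eq h hm.ne_zero hx
  refine (radicand_of_unramified hδ K.root_sq K.squarefree_radicand
    (fun P hP hP0 => L.unramified_finite P hP0) hm hx).imp (fun h => ⟨h.1, h.2, hpos⟩)
    fun h => ⟨h.1, h.2, fun h0 => ?_⟩
  obtain ⟨g, hg, h1⟩ := exists_sq_mul_sqfreeMul K.radicand hm
  have h2 := mul_pos (hpos h0) h0
  rw [h1] at h2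
  exact (pos_iff_pos_of_mul_pos h2).1 (by positivity)

/-- L is spanned by simultaneous eigenvectors of Gal(L/ℚ). A non-zero eigenvector has a rational
square, so it is a rational multiple of some √m with m squarefree, and unramifiedness places m in
the Kummer set. -/
theorem le_genusField (hst : ∀ (σ : Gal(QBar/ℚ)) (a : L.field), σ a ∈ L.field)
    (hinv : ∀ (σ : Gal(QBar/ℚ)) (a : L.field), σ (σ a) = a) :
    L.field.restrictScalars ℚ ≤ K.genusField := by
  have := L.numberField
  have hnorm : Normal ℚ (L.field.restrictScalars ℚ) := by
    refine normal_iff_forall_map_le'.2 fun σ => ?_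
    rintro _ ⟨a, ha, rfl⟩
    exact hst σ ⟨a, ha⟩
  have hnorm' : Normal ℚ L.field := hnorm
  have hgal : IsGalois ℚ L.field := ⟨⟩
  have h2 : ∀ (σ : Gal(L.field/ℚ)) (x : L.field), σ (σ x) = x := by
    intro σ x
    obtain ⟨σ', rfl⟩ := AlgEquiv.restrictNormalHom_surjective (F := ℚ) (K₁ := L.field) QBar σ
    have h3 : ∀ a : L.field, ((AlgEquiv.restrictNormalHom L.field σ' a : L.field) : QBar) = σ' a :=
      fun a => AlgEquiv.restrictNormal_commutes σ' L.field a
    rw [← Subtype.coe_inj, h3, h3, hinv]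
  intro x hx
  refine mem_of_forall_eigenvector_mem h2
    (K.genusField.toSubfield.toAddSubgroup.comap (algebraMap L.field QBar).toAddMonoidHom)
    (fun β hβ => ?_) ⟨x, hx⟩
  change (β : QBar) ∈ K.genusField
  by_cases hβ0 : β = 0
  · rw [hβ0]; exact zero_mem _
  obtain ⟨q, hq⟩ := (IsGalois.mem_range_algebraMap_iff_fixed (F := ℚ) (β ^ 2)).2 (by
    intro τ
    rcases hβ τ with h | h <;> rw [map_pow, h]
    ring)
  obtain ⟨c, m, hc, hm, h⟩ := exists_smul_sq_eq_intCast hβ0 hq.symm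
  have h4 : algebraMap ℚ QBar c * β ∈ K.genusField := by
    refine mem_sqrtField (L.mem_kummerSet hm h) ?_
    have h5 := congrArg (algebraMap L.field QBar) h
    rw [map_pow, map_mul, map_intCast] at h5
    rw [← h5]
    simp only [eq_ratCast, map_ratCast]
    rfl
  have h6 : algebraMap ℚ QBar c ≠ 0 := (map_ne_zero _).2 hc
  have h7 : (β : QBar) = algebraMap ℚ QBar c⁻¹ * (algebraMap ℚ QBar c * β) := by
    rw [map_inv₀, inv_mul_cancel_left₀ h6]
  rw [h7]
  exact mul_mem (K.genusField.algebraMap_mem _) h4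

end UnramifiedExt

end genusField

/-! ### The genus field is unramified, and so are its subextensions -/

section genusExt

open IntermediateField NumberField

theorem sqrtField_ringHom_ext {B : Set ℤ} {S : Type*} [Field S] [CharZero S]
    {f g : sqrtField B →+* S}
    (h : ∀ b ∈ B, ∀ x : sqrtField B, x ^ 2 = (b : sqrtField B) → f x = g x) : f = g := by
  have h1 : f.toRatAlgHom = g.toRatAlgHom := by
    refine algHom_ext_of_eq_adjoin ℚ (S := sqrtField B)
      (s := {x | ∃ b ∈ B, x ^ 2 = (b : QBar)}) rfl ?_
    rintro x ⟨b, hb, hx⟩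
    exact h b hb _ (Subtype.ext (by simpa using hx))
  ext x
  exact DFunLike.congr_fun h1 x

namespace QuadField

variable (K : QuadField)

/-- The genus field of the quadratic field `K`, as an extension of `K`. -/
noncomputable def genusExt : IntermediateField K.1 QBar := extendScalars K.le_genusField

theorem finrank_genusField : Module.finrank ℚ K.genusField = (kummerSet K.radicand).ncard := by
  have hf := finite_kummerSet K.squarefree_radicand
  have h := finrank_sqrtField (B := hf.toFinset)
    (fun b hb => ((hf.mem_toFinset).1 hb).1) (hf.mem_toFinset.2 (one_mem_kummerSet _))
    (fun a ha b hb => hf.mem_toFinset.2 (sqfreeMul_mem_kummerSet K.squarefree_radicand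
      (hf.mem_toFinset.1 ha) (hf.mem_toFinset.1 hb)))
  rw [hf.coe_toFinset, ← Set.ncard_eq_toFinset_card _ hf] at h
  exact h

theorem finiteDimensional_genusField : FiniteDimensional ℚ K.genusField := by
  refine Module.finite_of_finrank_pos ?_
  rw [K.finrank_genusField]
  exact (Set.ncard_pos (finite_kummerSet K.squarefree_radicand)).2 ⟨1, one_mem_kummerSet _⟩

theorem isAbelianGalois_genusField : IsAbelianGalois ℚ K.genusField := by
  have hg : IsGalois ℚ K.genusField := isGalois_sqrtField _
  have hn : Normal ℚ K.genusField := hg.to_normal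
  refine { hg with is_comm := ⟨mul_comm_of_mul_self_eq_one fun σ => ?_⟩ }
  obtain ⟨σ', rfl⟩ := AlgEquiv.restrictNormalHom_surjective (F := ℚ) (K₁ := K.genusField) QBar σ
  have h3 : ∀ a : K.genusField,
      ((AlgEquiv.restrictNormalHom K.genusField σ' a : K.genusField) : QBar) = σ' a :=
    fun a => AlgEquiv.restrictNormal_commutes σ' K.genusField a
  ext a
  rw [AlgEquiv.mul_apply, h3, h3]
  exact mul_self_apply_of_mem_sqrtField σ' a.2

theorem isAbelianGalois_rat_genusExt : IsAbelianGalois ℚ K.genusExt :=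
  K.isAbelianGalois_genusField

theorem isAbelianGalois_genusExt : IsAbelianGalois K.1 K.genusExt :=
  have := K.isAbelianGalois_rat_genusExt
  IsAbelianGalois.tower_top ℚ K.1 K.genusExt

theorem numberField_genusExt : NumberField K.genusExt where
  to_charZero := inferInstance
  to_finiteDimensional := K.finiteDimensional_genusField

theorem finiteDimensional_genusExt : FiniteDimensional K.1 K.genusExt :=
  have := K.numberField_genusExt
  FiniteDimensional.right ℚ K.1 K.genusExt

theorem two_mul_finrank_genusExt :
    2 * Module.finrank K.1 K.genusExt = (kummerSet K.radicand).ncard := by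
  rw [← K.finrank_genusField]
  have h : Module.finrank ℚ K.1 * Module.finrank K.1 K.genusExt = Module.finrank ℚ K.genusExt :=
    Module.finrank_mul_finrank ℚ K.1 K.genusExt
  have h2 : Module.finrank ℚ K.1 = 2 := K.2
  rw [h2] at h
  exact h

theorem genusExt_ringHom_ext {S : Type*} [Field S] [CharZero S] {f g : K.genusExt →+* S}
    (h : ∀ b ∈ kummerSet K.radicand, ∀ x : K.genusExt, x ^ 2 = (b : K.genusExt) → f x = g x) :
    f = g :=
  sqrtField_ringHom_ext (B := kummerSet K.radicand) (f := f) (g := g) h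

theorem isUnramifiedAt_genusExt (P : Ideal (𝓞 K.genusExt)) [P.IsPrime] :
    Algebra.IsUnramifiedAt (𝓞 K.1) P := by
  have := K.numberField_genusExt
  have := K.isAbelianGalois_genusExt
  refine isUnramifiedAt_of_generators K.root_sq K.squarefree_radicand (fun σ hσ => ?_) P
  have h1 : (σ : K.genusExt →+* K.genusExt) = RingHom.id K.genusExt := by
    refine K.genusExt_ringHom_ext fun b hb x hx => ?_
    change σ x = x
    rcases hb with ⟨hbs, hb | hb⟩
    · exact hσ b x hb.1 hb.2.1 hx
    -- Here only the squarefree part of bd is in `genusSet`. The element x√d/g is a square root of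
    -- it, and σ fixes √d and g, so σ fixes x as well.
    · obtain ⟨g, hg, h⟩ := exists_sq_mul_sqfreeMul K.radicand hbs
      have hg' : (g : K.genusExt) ≠ 0 := Int.cast_ne_zero.2 hg
      have hr : (algebraMap K.1 K.genusExt K.root) ^ 2 = (K.radicand : K.genusExt) := by
        rw [← map_pow, K.root_sq, map_intCast]
      have hr0 : algebraMap K.1 K.genusExt K.root ≠ 0 :=
        ne_zero_of_sq_eq_intCast K.squarefree_radicand.ne_zero hr
      have h2 := hσ _ (x * algebraMap K.1 K.genusExt K.root / g) hb.1 hb.2.1 (by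
        rw [div_pow, mul_pow, hx, hr, div_eq_iff (pow_ne_zero 2 hg')]
        exact_mod_cast h.trans (mul_comm _ _))
      rw [map_div₀, map_mul, AlgEquiv.commutes, map_intCast, div_left_inj' hg',
        mul_left_inj' hr0] at h2
      exact h2
  ext x
  exact congrArg _ (RingHom.congr_fun h1 x)

/-- For d > 0 all radicands are positive, so every embedding of the genus field is real. For d < 0
the field K has no real place that could ramify. -/
theorem isUnramifiedAtInfinitePlaces_genusExt : IsUnramifiedAtInfinitePlaces K.1 K.genusExt := by
  refine ⟨fun w => InfinitePlace.isUnramified_iff.2 ?_⟩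
  by_cases h0 : 0 < K.radicand
  · left
    rw [InfinitePlace.isReal_iff, ComplexEmbedding.isReal_iff]
    refine K.genusExt_ringHom_ext fun b hb x hx => ?_
    have hb0 : 0 < b := by
      rcases hb with ⟨hbs, hb | hb⟩
      · exact hb.2.2 h0
      · obtain ⟨g, hg, h⟩ := exists_sq_mul_sqfreeMul K.radicand hbs
        have h1 : 0 < b * K.radicand := by
          rw [h]; exact mul_pos (by positivity) (hb.2.2 h0)
        exact (pos_iff_pos_of_mul_pos h1).2 h0
    have hsq : w.embedding x ^ 2 = (b : ℂ) := by rw [← map_pow, hx, map_intCast]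
    exact conj_eq_of_sq_eq hb0.le hsq
  · right
    rw [← InfinitePlace.mk_embedding w, InfinitePlace.comap_mk, InfinitePlace.isComplex_mk_iff,
      K.isReal_iff]
    exact h0

end QuadField

namespace UnramifiedExt

variable {K : QuadField}

/-- A subextension of the genus field, as an unramified extension. -/
theorem exists_field_eq {F : IntermediateField K.1 QBar} (hF : F ≤ K.genusExt) :
    ∃ L : UnramifiedExt K, L.field = F := by
  have := K.numberField_genusExt
  have := K.finiteDimensional_genusExt
  have := K.isAbelianGalois_genusExt
  have hgal : IsAbelianGalois K.1 F := IsAbelianGalois.of_algHom (inclusion hF)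
  have hfin : FiniteDimensional K.1 F :=
    FiniteDimensional.of_injective (inclusion hF).toLinearMap (inclusion hF).injective
  have hnf : NumberField F :=
    { to_charZero := inferInstance
      to_finiteDimensional := FiniteDimensional.trans ℚ K.1 F }
  let _ : Algebra F K.genusExt := (inclusion hF).toRingHom.toAlgebra
  have : IsScalarTower K.1 F K.genusExt :=
    IsScalarTower.of_algebraMap_eq' (inclusion hF).comp_algebraMap.symm
  have hunr : IsUnramifiedAtInfinitePlaces K.1 F :=
    have := K.isUnramifiedAtInfinitePlaces_genusExt
    IsUnramifiedAtInfinitePlaces.bot K.1 F K.genusExt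
  refine ⟨⟨F, hfin, inferInstance, fun P hP hP0 => ?_, hunr⟩, rfl⟩
  obtain ⟨Q, hQ, hQP⟩ := Ideal.exists_ideal_over_prime_of_isIntegral_of_isDomain
    (S := 𝓞 K.genusExt) P (by
      rw [(RingHom.injective_iff_ker_eq_bot (algebraMap (𝓞 F) (𝓞 K.genusExt))).1
        (FaithfulSMul.algebraMap_injective _ _)]
      exact bot_le)
  have hlo : Q.LiesOver P := ⟨hQP.symm⟩
  have := K.isUnramifiedAt_genusExt Q
  exact Algebra.IsUnramifiedAt.of_liesOver (𝓞 K.1) P Q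

end UnramifiedExt

end genusExt

/-! ### Subfields of the genus field have the diagonal type -/

section typeOfGenus

open IntermediateField NumberField

/-- The projection of the diagonal type subgroup to `G`. -/
def diagonalFst (G : Type*) [Group G] : diagonalType G →* G :=
  MonoidHom.mk' (fun g => g.1.left 0) fun _ h => congrFun (mul_left_of_mem_diagonalType h.2) 0

/-- The hypotheses make W the direct product of u(H) and {1, y}. The map (a, a, b) ↦ u(ρ⁻¹ a) s(b)
is an isomorphism from the diagonal group onto W, and φ is its inverse. -/
theorem exists_hom_range_eq_diagonalType {H W : Type*} [Group H] [Group W] {k : ℕ}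
    (hW : ∀ w : W, w * w = 1) (u : H →* W) (hu : Function.Injective u) {y : W}
    (hy : ∀ γ, u γ ≠ y) (hcover : ∀ w, (∃ γ, w = u γ) ∨ ∃ γ, w = y * u γ) (ρ : H ≃* C2pow k) :
    ∃ φ : W →* WreathTwo (C2pow k), (∀ γ, φ (u γ) = SemidirectProduct.inl ![ρ γ, ρ γ]) ∧
      φ y = wreathSigma (C2pow k) ∧ φ.range = diagonalType (C2pow k) := by
  have hcomm := mul_comm_of_mul_self_eq_one hW
  let s : Equiv.Perm (Fin 2) → W := fun b => if b = 1 then 1 else y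
  have hs1 : s 1 = 1 := if_pos rfl
  have hsw : s (Equiv.swap 0 1) = y := if_neg (by decide)
  have hs : ∀ a b, s (a * b) = s a * s b := by
    intro a b
    by_cases ha : a = 1
    · rw [ha, one_mul, hs1, one_mul]
    · by_cases hb : b = 1
      · rw [hb, mul_one, hs1, mul_one]
      · rw [perm_fin_two_eq ha, perm_fin_two_eq hb, perm_fin_two_mul_self, hs1, hsw, hW]
  have hmul4 : ∀ a b c d : W, a * b * (c * d) = a * c * (b * d) := fun a b c d => by
    rw [mul_assoc, ← mul_assoc b, hcomm b c, mul_assoc, mul_assoc]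
  let f : diagonalType (C2pow k) →* W :=
    MonoidHom.mk' (fun g => u (ρ.symm (diagonalFst _ g)) * s g.1.right) fun g h => by
      have h2 : (g * h).1.right = g.1.right * h.1.right := rfl
      rw [map_mul, map_mul, map_mul, h2, hs, hmul4]
  have hf : ∀ g : diagonalType (C2pow k), f g = u (ρ.symm (g.1.left 0)) * s g.1.right :=
    fun _ => rfl
  have hfr : ∀ g : diagonalType (C2pow k), f g = 1 → g.1.right = 1 := by
    intro g hg
    by_contra hne
    rw [hf, perm_fin_two_eq hne, hsw] at hg
    refine hy (ρ.symm (g.1.left 0)) ?_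
    rw [eq_inv_of_mul_eq_one_left hg, inv_eq_of_mul_eq_one_left (hW y)]
  have hbij : Function.Bijective f := by
    constructor
    · rw [injective_iff_map_eq_one]
      intro g hg
      have h1 := hfr g hg
      rw [hf, h1, hs1, mul_one, map_eq_one_iff _ hu, MulEquiv.map_eq_one_iff] at hg
      refine Subtype.ext (SemidirectProduct.ext (funext fun i => ?_) h1)
      rw [diagonalType_left g.2 i 0, hg]
      rfl
    · intro w
      rcases hcover w with ⟨γ, hγ⟩ | ⟨γ, hγ⟩
      · refine ⟨⟨⟨fun _ => ρ γ, 1⟩, rfl⟩, ?_⟩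
        rw [hf, hγ]
        simp [hs1]
      · refine ⟨⟨⟨fun _ => ρ γ, Equiv.swap 0 1⟩, rfl⟩, ?_⟩
        rw [hf, hγ, hcomm]
        simp [hsw]
  let e := MulEquiv.ofBijective f hbij
  refine ⟨(diagonalType (C2pow k)).subtype.comp e.symm.toMonoidHom, ?_, ?_, ?_⟩
  · intro γ
    have h1 : e ⟨⟨fun _ => ρ γ, 1⟩, rfl⟩ = u γ := by
      change f _ = _
      rw [hf]
      simp [hs1]
    rw [← h1]
    change ((e.symm (e _)).1 : WreathTwo (C2pow k)) = _
    rw [e.symm_apply_apply]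
    refine SemidirectProduct.ext (funext fun i => ?_) rfl
    fin_cases i <;> rfl
  · have h1 : e ⟨⟨fun _ => 1, Equiv.swap 0 1⟩, rfl⟩ = y := by
      change f _ = _
      rw [hf]
      simp [hsw]
    rw [← h1]
    change ((e.symm (e _)).1 : WreathTwo (C2pow k)) = _
    rw [e.symm_apply_apply]
    rfl
  · ext g
    constructor
    · rintro ⟨w, rfl⟩
      exact (e.symm w).2
    · intro hg
      refine ⟨e ⟨g, hg⟩, ?_⟩
      change ((e.symm (e _)).1 : WreathTwo (C2pow k)) = _
      rw [e.symm_apply_apply]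

namespace UnramifiedExt

variable {K : QuadField} {L : UnramifiedExt K}

theorem apply_apply_of_le (hL : L.field ≤ K.genusExt) (σ : Gal(QBar/ℚ)) (a : L.field) :
    σ (σ a) = a :=
  mul_self_apply_of_mem_sqrtField σ (hL a.2)

theorem isAbelianGalois_of_le (hL : L.field ≤ K.genusExt) : IsAbelianGalois ℚ L.field := by
  have := K.isAbelianGalois_rat_genusExt
  exact IsAbelianGalois.of_algHom ((inclusion hL).toRingHom.toRatAlgHom)

theorem apply_mem_of_le (hL : L.field ≤ K.genusExt) (σ : QBar →ₐ[ℚ] QBar) (a : L.field) :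
    σ a ∈ L.field := by
  have h := isAbelianGalois_of_le hL
  have h1 : Normal ℚ (L.field.restrictScalars ℚ) := h.toIsGalois.to_normal
  exact normal_iff_forall_map_le.1 h1 σ ⟨a, a.2, rfl⟩

theorem closure_le_of_le (hL : L.field ≤ K.genusExt) :
    L.closure ≤ L.field.restrictScalars ℚ := by
  refine normalClosure_le_iff.2 fun f => ?_
  rintro _ ⟨a, rfl⟩
  have h := f.liftNormal_commutes QBar a
  exact (congrArg (· ∈ L.field) h).mp (apply_mem_of_le hL (f.liftNormal QBar) a)

theorem algebraMap_closure_surjective (hL : L.field ≤ K.genusExt) (z : L.closure) :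
    ∃ a : L.field, algebraMap L.field L.closure a = z :=
  ⟨⟨z, closure_le_of_le hL z.2⟩, Subtype.ext rfl⟩

theorem mul_self_closure (hL : L.field ≤ K.genusExt) (w : Gal(L.closure/ℚ)) : w * w = 1 := by
  obtain ⟨σ, rfl⟩ := L.res_surjective w
  ext z
  obtain ⟨a, rfl⟩ := algebraMap_closure_surjective hL z
  rw [AlgEquiv.mul_apply, coe_res, coe_res, coe_algebraMap_closure, apply_apply_of_le hL]
  rfl

theorem RestrictsTo.eq_left (hL : L.field ≤ K.genusExt) {w w' : Gal(L.closure/ℚ)}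
    {γ : Gal(L.field/K.1)} (h : L.RestrictsTo w γ) (h' : L.RestrictsTo w' γ) : w = w' := by
  ext z
  obtain ⟨a, rfl⟩ := algebraMap_closure_surjective hL z
  rw [h a, h' a]

theorem RestrictsTo.eq_right {w : Gal(L.closure/ℚ)} {γ γ' : Gal(L.field/K.1)}
    (h : L.RestrictsTo w γ) (h' : L.RestrictsTo w γ') : γ = γ' := by
  ext a
  exact congrArg Subtype.val ((algebraMap L.field L.closure).injective ((h a).symm.trans (h' a)))

variable (L) in
theorem exists_restrictsTo (γ : Gal(L.field/K.1)) : ∃ w, L.RestrictsTo w γ := by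
  have := L.normal
  obtain ⟨σ, rfl⟩ := AlgEquiv.restrictNormalHom_surjective (F := K.1) (K₁ := L.field) QBar γ
  refine ⟨L.res (σ.restrictScalars ℚ), (L.restrictsTo_res_iff _ _).2 fun a => ?_⟩
  exact (AlgEquiv.restrictNormal_commutes σ L.field a).symm

theorem RestrictsTo.apply_sqrt {σ : Gal(QBar/ℚ)} {γ : Gal(L.field/K.1)}
    (h : L.RestrictsTo (L.res σ) γ) : σ K.sqrt = K.sqrt := by
  have h1 := (L.restrictsTo_res_iff σ γ).1 h (algebraMap K.1 L.field K.root)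
  rw [AlgEquiv.commutes] at h1
  exact h1

/-- The inclusion of `Gal(L/K)` in `Gal(L/ℚ)`, for `L` inside the genus field. -/
noncomputable def lift (hL : L.field ≤ K.genusExt) : Gal(L.field/K.1) →* Gal(L.closure/ℚ) :=
  MonoidHom.mk' (fun γ => (L.exists_restrictsTo γ).choose) fun γ γ' => by
    refine RestrictsTo.eq_left hL (L.exists_restrictsTo (γ * γ')).choose_spec fun a => ?_
    rw [AlgEquiv.mul_apply, (L.exists_restrictsTo γ').choose_spec a,
      (L.exists_restrictsTo γ).choose_spec]
    rfl

theorem lift_restrictsTo (hL : L.field ≤ K.genusExt) (γ : Gal(L.field/K.1)) :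
    L.RestrictsTo (lift hL γ) γ :=
  (L.exists_restrictsTo γ).choose_spec

theorem lift_injective (hL : L.field ≤ K.genusExt) : Function.Injective (lift hL) :=
  fun γ γ' h => (lift_restrictsTo hL γ).eq_right (h ▸ lift_restrictsTo hL γ')

theorem res_eq_lift (hL : L.field ≤ K.genusExt) {σ : Gal(QBar/ℚ)} (h : σ K.sqrt = K.sqrt) :
    ∃ γ, L.res σ = lift hL γ := by
  obtain ⟨γ, hγ⟩ := L.exists_gal_of_apply_sqrt h
  exact ⟨γ, ((L.restrictsTo_res_iff _ _).2 hγ).eq_left hL (lift_restrictsTo hL γ)⟩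

theorem lift_ne (hL : L.field ≤ K.genusExt) {σ : Gal(QBar/ℚ)} (h : σ K.sqrt = -K.sqrt)
    (γ : Gal(L.field/K.1)) : lift hL γ ≠ L.res σ := by
  intro h1
  have h2 : σ K.sqrt = K.sqrt := RestrictsTo.apply_sqrt (h1 ▸ lift_restrictsTo hL γ)
  exact K.sqrt_ne_zero (self_eq_neg.1 (h2.symm.trans h))

theorem exists_eq_mul_lift (hL : L.field ≤ K.genusExt) {σ₀ σ : Gal(QBar/ℚ)}
    (hσ₀ : σ₀ K.sqrt = -K.sqrt) (hσ : σ K.sqrt = -K.sqrt) :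
    ∃ γ, L.res σ = L.res σ₀ * lift hL γ := by
  obtain ⟨γ, hγ⟩ := res_eq_lift hL (σ := σ₀ * σ) (by
    rw [AlgEquiv.mul_apply, hσ, map_neg, hσ₀, neg_neg])
  refine ⟨γ, ?_⟩
  rw [← hγ, map_mul, ← mul_assoc, mul_self_closure hL, one_mul]

theorem isTwist_iff_of_le (hL : L.field ≤ K.genusExt) (σ : Gal(QBar/ℚ)) :
    L.IsTwist (L.res σ) ↔ σ K.sqrt = -K.sqrt := by
  rw [res_isTwist_iff, and_iff_right_iff_imp]
  intro h
  refine orderOf_eq_prime (by rw [pow_two, mul_self_closure hL]) fun h1 => ?_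
  exact lift_ne hL h 1 (by rw [map_one, h1])

/-- Every non-trivial element of Gal(L̃/ℚ) has order 2, so the twists fill the whole non-trivial
coset of Gal(L/K). -/
theorem ncard_isTwist (hL : L.field ≤ K.genusExt) :
    {y | L.IsTwist y}.ncard = Nat.card Gal(L.field/K.1) := by
  obtain ⟨σ₀, hσ₀⟩ := K.exists_apply_sqrt_eq_neg
  have h1 : {y | L.IsTwist y} = Set.range (fun γ => L.res σ₀ * lift hL γ) := by
    ext w
    obtain ⟨σ, rfl⟩ := L.res_surjective w
    rw [Set.mem_ofPred_eq, isTwist_iff_of_le hL]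
    constructor
    · intro h
      obtain ⟨γ, hγ⟩ := exists_eq_mul_lift hL hσ₀ h
      exact ⟨γ, hγ.symm⟩
    · rintro ⟨γ, hγ⟩
      refine (K.apply_sqrt σ).resolve_left fun h => ?_
      obtain ⟨γ', hγ'⟩ := res_eq_lift hL h
      refine lift_ne hL hσ₀ (γ' * γ⁻¹) ?_
      rw [map_mul, map_inv, ← hγ', ← hγ, mul_inv_cancel_right]
  rw [h1, ← Set.image_univ, Set.ncard_image_of_injective, Set.ncard_univ]
  exact fun γ γ' h => lift_injective hL (mul_left_cancel h)

/-- Gal(L̃/ℚ) is abelian, so y x y⁻¹ = x and the two coordinates agree for every ρ. -/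
theorem hasType_of_le (hL : L.field ≤ K.genusExt) {k : ℕ} (ρ : Gal(L.field/K.1) ≃* C2pow k)
    {σ₀ : Gal(QBar/ℚ)} (hσ₀ : σ₀ K.sqrt = -K.sqrt) :
    L.HasType ρ (L.res σ₀) (diagonalType (C2pow k)) := by
  have hcover : ∀ w, (∃ γ, w = lift hL γ) ∨ ∃ γ, w = L.res σ₀ * lift hL γ := by
    intro w
    obtain ⟨σ, rfl⟩ := L.res_surjective w
    exact (K.apply_sqrt σ).imp (res_eq_lift hL) (exists_eq_mul_lift hL hσ₀)
  obtain ⟨φ, h1, h2, h3⟩ := exists_hom_range_eq_diagonalType (mul_self_closure hL) (lift hL)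
    (lift_injective hL) (lift_ne hL hσ₀) hcover ρ
  refine ⟨φ, fun x γ γ' hx hx' => ?_, h2, h3⟩
  rw [mul_comm_of_mul_self_eq_one (mul_self_closure hL) _ x, mul_inv_cancel_right] at hx'
  rw [← hx.eq_right hx', ← h1, hx.eq_left hL (lift_restrictsTo hL γ)]

theorem HasType.le {k : ℕ} {ρ : Gal(L.field/K.1) ≃* C2pow k} {σ₀ : Gal(QBar/ℚ)}
    (hσ₀ : σ₀ K.sqrt = -K.sqrt) (h : L.HasType ρ (L.res σ₀) (diagonalType (C2pow k))) :
    L.field ≤ K.genusExt :=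
  L.le_genusField (h.stable hσ₀) h.apply_apply

/-- If complex conjugation fixed √d, the restriction of ι to K would be a real embedding, which d <
0 excludes. -/
theorem apply_sqrt_of_isConj (hK : K.radicand < 0) (ι : QBar →+* ℂ) {σ : Gal(QBar/ℚ)}
    (h : ComplexEmbedding.IsConj (ι.comp (algebraMap L.closure QBar)) (L.res σ)) :
    σ K.sqrt = -K.sqrt := by
  refine (K.apply_sqrt σ).resolve_left fun hs => ?_
  have h1 := h.eq (algebraMap L.field L.closure (algebraMap K.1 L.field K.root))
  have h2 : ι (σ K.sqrt) = star (ι K.sqrt) := by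
    have h3 := L.coe_res σ (algebraMap L.field L.closure (algebraMap K.1 L.field K.root))
    exact (congrArg ι h3).symm.trans h1
  rw [hs] at h2
  have h4 : ComplexEmbedding.IsReal (ι.comp (algebraMap K.1 QBar)) :=
    ComplexEmbedding.isReal_iff.2 (K.ringHom_ext h2.symm)
  rw [K.isReal_iff] at h4
  omega

variable (L) in
theorem exists_isConj (ι : QBar →+* ℂ) :
    ∃ y : Gal(L.closure/ℚ), ComplexEmbedding.IsConj (ι.comp (algebraMap L.closure QBar)) y := by
  have hn := L.normal_closure
  have : IsGalois ℚ L.closure := ⟨⟩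
  obtain ⟨σ, hσ⟩ := ComplexEmbedding.exists_comp_symm_eq_of_comp_eq (k := ℚ)
    (ι.comp (algebraMap L.closure QBar))
    (ComplexEmbedding.conjugate (ι.comp (algebraMap L.closure QBar))) (Subsingleton.elim _ _)
  exact ⟨σ.symm, hσ.symm⟩

theorem card_eq_of_mulEquiv {k : ℕ} (ρ : Gal(L.field/K.1) ≃* C2pow k) :
    Module.finrank K.1 L.field = 2 ^ k := by
  have := L.isGalois
  have := L.finiteDimensional
  rw [← IsGalois.card_aut_eq_finrank, Nat.card_congr ρ.toEquiv, natCard_C2pow]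

theorem card_gal {k : ℕ} (h : Module.finrank K.1 L.field = 2 ^ k) :
    Nat.card Gal(L.field/K.1) = 2 ^ k := by
  have := L.isGalois
  have := L.finiteDimensional
  rw [IsGalois.card_aut_eq_finrank, h]

theorem exists_mulEquiv (hL : L.field ≤ K.genusExt) {k : ℕ}
    (h : Module.finrank K.1 L.field = 2 ^ k) : Nonempty (Gal(L.field/K.1) ≃* C2pow k) := by
  have := L.finiteDimensional
  refine exists_mulEquiv_C2pow (fun γ => ?_) (card_gal h)
  refine lift_injective hL ?_
  rw [map_mul, mul_self_closure hL, map_one]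

end UnramifiedExt

end typeOfGenus

/-! ### Reduction of the four counts to surjections from Gal(Γ/K) -/

section counting

open IntermediateField

theorem UnramifiedExt.field_injective {K : QuadField} :
    Function.Injective (UnramifiedExt.field (K := K)) := by
  rintro ⟨F, _, _, _, _⟩ ⟨F', _, _, _, _⟩ h
  have h1 : F = F' := h
  subst h1
  rfl

namespace QuadField

variable (K : QuadField)

theorem mul_self_gal_genusExt (γ : Gal(K.genusExt/K.1)) : γ * γ = 1 := by
  have := K.isAbelianGalois_genusExt
  have : Normal K.1 K.genusExt := IsGalois.to_normal
  obtain ⟨σ, rfl⟩ := AlgEquiv.restrictNormalHom_surjective (F := K.1) (K₁ := K.genusExt) QBar γ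
  have h1 : ∀ x : K.genusExt, ((AlgEquiv.restrictNormalHom K.genusExt σ x : K.genusExt) : QBar)
      = σ x := fun x => AlgEquiv.restrictNormal_commutes σ K.genusExt x
  ext x
  rw [AlgEquiv.mul_apply, h1, h1]
  exact mul_self_apply_of_mem_sqrtField (σ.restrictScalars ℚ) x.2

theorem finite_gal_genusExt : Finite Gal(K.genusExt/K.1) := by
  have := K.finiteDimensional_genusExt
  infer_instance

theorem two_mul_card_gal_genusExt :
    2 * Nat.card Gal(K.genusExt/K.1) = (kummerSet K.radicand).ncard := by
  have := K.finiteDimensional_genusExt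
  have := K.isAbelianGalois_genusExt
  rw [IsGalois.card_aut_eq_finrank, two_mul_finrank_genusExt]

/-- The extensions of degree `2 ^ k` of `K` that are contained in its genus field. -/
def genusSubexts (k : ℕ) : Set (UnramifiedExt K) :=
  {L | L.field ≤ K.genusExt ∧ Module.finrank K.1 L.field = 2 ^ k}

theorem nonempty_genusSubexts_equiv (k : ℕ) :
    Nonempty (K.genusSubexts k ≃ {H : Subgroup Gal(K.genusExt/K.1) // H.index = 2 ^ k}) := by
  have := K.finiteDimensional_genusExt
  have := K.isAbelianGalois_genusExt
  have hidx : ∀ F : IntermediateField K.1 K.genusExt,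
      F.fixingSubgroup.index = Module.finrank K.1 (lift F) := fun F => by
    rw [← finrank_eq_fixingSubgroup_index, (liftAlgEquiv F).toLinearEquiv.finrank_eq]
  have hex : ∀ H : Subgroup Gal(K.genusExt/K.1), ∃ L : UnramifiedExt K,
      L.field = lift (fixedField H) := fun H => UnramifiedExt.exists_field_eq (lift_le _)
  choose f hf using hex
  have hfin : ∀ H, Module.finrank K.1 (f H).field = H.index := fun H => by
    rw [hf, ← hidx, fixingSubgroup_fixedField]
  refine ⟨(Equiv.ofBijective (fun H => ⟨f H.1, by rw [hf]; exact lift_le _, by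
    rw [hfin, H.2]⟩) ⟨fun H H' h => ?_, fun L => ?_⟩).symm⟩
  · have h1 : f H.1 = f H'.1 := congrArg Subtype.val h
    have h2 : lift (fixedField H.1) = lift (fixedField H'.1) := by rw [← hf, h1, hf]
    have h3 := lift_injective _ h2
    refine Subtype.ext ?_
    rw [← fixingSubgroup_fixedField H.1, h3, fixingSubgroup_fixedField]
  · obtain ⟨L, hle, hdeg⟩ := L
    have h1 : f (restrict hle).fixingSubgroup = L := by
      refine UnramifiedExt.field_injective ?_
      rw [hf, IsGalois.fixedField_fixingSubgroup]
      exact lift_restrict hle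
    exact ⟨⟨(restrict hle).fixingSubgroup, by rw [← hfin, h1, hdeg]⟩, Subtype.ext h1⟩

theorem finite_genusSubexts (k : ℕ) : (K.genusSubexts k).Finite := by
  have := K.finite_gal_genusExt
  obtain ⟨e⟩ := K.nonempty_genusSubexts_equiv k
  exact Finite.of_equiv _ e.symm

/-- The number of surjective homomorphisms from `Gal(Γ/K)` to `C₂ᵏ`, for `Γ` the genus field. -/
noncomputable def genusSurj (k : ℕ) : ℕ := surjCount k Gal(K.genusExt/K.1)

theorem genusSurj_eq (k : ℕ) :
    K.genusSurj k = (K.genusSubexts k).ncard * Nat.card (MulAut (C2pow k)) := by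
  have := K.finite_gal_genusExt
  obtain ⟨e⟩ := K.nonempty_genusSubexts_equiv k
  rw [genusSurj, surjCount_eq k _ K.mul_self_gal_genusExt, ← Nat.card_congr e,
    Nat.card_coe_set_eq]

end QuadField

open QuadField UnramifiedExt

variable {K : QuadField} {k : ℕ}

/-- The type condition depends neither on ρ nor on the choice of y once y is non-trivial on K. This
single equivalence reduces all four counts to `genusSubexts`. -/
theorem hasType_iff_mem_genusSubexts {L : UnramifiedExt K} {ρ : Gal(L.field/K.1) ≃* C2pow k}
    {y : Gal(L.closure/ℚ)} (hy : ∃ σ : Gal(QBar/ℚ), y = L.res σ ∧ σ K.sqrt = -K.sqrt) :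
    L.HasType ρ y (diagonalType (C2pow k)) ↔ L ∈ K.genusSubexts k := by
  obtain ⟨σ, rfl, hσ⟩ := hy
  exact ⟨fun h => ⟨h.le hσ, card_eq_of_mulEquiv ρ⟩, fun h => hasType_of_le h.1 ρ hσ⟩

theorem exists_res_of_isTwist {L : UnramifiedExt K} {y : Gal(L.closure/ℚ)} (hy : L.IsTwist y) :
    ∃ σ : Gal(QBar/ℚ), y = L.res σ ∧ σ K.sqrt = -K.sqrt := by
  obtain ⟨σ, rfl⟩ := L.res_surjective y
  exact ⟨σ, rfl, ((L.res_isTwist_iff σ).1 hy).2⟩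

theorem realRigidified_eq : realRigidified (diagonalType (C2pow k)) K =
    {t | t.1 ∈ K.genusSubexts k ∧ t.1.IsTwist t.2.2} := by
  ext t
  exact ⟨fun h => ⟨(hasType_iff_mem_genusSubexts (exists_res_of_isTwist h.1)).1 h.2, h.1⟩,
    fun h => ⟨h.2, (hasType_iff_mem_genusSubexts (exists_res_of_isTwist h.2)).2 h.1⟩⟩

theorem realFields_eq : realFields (diagonalType (C2pow k)) K = K.genusSubexts k := by
  ext L
  constructor
  · rintro ⟨ρ, y, hy, h⟩
    exact (hasType_iff_mem_genusSubexts (exists_res_of_isTwist hy)).1 h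
  · intro h
    obtain ⟨ρ⟩ := exists_mulEquiv h.1 h.2
    obtain ⟨σ, hσ⟩ := K.exists_apply_sqrt_eq_neg
    exact ⟨ρ, L.res σ, (isTwist_iff_of_le h.1 σ).2 hσ, hasType_of_le h.1 ρ hσ⟩

theorem hasImagType_iff (hK : K.radicand < 0) (ι : QBar →+* ℂ) {L : UnramifiedExt K}
    {ρ : Gal(L.field/K.1) ≃* C2pow k} :
    L.HasImagType ι ρ (diagonalType (C2pow k)) ↔ L ∈ K.genusSubexts k := by
  have h1 : ∀ y : Gal(L.closure/ℚ),
      NumberField.ComplexEmbedding.IsConj (ι.comp (algebraMap L.closure QBar)) y →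
      ∃ σ : Gal(QBar/ℚ), y = L.res σ ∧ σ K.sqrt = -K.sqrt := by
    intro y hy
    obtain ⟨σ, rfl⟩ := L.res_surjective y
    exact ⟨σ, rfl, apply_sqrt_of_isConj hK ι hy⟩
  constructor
  · rintro ⟨y, hy, h⟩
    exact (hasType_iff_mem_genusSubexts (h1 y hy)).1 h
  · intro h
    obtain ⟨y, hy⟩ := L.exists_isConj ι
    exact ⟨y, hy, (hasType_iff_mem_genusSubexts (h1 y hy)).2 h⟩

theorem imagRigidified_eq (hK : K.radicand < 0) (ι : QBar →+* ℂ) :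
    imagRigidified (diagonalType (C2pow k)) ι K = {t | t.1 ∈ K.genusSubexts k} := by
  ext t
  exact hasImagType_iff hK ι

theorem imagFields_eq (hK : K.radicand < 0) (ι : QBar →+* ℂ) :
    imagFields (diagonalType (C2pow k)) ι K = K.genusSubexts k := by
  ext L
  constructor
  · rintro ⟨ρ, h⟩
    exact (hasImagType_iff hK ι).1 h
  · intro h
    obtain ⟨ρ⟩ := exists_mulEquiv h.1 h.2
    exact ⟨ρ, (hasImagType_iff hK ι).2 h⟩

/-- The condition n ≠ 0 makes each fibre over s finite, since an infinite set has `ncard` 0. -/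
theorem ncard_sigma_const {α : Type*} {β : α → Type*} {s : Set α} (hs : s.Finite)
    (t : ∀ a, Set (β a)) {n : ℕ} (hn : n ≠ 0) (h : ∀ a ∈ s, (t a).ncard = n) :
    {x : Σ a, β a | x.1 ∈ s ∧ x.2 ∈ t x.1}.Finite ∧
      {x : Σ a, β a | x.1 ∈ s ∧ x.2 ∈ t x.1}.ncard = s.ncard * n := by
  have hfin : ∀ a ∈ s, (t a).Finite := fun a ha =>
    Set.finite_of_ncard_ne_zero (by rw [h a ha]; exact hn)
  have := hs.fintype
  have hfin' : ∀ a : s, Finite (t a) := fun a => hfin a a.2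
  let e : {x : Σ a, β a | x.1 ∈ s ∧ x.2 ∈ t x.1} ≃ Σ a : s, t a :=
    { toFun := fun x => ⟨⟨x.1.1, x.2.1⟩, ⟨x.1.2, x.2.2⟩⟩
      invFun := fun x => ⟨⟨x.1, x.2⟩, x.1.2, x.2.2⟩
      left_inv := fun _ => rfl
      right_inv := fun _ => rfl }
  refine ⟨Finite.of_equiv _ e.symm, ?_⟩
  rw [← Nat.card_coe_set_eq, Nat.card_congr e, Nat.card_sigma]
  simp only [Nat.card_coe_set_eq]
  rw [Finset.sum_congr rfl fun (a : s) _ => h a a.2, Finset.sum_const, smul_eq_mul,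
    Finset.card_univ, ← Nat.card_eq_fintype_card, Nat.card_coe_set_eq]

theorem ncard_setOf_snd {α β : Type*} (P : β → Prop) :
    {x : α × β | P x.2}.ncard = Nat.card α * {y | P y}.ncard := by
  rw [← Set.ncard_univ, ← Set.ncard_prod]
  congr 1
  ext x
  simp

theorem natCard_mulAut_C2pow_ne_zero (k : ℕ) : Nat.card (MulAut (C2pow k)) ≠ 0 :=
  Nat.card_ne_zero.2 ⟨inferInstance, inferInstance⟩

theorem natCard_mulEquiv_of_mem_genusSubexts {L : UnramifiedExt K} (h : L ∈ K.genusSubexts k) :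
    Nat.card (Gal(L.field/K.1) ≃* C2pow k) = Nat.card (MulAut (C2pow k)) := by
  obtain ⟨ρ⟩ := exists_mulEquiv h.1 h.2
  exact natCard_mulEquiv_congr ρ

theorem finite_and_ncard_imagRigidified (hK : K.radicand < 0) (ι : QBar →+* ℂ) :
    (imagRigidified (diagonalType (C2pow k)) ι K).Finite ∧
      (imagRigidified (diagonalType (C2pow k)) ι K).ncard = K.genusSurj k := by
  have h := ncard_sigma_const (K.finite_genusSubexts k)
    (fun L => (Set.univ : Set (Gal(L.field/K.1) ≃* C2pow k))) (natCard_mulAut_C2pow_ne_zero k)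
    fun L hL => by rw [Set.ncard_univ, natCard_mulEquiv_of_mem_genusSubexts hL]
  simp only [Set.mem_univ, and_true] at h
  rw [imagRigidified_eq hK, genusSurj_eq]
  exact h

theorem finite_and_ncard_realRigidified :
    (realRigidified (diagonalType (C2pow k)) K).Finite ∧
      (realRigidified (diagonalType (C2pow k)) K).ncard = 2 ^ k * K.genusSurj k := by
  have h1 : ∀ L ∈ K.genusSubexts k,
      {x : (Gal(L.field/K.1) ≃* C2pow k) × Gal(L.closure/ℚ) | L.IsTwist x.2}.ncard =
        Nat.card (MulAut (C2pow k)) * 2 ^ k := fun L hL => by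
    rw [ncard_setOf_snd, natCard_mulEquiv_of_mem_genusSubexts hL, ncard_isTwist hL.1, card_gal hL.2]
  have h := ncard_sigma_const (K.finite_genusSubexts k)
    (fun L => {x : (Gal(L.field/K.1) ≃* C2pow k) × Gal(L.closure/ℚ) | L.IsTwist x.2})
    (mul_ne_zero (natCard_mulAut_C2pow_ne_zero k) (pow_ne_zero k two_ne_zero)) h1
  have h2 : 2 ^ k * K.genusSurj k =
      (K.genusSubexts k).ncard * (Nat.card (MulAut (C2pow k)) * 2 ^ k) := by
    rw [genusSurj_eq, mul_comm, mul_assoc]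
  rw [h2, realRigidified_eq]
  exact h

end counting

/-! ### Sums over radicands as sums over odd squarefree numbers -/

section radicandSums

open Finset

/-- The squarefree natural numbers `n ≤ x` with `n ≡ a` modulo `4`. -/
noncomputable def sqfreeMod (a : ℕ) (x : ℝ) : Finset ℕ :=
  {n ∈ Ioc 0 ⌊x⌋₊ | n % 4 = a ∧ Squarefree n}

theorem mem_sqfreeMod {a n : ℕ} {x : ℝ} :
    n ∈ sqfreeMod a x ↔ 0 < n ∧ (n : ℝ) ≤ x ∧ n % 4 = a ∧ Squarefree n := by
  rw [sqfreeMod, mem_filter, mem_Ioc, and_assoc]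
  refine and_congr_right fun h => ?_
  rw [Nat.le_floor_iff' h.ne']

/-- The squarefree integers of the sign of `ε`, in the range that corresponds to quadratic fields
of absolute discriminant at most `X`. -/
def signedRadicands (ε : ℤ) (X : ℝ) : Set ℤ := {d | Squarefree d ∧ 0 < ε * d ∧
  if d % 4 = 1 then |(d : ℝ)| ≤ X else |(d : ℝ)| ≤ X / 4}

theorem squarefree_sign_mul_iff {ε : ℤ} (hε : ε = 1 ∨ ε = -1) (n : ℕ) :
    Squarefree (ε * n) ↔ Squarefree n := by
  rw [← Int.squarefree_natAbs]
  rcases hε with rfl | rfl <;> simp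

theorem squarefree_two_mul_iff {m : ℕ} (h : m % 2 = 1) :
    Squarefree (2 * m) ↔ Squarefree m := by
  rw [Nat.squarefree_mul (Nat.coprime_two_left.2 (Nat.odd_iff.2 h))]
  exact and_iff_right Nat.prime_two.squarefree

theorem mod_four_ne_zero_of_squarefree {n : ℕ} (h : Squarefree n) : n % 4 ≠ 0 := fun h4 =>
  absurd (Nat.isUnit_iff.1 (h 2 (Nat.dvd_of_mod_eq_zero h4))) (by norm_num)

/-- Here e is the residue of |d| modulo 4 for which d ≡ 1 mod 4. The cutoffs X, X/4 and X/8 for m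
correspond to the discriminants d with |d| = m, 4d with |d| = m, and 4d with |d| = 2m. -/
theorem signedRadicands_eq {ε : ℤ} {e : ℕ} (hε : ε = 1 ∧ e = 1 ∨ ε = -1 ∧ e = 3) (X : ℝ) :
    signedRadicands ε X =
      ((fun m : ℕ => ε * m) '' sqfreeMod e X ∪ (fun m : ℕ => ε * m) '' sqfreeMod (4 - e) (X / 4)) ∪
      ((fun m : ℕ => ε * (2 * m : ℕ)) '' sqfreeMod e (X / 8) ∪
        (fun m : ℕ => ε * (2 * m : ℕ)) '' sqfreeMod (4 - e) (X / 8)) := by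
  have hε' : ε = 1 ∨ ε = -1 := hε.imp And.left And.left
  have habs : ∀ n : ℕ, |((ε * n : ℤ) : ℝ)| = n := by
    intro n
    rcases hε' with rfl | rfl <;> simp
  have hpos : ∀ n : ℕ, 0 < ε * (ε * n) ↔ 0 < n := by
    intro n
    rcases hε' with rfl | rfl <;> simp
  have hmod : ∀ n : ℕ, (ε * n) % 4 = 1 ↔ n % 4 = e := by
    intro n
    rcases hε with ⟨rfl, rfl⟩ | ⟨rfl, rfl⟩ <;> omega
  have hmem : ∀ n : ℕ, ε * n ∈ signedRadicands ε X ↔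
      Squarefree n ∧ 0 < n ∧ if n % 4 = e then (n : ℝ) ≤ X else (n : ℝ) ≤ X / 4 := by
    intro n
    simp only [signedRadicands, Set.mem_ofPred_eq, squarefree_sign_mul_iff hε', habs, hpos, hmod]
  have he : e = 1 ∨ e = 3 := hε.imp And.right And.right
  ext d
  constructor
  · intro hd
    obtain ⟨n, rfl⟩ : ∃ n : ℕ, d = ε * n := by
      refine ⟨d.natAbs, ?_⟩
      have := hd.2.1
      rcases hε' with rfl | rfl <;> omega
    obtain ⟨h1, h2, h3⟩ := (hmem n).1 hd
    have h4 := mod_four_ne_zero_of_squarefree h1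
    by_cases hn : n % 4 = e
    · rw [if_pos hn] at h3
      exact Or.inl (Or.inl ⟨n, mem_sqfreeMod.2 ⟨h2, h3, hn, h1⟩, rfl⟩)
    rw [if_neg hn] at h3
    by_cases hn' : n % 4 = 4 - e
    · exact Or.inl (Or.inr ⟨n, mem_sqfreeMod.2 ⟨h2, h3, hn', h1⟩, rfl⟩)
    obtain ⟨m, rfl, hm⟩ : ∃ m, n = 2 * m ∧ m % 2 = 1 := ⟨n / 2, by omega, by omega⟩
    have h3' : (m : ℝ) ≤ X / 8 := by
      push_cast at h3
      linarith
    have h1' := (squarefree_two_mul_iff hm).1 h1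
    by_cases hme : m % 4 = e
    · exact Or.inr (Or.inl ⟨m, mem_sqfreeMod.2 ⟨by omega, h3', hme, h1'⟩, rfl⟩)
    · exact Or.inr (Or.inr ⟨m, mem_sqfreeMod.2 ⟨by omega, h3', by omega, h1'⟩, rfl⟩)
  · have hodd : ∀ {m a : ℕ}, (a = e ∨ a = 4 - e) → m ∈ sqfreeMod a (X / 8) →
        ε * (2 * m : ℕ) ∈ signedRadicands ε X := by
      intro m a ha hm
      obtain ⟨h1, h2, h3, h4⟩ := mem_sqfreeMod.1 hm
      refine (hmem _).2 ⟨(squarefree_two_mul_iff (by omega)).2 h4, by omega, ?_⟩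
      rw [if_neg (by omega)]
      push_cast
      linarith
    rintro ((⟨m, hm, rfl⟩ | ⟨m, hm, rfl⟩) | (⟨m, hm, rfl⟩ | ⟨m, hm, rfl⟩))
    · obtain ⟨h1, h2, h3, h4⟩ := mem_sqfreeMod.1 hm
      exact (hmem m).2 ⟨h4, h1, by rwa [if_pos h3]⟩
    · obtain ⟨h1, h2, h3, h4⟩ := mem_sqfreeMod.1 hm
      exact (hmem m).2 ⟨h4, h1, by rwa [if_neg (by omega)]⟩
    · exact hodd (Or.inl rfl) hm
    · exact hodd (Or.inr rfl) hm

theorem finsum_mem_signedRadicands {ε : ℤ} {e : ℕ} (hε : ε = 1 ∧ e = 1 ∨ ε = -1 ∧ e = 3)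
    (f : ℤ → ℝ) (X : ℝ) :
    ∑ᶠ d ∈ signedRadicands ε X, f d =
      (∑ m ∈ sqfreeMod e X, f (ε * m) + ∑ m ∈ sqfreeMod (4 - e) (X / 4), f (ε * m)) +
      (∑ m ∈ sqfreeMod e (X / 8), f (ε * (2 * m : ℕ)) +
        ∑ m ∈ sqfreeMod (4 - e) (X / 8), f (ε * (2 * m : ℕ))) := by
  have hε' : ε = 1 ∨ ε = -1 := hε.imp And.left And.left
  have he : e = 1 ∨ e = 3 := hε.imp And.right And.right
  have hinj : Function.Injective fun m : ℕ => ε * m := by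
    intro m n h
    rcases hε' with rfl | rfl <;> simp at h <;> exact h
  have hinj2 : Function.Injective fun m : ℕ => ε * (2 * m : ℕ) := fun m n h => by
    have := hinj h
    omega
  have hdis : ∀ {x y : ℝ}, Disjoint (sqfreeMod e x : Set ℕ) (sqfreeMod (4 - e) y) := by
    intro x y
    rw [Set.disjoint_left]
    intro m h h'
    have h1 := (mem_sqfreeMod.1 h).2.2.1
    have h2 := (mem_sqfreeMod.1 h').2.2.1
    omega
  rw [signedRadicands_eq hε, finsum_mem_union, finsum_mem_union, finsum_mem_union,
    finsum_mem_image hinj.injOn, finsum_mem_image hinj.injOn, finsum_mem_image hinj2.injOn,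
    finsum_mem_image hinj2.injOn, finsum_mem_coe_finset, finsum_mem_coe_finset,
    finsum_mem_coe_finset, finsum_mem_coe_finset]
  · exact (Set.disjoint_image_iff hinj2).2 hdis
  · exact (finite_toSet _).image _
  · exact (finite_toSet _).image _
  · exact (Set.disjoint_image_iff hinj).2 hdis
  · exact (finite_toSet _).image _
  · exact (finite_toSet _).image _
  · rw [Set.disjoint_left]
    have key : ∀ {m n a : ℕ} {x : ℝ}, (a = e ∨ a = 4 - e) → m ∈ sqfreeMod a x →
        ε * m ≠ ε * (2 * n : ℕ) := by
      intro m n a x ha hm h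
      have h1 := (mem_sqfreeMod.1 hm).2.2.1
      have h2 := hinj h
      omega
    rintro d (⟨m, hm, rfl⟩ | ⟨m, hm, rfl⟩) (⟨n, hn, h⟩ | ⟨n, hn, h⟩)
    · exact key (Or.inl rfl) hm h.symm
    · exact key (Or.inl rfl) hm h.symm
    · exact key (Or.inr rfl) hm h.symm
    · exact key (Or.inr rfl) hm h.symm
  · exact ((finite_toSet _).image _).union ((finite_toSet _).image _)
  · exact ((finite_toSet _).image _).union ((finite_toSet _).image _)

/-- Half the number of radicands of the genus field: the degree of the genus field over the
quadratic field of radicand `d ≠ 1`. -/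
noncomputable def genusDegree (d : ℤ) : ℝ := (kummerSet d).ncard / 2

theorem genusDegree_nonneg (d : ℤ) : 0 ≤ genusDegree d := by
  unfold genusDegree
  positivity

theorem genusDegree_eq {d : ℤ} (hd : Squarefree d) :
    genusDegree d = (if d % 4 = 1 then 1 / 2 else 1) * (genusSet d).ncard := by
  rw [genusDegree]
  split_ifs with h
  · rw [kummerSet_eq_genusSet hd h]
    ring
  · rw [ncard_kummerSet hd h]
    push_cast
    ring

theorem genusDegree_of_neg {d : ℤ} (hds : Squarefree d) {m : ℕ} (hm : Odd m) (hms : Squarefree m)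
    (h : d.natAbs = m ∨ d.natAbs = 2 * m) (hd : d < 0) :
    genusDegree d = (if d % 4 = 1 then 1 / 2 else 1) * 1 * 2 ^ m.primeFactors.card *
      (1 + if ∀ p ∈ m.primeFactors, p % 4 = 1 then 0 else 0) := by
  rw [genusDegree_eq hds, ncard_genusSet_of_neg hm hms h hd]
  push_cast
  simp

theorem genusDegree_of_pos {d : ℤ} (hds : Squarefree d) {m : ℕ} (hm : Odd m) (hms : Squarefree m)
    (h : d.natAbs = m ∨ d.natAbs = 2 * m) (hd : 0 < d) :
    genusDegree d = (if d % 4 = 1 then 1 / 2 else 1) * (1 / 2) * 2 ^ m.primeFactors.card *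
      (1 + if ∀ p ∈ m.primeFactors, p % 4 = 1 then 1 else 0) := by
  have h1 : 2 * ((genusSet d).ncard : ℝ) = 2 ^ m.primeFactors.card *
      (1 + if ∀ p ∈ m.primeFactors, p % 4 = 1 then 1 else 0) := by
    have h2 := congrArg (Nat.cast (R := ℝ)) (ncard_genusSet_of_pos hm hms h hd)
    push_cast at h2
    rw [h2, mul_add, mul_one, mul_ite, mul_one, mul_zero]
  rw [genusDegree_eq hds, mul_assoc _ (2 ^ _ : ℝ), ← h1]
  ring

end radicandSums

/-! ### Moments of the degree of the genus field -/

section radicandAsymptotics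

open Finset

theorem sum_sqfreeMod_eq (z : ℕ) {a : ℕ} (ha : a = 1 ∨ a = 3) (x : ℝ) (P : ℕ → Prop)
    [DecidablePred P] :
    ∑ m ∈ sqfreeMod a x with P m, (z : ℝ) ^ m.primeFactors.card =
      ∑ n ∈ Ioc 0 ⌊x⌋₊ with n % 4 = a ∧ P n, oddSqfreePow z n := by
  rw [sqfreeMod, filter_filter, ← sum_filter_of_ne (s := {n ∈ Ioc 0 ⌊x⌋₊ | n % 4 = a ∧ P n})
    (p := fun n => Squarefree n), filter_filter]
  · refine sum_congr (filter_congr fun n _ => by tauto) fun n hn => ?_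
    obtain ⟨-, ⟨h4, -⟩, hs⟩ := mem_filter.1 hn
    rw [oddSqfreePow_apply, if_pos ⟨Nat.odd_iff.2 (by omega), hs⟩]
  · intro n _ hn
    by_contra hs
    exact hn (by rw [oddSqfreePow_apply, if_neg fun h => hs h.2])

/-- The density constant of the sums of `(z + 1) ^ ω(n)` over squarefree `n` in an odd class
modulo `4`. -/
noncomputable def sqfreeModConst (z : ℕ) : ℝ := 1 / z.factorial * sqfreeConst (z + 1) / 2

theorem sqfreeModConst_pos (z : ℕ) : 0 < sqfreeModConst z := by
  have := sqfreeConst_pos (z + 1)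
  unfold sqfreeModConst
  positivity

/-- The w-term lives on m whose prime factors are all 1 mod 4. Its sum loses a logarithm, so w does
not appear in the limit. -/
theorem tendsto_sum_sqfreeMod (j : ℕ) {a : ℕ} (ha : a = 1 ∨ a = 3) {f : ℕ → ℝ} {c w t : ℝ}
    (ht : 0 < t) (hf : ∀ m, m % 4 = a → Squarefree m → f m =
      c * ((2 * (j + 1) : ℕ) : ℝ) ^ m.primeFactors.card *
        (1 + if ∀ p ∈ m.primeFactors, p % 4 = 1 then w else 0)) :
    Tendsto (fun X => (∑ m ∈ sqfreeMod a (X / t), f m) / (X * Real.log X ^ (2 * j + 1))) atTop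
      (𝓝 (c * sqfreeModConst (2 * j + 1) / t)) := by
  have h1 : Tendsto (fun x => sqfreeSumMod (2 * (j + 1)) a x / (x * Real.log x ^ (2 * j + 1)))
      atTop (𝓝 (sqfreeModConst (2 * j + 1))) := tendsto_sqfreeSumMod (2 * j) ha
  obtain ⟨B, hB⟩ := exists_sum_oddSqfreePow_primes_le j
  let F : ℝ → ℝ := fun x => ∑ n ∈ Ioc 0 ⌊x⌋₊ with n % 4 = a ∧ ∀ p ∈ n.primeFactors, p % 4 = 1,
    oddSqfreePow (2 * (j + 1)) n
  have h2 : Tendsto (fun x => F x / (x * Real.log x ^ (2 * j + 1))) atTop (𝓝 0) := by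
    refine tendsto_div_mul_log_pow_of_le (B := B) (Nat.lt_succ_self (2 * j)) fun x hx => ?_
    refine le_trans ?_ (hB x hx)
    rw [abs_of_nonneg (sum_nonneg fun n _ => oddSqfreePow_nonneg _ n)]
    refine le_trans (sum_le_sum_of_subset_of_nonneg ?_ fun n _ _ => oddSqfreePow_nonneg _ n)
      (le_abs_self _)
    intro n hn
    rw [mem_filter] at hn ⊢
    exact ⟨hn.1, hn.2.2⟩
  have h3 := tendsto_comp_div_mul_log_pow ((h1.const_mul c).add (h2.const_mul (c * w)) |>.congr
    fun x => show _ = (c * sqfreeSumMod (2 * (j + 1)) a x + c * w * F x) /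
      (x * Real.log x ^ (2 * j + 1)) by ring) ht
  rw [mul_zero, add_zero] at h3
  refine h3.congr fun X => ?_
  congr 1
  have e1 := sum_sqfreeMod_eq (2 * (j + 1)) ha (X / t) fun _ => True
  have e2 := sum_sqfreeMod_eq (2 * (j + 1)) ha (X / t) fun n => ∀ p ∈ n.primeFactors, p % 4 = 1
  simp only [and_true, filter_true] at e1
  rw [sqfreeSumMod, ← e1, show F (X / t) = _ from e2.symm, sum_filter, mul_sum, mul_sum,
    ← sum_add_distrib]
  refine sum_congr rfl fun m hm => ?_
  rw [hf m (mem_sqfreeMod.1 hm).2.2.1 (mem_sqfreeMod.1 hm).2.2.2]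
  split_ifs <;> ring

theorem tendsto_sum_sqfreeMod_zero (z : ℕ) {n : ℕ} (hz : z < n) {a : ℕ} (ha : a = 1 ∨ a = 3)
    {f : ℕ → ℝ} {t : ℝ} (ht : 0 < t) (hf : ∀ m, m % 4 = a → Squarefree m → 0 ≤ f m ∧
      f m ≤ ((z + 1 : ℕ) : ℝ) ^ m.primeFactors.card) :
    Tendsto (fun X => (∑ m ∈ sqfreeMod a (X / t), f m) / (X * Real.log X ^ n)) atTop (𝓝 0) := by
  obtain ⟨B, hB⟩ := exists_summatory_oddSqfreePow_le z
  have h := tendsto_comp_div_mul_log_pow (G := fun x => ∑ m ∈ sqfreeMod a x, f m) (m := n) (c := 0)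
    (tendsto_div_mul_log_pow_of_le hz (B := B) fun x hx => ?_) ht
  · rwa [zero_div] at h
  · refine le_trans ?_ (hB x hx)
    have h1 : ∀ m ∈ sqfreeMod a x, 0 ≤ f m ∧ f m ≤ ((z + 1 : ℕ) : ℝ) ^ m.primeFactors.card :=
      fun m hm => hf m (mem_sqfreeMod.1 hm).2.2.1 (mem_sqfreeMod.1 hm).2.2.2
    rw [abs_of_nonneg (sum_nonneg fun m hm => (h1 m hm).1)]
    refine (sum_le_sum fun m hm => (h1 m hm).2).trans ?_
    have e1 := sum_sqfreeMod_eq (z + 1) ha x fun _ => True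
    simp only [and_true, filter_true] at e1
    rw [e1]
    refine le_trans (sum_le_sum_of_subset_of_nonneg (filter_subset _ _)
      fun n _ _ => oddSqfreePow_nonneg _ n) (le_abs_self _)

/-- Both signs are put into one shape: α = 1/2, w = 1 for d > 0, and α = 1, w = 0 for d < 0. The
inequality α(1 + w) ≤ 1 bounds the degree by 2^ω(m). -/
theorem genusDegree_sign_mul {ε : ℤ} {e : ℕ} (hε : ε = 1 ∧ e = 1 ∨ ε = -1 ∧ e = 3) :
    ∃ α w : ℝ, 0 < α ∧ α * (1 + w) ≤ 1 ∧ 0 ≤ w ∧ ∀ m : ℕ, m % 2 = 1 → Squarefree m →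
      (genusDegree (ε * m) = (if m % 4 = e then 1 / 2 else 1) * α * 2 ^ m.primeFactors.card *
        (1 + if ∀ p ∈ m.primeFactors, p % 4 = 1 then w else 0)) ∧
      (genusDegree (ε * (2 * m : ℕ)) = 1 * α * 2 ^ m.primeFactors.card *
        (1 + if ∀ p ∈ m.primeFactors, p % 4 = 1 then w else 0)) := by
  have hε' : ε = 1 ∨ ε = -1 := hε.imp And.left And.left
  have hsq : ∀ m : ℕ, m % 2 = 1 → Squarefree m →
      Squarefree (ε * m) ∧ Squarefree (ε * (2 * m : ℕ)) := fun m hm hs =>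
    ⟨(squarefree_sign_mul_iff hε' m).2 hs,
      (squarefree_sign_mul_iff hε' _).2 ((squarefree_two_mul_iff hm).2 hs)⟩
  have hmod : ∀ n : ℕ, (ε * n) % 4 = 1 ↔ n % 4 = e := by
    intro n
    rcases hε with ⟨rfl, rfl⟩ | ⟨rfl, rfl⟩ <;> omega
  have he : e = 1 ∨ e = 3 := hε.imp And.right And.right
  have habs : ∀ n : ℕ, (ε * n).natAbs = n := by
    intro n
    rcases hε' with rfl | rfl <;> simp
  rcases hε' with rfl | rfl
  · refine ⟨1 / 2, 1, by norm_num, by norm_num, zero_le_one, fun m hm hs => ⟨?_, ?_⟩⟩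
    · rw [genusDegree_of_pos (hsq m hm hs).1 (Nat.odd_iff.2 hm) hs (Or.inl (habs m)) (by omega)]
      simp only [hmod]
    · rw [genusDegree_of_pos (hsq m hm hs).2 (Nat.odd_iff.2 hm) hs (Or.inr (habs _)) (by omega),
        if_neg (by rw [hmod]; omega)]
  · refine ⟨1, 0, by norm_num, by norm_num, le_rfl, fun m hm hs => ⟨?_, ?_⟩⟩
    · rw [genusDegree_of_neg (hsq m hm hs).1 (Nat.odd_iff.2 hm) hs (Or.inl (habs m)) (by omega)]
      simp only [hmod]
    · rw [genusDegree_of_neg (hsq m hm hs).2 (Nat.odd_iff.2 hm) hs (Or.inr (habs _)) (by omega),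
        if_neg (by rw [hmod]; omega)]

theorem tendsto_finsum_genusDegree_pow {ε : ℤ} {e : ℕ} (hε : ε = 1 ∧ e = 1 ∨ ε = -1 ∧ e = 3)
    (k : ℕ) : ∃ c : ℝ, 0 < c ∧
      Tendsto (fun X => (∑ᶠ d ∈ signedRadicands ε X, genusDegree d ^ (k + 1)) /
        (X * Real.log X ^ (2 ^ (k + 1) - 1))) atTop (𝓝 c) ∧
      Tendsto (fun X => (∑ᶠ d ∈ signedRadicands ε X, genusDegree d ^ k) /
        (X * Real.log X ^ (2 ^ (k + 1) - 1))) atTop (𝓝 0) := by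
  obtain ⟨α, w, hα, hαw, hw, hV⟩ := genusDegree_sign_mul hε
  have he : e = 1 ∨ e = 3 := hε.imp And.right And.right
  have he' : 4 - e = 1 ∨ 4 - e = 3 := by omega
  -- With 2^k = j + 1, the (k+1)-st moment involves (2(j+1))^ω, with logarithmic exponent 2j + 1.
  -- The k-th moment is bounded through (j+1)^ω, with exponent j < 2j + 1.
  obtain ⟨j, hj⟩ : ∃ j, 2 ^ k = j + 1 := ⟨2 ^ k - 1, (Nat.sub_add_cancel Nat.one_le_two_pow).symm⟩
  have hexp : 2 ^ (k + 1) - 1 = 2 * j + 1 := by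
    rw [pow_succ, hj]
    omega
  -- Raising to the power k + 1 keeps the shape, with (1 + w)^(k+1) - 1 in the role of w.
  have hpow : ∀ (κ : ℝ) (r : ℕ) (P : Prop) [Decidable P],
      (κ * α * 2 ^ r * (1 + if P then w else 0)) ^ (k + 1) =
      (κ * α) ^ (k + 1) * ((2 * (j + 1) : ℕ) : ℝ) ^ r *
        (1 + if P then (1 + w) ^ (k + 1) - 1 else 0) := by
    intro κ r P _
    rw [← hj, ← pow_succ', mul_pow, mul_pow]
    push_cast
    rw [← pow_mul, ← pow_mul, mul_comm r]
    split_ifs <;> simp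
  have hle : ∀ (κ : ℝ) (r : ℕ) (P : Prop) [Decidable P], 0 ≤ κ → κ ≤ 1 →
      0 ≤ (κ * α * 2 ^ r * (1 + if P then w else 0)) ^ k ∧
      (κ * α * 2 ^ r * (1 + if P then w else 0)) ^ k ≤ ((j + 1 : ℕ) : ℝ) ^ r := by
    intro κ r P _ hκ hκ'
    have h0 : 0 ≤ (1 + if P then w else 0 : ℝ) := by split_ifs <;> linarith
    have h1 : (1 + if P then w else 0 : ℝ) ≤ 1 + w := by split_ifs <;> linarith
    refine ⟨by positivity, ?_⟩
    rw [← hj]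
    push_cast
    rw [← pow_mul, mul_comm k, pow_mul]
    refine pow_le_pow_left₀ (by positivity) ?_ k
    calc κ * α * 2 ^ r * (1 + if P then w else 0) ≤ 1 * α * 2 ^ r * (1 + w) := by gcongr
      _ = α * (1 + w) * 2 ^ r := by ring
      _ ≤ 2 ^ r := mul_le_of_le_one_left (by positivity) hαw
  have hodd : ∀ {a m : ℕ}, a = 1 ∨ a = 3 → m % 4 = a → m % 2 = 1 := by omega
  have hne : 4 - e ≠ e := by omega
  have hsum : ∀ i X, (∑ᶠ d ∈ signedRadicands ε X, genusDegree d ^ i) /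
      (X * Real.log X ^ (2 ^ (k + 1) - 1)) = _ := fun i X => by
    rw [finsum_mem_signedRadicands hε (fun d => genusDegree d ^ i), hexp, add_div, add_div, add_div,
      show sqfreeMod e X = sqfreeMod e (X / 1) by rw [div_one]]
  simp only [hsum]
  have hC := sqfreeModConst_pos (2 * j + 1)
  have h := ((tendsto_sum_sqfreeMod j he one_pos (f := fun m => genusDegree (ε * m) ^ (k + 1))
      (c := (1 / 2 * α) ^ (k + 1)) (w := (1 + w) ^ (k + 1) - 1) fun m h4 hs => ?_).add
      (tendsto_sum_sqfreeMod j he' four_pos (f := fun m => genusDegree (ε * m) ^ (k + 1))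
      (c := (1 * α) ^ (k + 1)) (w := (1 + w) ^ (k + 1) - 1) fun m h4 hs => ?_)).add
      ((tendsto_sum_sqfreeMod j he (f := fun m => genusDegree (ε * (2 * m : ℕ)) ^ (k + 1))
      (c := (1 * α) ^ (k + 1)) (w := (1 + w) ^ (k + 1) - 1) (t := 8) (by norm_num)
        fun m h4 hs => ?_).add
      (tendsto_sum_sqfreeMod j he' (f := fun m => genusDegree (ε * (2 * m : ℕ)) ^ (k + 1))
      (c := (1 * α) ^ (k + 1)) (w := (1 + w) ^ (k + 1) - 1) (t := 8) (by norm_num)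
        fun m h4 hs => ?_))
  rotate_left
  · rw [(hV m (hodd he h4) hs).1, if_pos h4, hpow]
  · rw [(hV m (hodd he' h4) hs).1, if_neg (by omega), hpow]
  · rw [(hV m (hodd he h4) hs).2, hpow]
  · rw [(hV m (hodd he' h4) hs).2, hpow]
  refine ⟨_, ?_, h, ?_⟩
  · positivity
  · have h := ((tendsto_sum_sqfreeMod_zero j (n := 2 * j + 1) (by omega) he one_pos
      (f := fun m => genusDegree (ε * m) ^ k) fun m h4 hs => ?_).add
      (tendsto_sum_sqfreeMod_zero j (n := 2 * j + 1) (by omega) he' four_pos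
      (f := fun m => genusDegree (ε * m) ^ k) fun m h4 hs => ?_)).add
      ((tendsto_sum_sqfreeMod_zero j (n := 2 * j + 1) (by omega) he (t := 8) (by norm_num)
      (f := fun m => genusDegree (ε * (2 * m : ℕ)) ^ k) fun m h4 hs => ?_).add
      (tendsto_sum_sqfreeMod_zero j (n := 2 * j + 1) (by omega) he' (t := 8) (by norm_num)
      (f := fun m => genusDegree (ε * (2 * m : ℕ)) ^ k) fun m h4 hs => ?_))
    · simpa only [add_zero] using h
    · rw [(hV m (hodd he h4) hs).1, if_pos h4]
      exact hle _ _ _ (by norm_num) (by norm_num)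
    · rw [(hV m (hodd he' h4) hs).1, if_neg (by omega)]
      exact hle _ _ _ (by norm_num) (by norm_num)
    · rw [(hV m (hodd he h4) hs).2]
      exact hle _ _ _ (by norm_num) (by norm_num)
    · rw [(hV m (hodd he' h4) hs).2]
      exact hle _ _ _ (by norm_num) (by norm_num)

end radicandAsymptotics

/-! ### Sums and averages over quadratic fields -/

section quadraticFieldSums

open Finset

theorem QuadField.natCard_gal_genusExt (K : QuadField) :
    (Nat.card Gal(K.genusExt/K.1) : ℝ) = genusDegree K.radicand := by
  rw [genusDegree, ← K.two_mul_card_gal_genusExt]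
  push_cast
  ring

theorem QuadField.abs_genusSurj_sub_le (K : QuadField) (k : ℕ) :
    |(K.genusSurj (k + 1) : ℝ) - genusDegree K.radicand ^ (k + 1)| ≤
      2 ^ (k + 1) * genusDegree K.radicand ^ k := by
  have := K.finite_gal_genusExt
  obtain ⟨h1, h2⟩ := surjCount_bounds k Gal(K.genusExt/K.1) K.mul_self_gal_genusExt
  have h3 : (K.genusSurj (k + 1) : ℝ) ≤ (Nat.card Gal(K.genusExt/K.1) : ℝ) ^ (k + 1) := by
    exact_mod_cast h1
  have h4 : (Nat.card Gal(K.genusExt/K.1) : ℝ) ^ (k + 1) ≤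
      K.genusSurj (k + 1) + 2 ^ (k + 1) * (Nat.card Gal(K.genusExt/K.1) : ℝ) ^ k := by
    exact_mod_cast h2
  rw [K.natCard_gal_genusExt] at h3 h4
  have := genusDegree_nonneg K.radicand
  have h5 : 0 ≤ 2 ^ (k + 1) * genusDegree K.radicand ^ k := by positivity
  rw [abs_le]
  constructor <;> linarith

theorem quadSum_eq_sum {S : Set QuadField} (hS : S.Finite) (f : QuadField → ℕ) :
    quadSum S f = ∑ K ∈ hS.toFinset, (f K : ℝ) := by
  rw [quadSum, finsum_mem_eq_finite_toFinset_sum _ hS, Nat.cast_sum]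

theorem sum_radicand {S : Set QuadField} (hS : S.Finite) (f : ℤ → ℝ) :
    ∑ K ∈ hS.toFinset, f K.radicand = ∑ᶠ d ∈ QuadField.radicand '' S, f d := by
  rw [finsum_mem_image QuadField.radicand_injective.injOn, finsum_mem_eq_finite_toFinset_sum _ hS]

/-- The number of surjections differs from the (k+1)-st power of the degree by at most 2^(k+1) times
the k-th power, and the k-th moment is negligible by hypothesis. -/
theorem tendsto_quadSum_genusSurj {S : ℝ → Set QuadField} (hS : ∀ X, (S X).Finite) {k n : ℕ}
    {c : ℝ}
    (h1 : Tendsto (fun X => (∑ᶠ d ∈ QuadField.radicand '' S X, genusDegree d ^ (k + 1)) /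
      (X * Real.log X ^ n)) atTop (𝓝 c))
    (h2 : Tendsto (fun X => (∑ᶠ d ∈ QuadField.radicand '' S X, genusDegree d ^ k) /
      (X * Real.log X ^ n)) atTop (𝓝 0)) :
    Tendsto (fun X => quadSum (S X) (fun K => K.genusSurj (k + 1)) / (X * Real.log X ^ n)) atTop
      (𝓝 c) := by
  have h3 := h2.const_mul (2 ^ (k + 1))
  rw [mul_zero] at h3
  have h4 : Tendsto (fun X => (quadSum (S X) (fun K => K.genusSurj (k + 1)) -
      ∑ᶠ d ∈ QuadField.radicand '' S X, genusDegree d ^ (k + 1)) / (X * Real.log X ^ n)) atTop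
      (𝓝 0) := by
    refine squeeze_zero_norm' ?_ h3
    filter_upwards [eventually_gt_atTop 1] with X hX
    have := Real.log_pos hX
    rw [Real.norm_eq_abs, abs_div, abs_of_nonneg (by positivity : 0 ≤ X * Real.log X ^ n),
      ← mul_div_assoc, quadSum_eq_sum (hS X), ← sum_radicand (hS X),
      ← sum_radicand (hS X) fun d => genusDegree d ^ k, ← sum_sub_distrib, mul_sum]
    gcongr
    exact (abs_sum_le_sum_abs _ _).trans (sum_le_sum fun K _ => K.abs_genusSurj_sub_le k)
  have h5 := h4.add h1
  rw [zero_add] at h5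
  exact h5.congr fun X => by rw [← add_div, sub_add_cancel]

theorem signedRadicands_one_eq {X : ℝ} (hX : 1 ≤ X) :
    signedRadicands 1 X = insert 1 (realRadicands X) := by
  ext d
  rw [Set.mem_insert_iff]
  by_cases hd : d = 1
  · subst hd
    simpa [signedRadicands] using hX
  · simp only [signedRadicands, realRadicands, Set.mem_ofPred_eq, hd, one_mul, ne_eq,
      not_false_eq_true, true_and, false_or]

theorem signedRadicands_neg_one_eq (X : ℝ) : signedRadicands (-1) X = imagRadicands X := by
  ext d
  simp only [signedRadicands, imagRadicands, Set.mem_ofPred_eq, neg_one_mul, neg_pos]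

theorem tendsto_mul_log_pow_atTop (n : ℕ) :
    Tendsto (fun X : ℝ => X * Real.log X ^ n) atTop atTop := by
  refine tendsto_atTop_mono' _ ?_ tendsto_id
  filter_upwards [eventually_ge_atTop (Real.exp 1)] with X hX
  have h1 : 1 ≤ Real.log X := (Real.le_log_iff_exp_le ((Real.exp_pos 1).trans_le hX)).2 hX
  exact le_mul_of_one_le_right ((Real.exp_pos 1).le.trans hX) (one_le_pow₀ h1)

theorem exists_tendsto_quadSum_realQuad (k : ℕ) : ∃ c : ℝ, 0 < c ∧
    Tendsto (fun X => quadSum (realQuad X) (fun K => K.genusSurj (k + 1)) /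
      (X * Real.log X ^ (2 ^ (k + 1) - 1))) atTop (𝓝 c) := by
  obtain ⟨c, hc, h1, h2⟩ := tendsto_finsum_genusDegree_pow (Or.inl ⟨rfl, rfl⟩) k
  have key : ∀ {i : ℕ} {b : ℝ},
      Tendsto (fun X => (∑ᶠ d ∈ signedRadicands 1 X, genusDegree d ^ i) /
        (X * Real.log X ^ (2 ^ (k + 1) - 1))) atTop (𝓝 b) →
      Tendsto (fun X => (∑ᶠ d ∈ QuadField.radicand '' realQuad X, genusDegree d ^ i) /
        (X * Real.log X ^ (2 ^ (k + 1) - 1))) atTop (𝓝 b) := by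
    intro i b h
    -- The term d = 1, which is the radicand of no quadratic field, is a constant and disappears in
    -- the limit.
    have h3 := h.sub ((tendsto_const_nhds (x := genusDegree 1 ^ i)).div_atTop
      (tendsto_mul_log_pow_atTop (2 ^ (k + 1) - 1)))
    rw [sub_zero] at h3
    refine h3.congr' ?_
    filter_upwards [eventually_ge_atTop 1] with X hX
    rw [image_radicand_realQuad, signedRadicands_one_eq hX,
      finsum_mem_insert _ (fun h => h.2.1 rfl) (finite_realRadicands X), ← sub_div,
      add_sub_cancel_left]
  exact ⟨c, hc, tendsto_quadSum_genusSurj finite_realQuad (key h1) (key h2)⟩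

theorem exists_tendsto_quadSum_imagQuad (k : ℕ) : ∃ c : ℝ, 0 < c ∧
    Tendsto (fun X => quadSum (imagQuad X) (fun K => K.genusSurj (k + 1)) /
      (X * Real.log X ^ (2 ^ (k + 1) - 1))) atTop (𝓝 c) := by
  obtain ⟨c, hc, h1, h2⟩ := tendsto_finsum_genusDegree_pow (Or.inr ⟨rfl, rfl⟩) k
  simp only [signedRadicands_neg_one_eq, ← image_radicand_imagQuad] at h1 h2
  exact ⟨c, hc, tendsto_quadSum_genusSurj finite_imagQuad h1 h2⟩

theorem tendsto_quadSum_of_eq {S : ℝ → Set QuadField} (hS : ∀ X, (S X).Finite)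
    {f g : QuadField → ℕ} {v : ℝ → ℝ} {a c : ℝ}
    (h : ∀ X, ∀ K ∈ S X, (g K : ℝ) = a * f K)
    (hf : Tendsto (fun X => quadSum (S X) f / v X) atTop (𝓝 c)) :
    Tendsto (fun X => quadSum (S X) g / v X) atTop (𝓝 (a * c)) := by
  refine (hf.const_mul a).congr fun X => ?_
  rw [quadSum_eq_sum (hS X), quadSum_eq_sum (hS X), ← mul_div_assoc, mul_sum]
  congr 1
  exact sum_congr rfl fun K hK => (h X K ((hS X).mem_toFinset.1 hK)).symm

theorem isEquivalent_of_tendsto_div {u v : ℝ → ℝ} {c : ℝ} (hc : 0 < c)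
    (hv : Tendsto v atTop atTop) (h : Tendsto (fun X => u X / v X) atTop (𝓝 c)) :
    u ~[atTop] fun X => c * v X := by
  refine (isEquivalent_iff_tendsto_one ?_).2 ?_
  · filter_upwards [hv.eventually_gt_atTop 0] with X hX
    exact (mul_pos hc hX).ne'
  · have h1 := h.div_const c
    rw [div_self hc.ne'] at h1
    refine h1.congr fun X => ?_
    rw [Pi.div_apply, div_div, mul_comm]

theorem ncard_le_of_abs_radicand_le {S : Set QuadField} {X : ℝ} (hX : 1 ≤ X)
    (h : ∀ d ∈ QuadField.radicand '' S, |(d : ℝ)| ≤ X) : (S.ncard : ℝ) ≤ 3 * X := by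
  have h1 : QuadField.radicand '' S ⊆ (Icc (-⌊X⌋) ⌊X⌋ : Finset ℤ) := fun d hd => by
    have h2 := abs_le.1 (h d hd)
    have h3 : -d ≤ ⌊X⌋ := Int.le_floor.2 (by push_cast; linarith)
    exact mem_coe.2 (mem_Icc.2 ⟨by omega, Int.le_floor.2 h2.2⟩)
  have h4 := Set.ncard_le_ncard h1 (finite_toSet _)
  rw [Set.ncard_image_of_injective _ QuadField.radicand_injective, Set.ncard_coe_finset,
    Int.card_Icc] at h4
  have h5 : (1 : ℤ) ≤ ⌊X⌋ := Int.le_floor.2 (by exact_mod_cast hX)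
  have h6 : (S.ncard : ℤ) ≤ 3 * ⌊X⌋ := by omega
  have h7 : (S.ncard : ℝ) ≤ 3 * (⌊X⌋ : ℝ) := by exact_mod_cast h6
  linarith [Int.floor_le X]

/-- Divergence needs only an upper bound for the number of fields. The count of integers of absolute
value at most X gives 3X, so the average is at least the sum divided by 3X. -/
theorem tendsto_quadAverage_atTop {S : ℝ → Set QuadField} (hS : ∀ X, (S X).Finite)
    (hle : ∀ X, ∀ d ∈ QuadField.radicand '' S X, |(d : ℝ)| ≤ X) {f : QuadField → ℕ} {n : ℕ}
    (hn : n ≠ 0) {c : ℝ} (hc : 0 < c)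
    (h : Tendsto (fun X => quadSum (S X) f / (X * Real.log X ^ n)) atTop (𝓝 c)) :
    Tendsto (fun X => quadAverage (S X) f) atTop atTop := by
  have h1 : Tendsto (fun X => Real.log X ^ n / 3) atTop atTop :=
    ((tendsto_pow_atTop hn).comp Real.tendsto_log_atTop).atTop_div_const three_pos
  refine tendsto_atTop_mono' _ ?_ (h.pos_mul_atTop hc h1)
  filter_upwards [eventually_gt_atTop 1] with X hX
  have hlog := Real.log_pos hX
  have hX0 : 0 < X := by linarith
  have e : quadSum (S X) f / (X * Real.log X ^ n) * (Real.log X ^ n / 3) =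
      quadSum (S X) f / (3 * X) := by
    field_simp
  rw [e, quadAverage]
  -- If there are no fields, the average is 0/0 = 0 and the lower bound is 0 as well.
  rcases (S X).eq_empty_or_nonempty with h0 | h0
  · simp [h0, quadSum]
  · have h2 : 0 < ((S X).ncard : ℝ) := Nat.cast_pos.2 ((Set.ncard_pos (hS X)).2 h0)
    have h3 : 0 ≤ quadSum (S X) f := Nat.cast_nonneg _
    exact div_le_div_of_nonneg_left h3 h2 (ncard_le_of_abs_radicand_le hX.le (hle X))

theorem abs_radicand_le_of_realQuad (X : ℝ) :
    ∀ d ∈ QuadField.radicand '' realQuad X, |(d : ℝ)| ≤ X := by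
  rw [image_radicand_realQuad]
  exact fun _ h => abs_le_of_ite h.2.2.2

theorem abs_radicand_le_of_imagQuad (X : ℝ) :
    ∀ d ∈ QuadField.radicand '' imagQuad X, |(d : ℝ)| ≤ X := by
  rw [image_radicand_imagQuad]
  exact fun _ h => abs_le_of_ite h.2.2

theorem ncard_genusSubexts_eq (K : QuadField) (k : ℕ) :
    ((K.genusSubexts k).ncard : ℝ) = (Nat.card (MulAut (C2pow k)) : ℝ)⁻¹ * K.genusSurj k := by
  have h : (Nat.card (MulAut (C2pow k)) : ℝ) ≠ 0 :=
    Nat.cast_ne_zero.2 (natCard_mulAut_C2pow_ne_zero k)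
  rw [K.genusSurj_eq, Nat.cast_mul, mul_comm, mul_inv_cancel_right₀ h]

end quadraticFieldSums
-- Assembly of the theorem
theorem mainTheorem8 (k : ℕ) (hk : 1 ≤ k) :
    -- the subgroup `G'` of `C₂ᵏ ≀ S₂`: it is `C₂ᵏ⁺¹`, admissible, and not good
    (Nonempty (diagonalType (C2pow k) ≃* C2pow (k + 1)) ∧
      IsAdmissible (diagonalType (C2pow k)) ∧ ¬ IsGood (diagonalType (C2pow k))) ∧
    -- all the sets that are counted are finite
    (∀ X : ℝ, (realQuad X).Finite ∧ (imagQuad X).Finite ∧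
      (∀ K ∈ realQuad X, (realRigidified (diagonalType (C2pow k)) K).Finite ∧
        (realFields (diagonalType (C2pow k)) K).Finite) ∧
      (∀ ι : QBar →+* ℂ, ∀ K ∈ imagQuad X,
        (imagRigidified (diagonalType (C2pow k)) ι K).Finite ∧
        (imagFields (diagonalType (C2pow k)) ι K).Finite)) ∧
    -- real quadratic fields: asymptotics of the counts
    (∃ c c' : ℝ, 0 < c ∧ 0 < c' ∧
      (fun X : ℝ => quadSum (realQuad X)
          (fun K => (realRigidified (diagonalType (C2pow k)) K).ncard))
        ~[atTop] (fun X : ℝ => c * (X * Real.log X ^ (2 ^ k - 1))) ∧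
      (fun X : ℝ => quadSum (realQuad X)
          (fun K => (realFields (diagonalType (C2pow k)) K).ncard))
        ~[atTop] (fun X : ℝ => c' * (X * Real.log X ^ (2 ^ k - 1)))) ∧
    -- imaginary quadratic fields: asymptotics of the counts
    (∃ c c' : ℝ, 0 < c ∧ 0 < c' ∧ ∀ ι : QBar →+* ℂ,
      (fun X : ℝ => quadSum (imagQuad X)
          (fun K => (imagRigidified (diagonalType (C2pow k)) ι K).ncard))
        ~[atTop] (fun X : ℝ => c * (X * Real.log X ^ (2 ^ k - 1))) ∧
      (fun X : ℝ => quadSum (imagQuad X)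
          (fun K => (imagFields (diagonalType (C2pow k)) ι K).ncard))
        ~[atTop] (fun X : ℝ => c' * (X * Real.log X ^ (2 ^ k - 1)))) ∧
    -- the averages over real quadratic fields are infinite
    (Tendsto (fun X : ℝ => quadAverage (realQuad X)
        (fun K => (realRigidified (diagonalType (C2pow k)) K).ncard)) atTop atTop ∧
      Tendsto (fun X : ℝ => quadAverage (realQuad X)
        (fun K => (realFields (diagonalType (C2pow k)) K).ncard)) atTop atTop) ∧
    -- the averages over imaginary quadratic fields are infinite
    (∀ ι : QBar →+* ℂ,
      Tendsto (fun X : ℝ => quadAverage (imagQuad X)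
        (fun K => (imagRigidified (diagonalType (C2pow k)) ι K).ncard)) atTop atTop ∧
      Tendsto (fun X : ℝ => quadAverage (imagQuad X)
        (fun K => (imagFields (diagonalType (C2pow k)) ι K).ncard)) atTop atTop) := by
  obtain ⟨j, rfl⟩ : ∃ j, k = j + 1 := ⟨k - 1, by omega⟩
  have hn : 2 ^ (j + 1) - 1 ≠ 0 := by
    have := Nat.pow_le_pow_right two_pos hk
    omega
  have hA : 0 < (Nat.card (MulAut (C2pow (j + 1))) : ℝ)⁻¹ :=
    inv_pos.2 (Nat.cast_pos.2 (Nat.pos_of_ne_zero (natCard_mulAut_C2pow_ne_zero _)))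
  have hrad : ∀ {X : ℝ} {K : QuadField}, K ∈ imagQuad X → K.radicand < 0 := fun {X K} hK =>
    K.isTotallyComplex_iff.1 hK.1
  have hv := tendsto_mul_log_pow_atTop (2 ^ (j + 1) - 1)
  obtain ⟨c, hc, hreal⟩ := exists_tendsto_quadSum_realQuad j
  obtain ⟨c', hc', himag⟩ := exists_tendsto_quadSum_imagQuad j
  -- Relative to the count of surjections, the constants are 2^k for the twists in the real case, 1
  -- in the imaginary case, where y is prescribed, and 1/|Aut(C₂^k)| whenever ρ is forgotten.
  have h1 := tendsto_quadSum_of_eq finite_realQuad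
    (g := fun K => (realRigidified (diagonalType (C2pow (j + 1))) K).ncard) (a := 2 ^ (j + 1))
    (fun X K _ => by rw [finite_and_ncard_realRigidified.2]; push_cast; rfl) hreal
  have h2 := tendsto_quadSum_of_eq finite_realQuad
    (g := fun K => (realFields (diagonalType (C2pow (j + 1))) K).ncard)
    (fun X K _ => by rw [realFields_eq, ncard_genusSubexts_eq]) hreal
  have h3 := fun ι : QBar →+* ℂ => tendsto_quadSum_of_eq finite_imagQuad
    (g := fun K => (imagRigidified (diagonalType (C2pow (j + 1))) ι K).ncard) (a := 1)
    (fun X K hK => by rw [(finite_and_ncard_imagRigidified (hrad hK) ι).2, one_mul]) himag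
  have h4 := fun ι : QBar →+* ℂ => tendsto_quadSum_of_eq finite_imagQuad
    (g := fun K => (imagFields (diagonalType (C2pow (j + 1))) ι K).ncard)
    (fun X K hK => by rw [imagFields_eq (hrad hK), ncard_genusSubexts_eq]) himag
  have hc1 : 0 < 2 ^ (j + 1) * c := by positivity
  have hc2 := mul_pos hA hc
  have hc3 : 0 < 1 * c' := by positivity
  have hc4 := mul_pos hA hc'
  refine ⟨⟨nonempty_diagonalType_mulEquiv _, isAdmissible_diagonalType _,
    not_isGood_diagonalType hk⟩, fun X => ⟨finite_realQuad X, finite_imagQuad X,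
    fun K _ => ⟨finite_and_ncard_realRigidified.1, ?_⟩,
    fun ι K hK => ⟨(finite_and_ncard_imagRigidified (hrad hK) ι).1, ?_⟩⟩,
    ⟨_, _, hc1, hc2, isEquivalent_of_tendsto_div hc1 hv h1, isEquivalent_of_tendsto_div hc2 hv h2⟩,
    ⟨_, _, hc3, hc4, fun ι => ⟨isEquivalent_of_tendsto_div hc3 hv (h3 ι),
      isEquivalent_of_tendsto_div hc4 hv (h4 ι)⟩⟩,
    ⟨tendsto_quadAverage_atTop finite_realQuad abs_radicand_le_of_realQuad hn hc1 h1,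
      tendsto_quadAverage_atTop finite_realQuad abs_radicand_le_of_realQuad hn hc2 h2⟩,
    fun ι => ⟨tendsto_quadAverage_atTop finite_imagQuad abs_radicand_le_of_imagQuad hn hc3 (h3 ι),
      tendsto_quadAverage_atTop finite_imagQuad abs_radicand_le_of_imagQuad hn hc4 (h4 ι)⟩⟩
  · rw [realFields_eq]
    exact K.finite_genusSubexts _
  · rw [imagFields_eq (hrad hK)]
    exact K.finite_genusSubexts _
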